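/- Let $\mathbf{M}\in\mathbb{R}^{d\times k}$ with $k\ge 2$ have linearly independent columns $M_{\cdot,1},\dots,M_{\cdot,k}$, let $\mathbf{P}\in\mathbb{R}^{d\times n}$ have all its columns in the convex hull of $M_{\cdot,1},\dots,M_{\cdot,k}$, and let $\mathbf{A}\in\mathbb{R}^{d\times n}$, where $n\ge 1$. Put $\sigma=\|\mathbf{A}-\mathbf{P}\|/\sqrt n$ (spectral norm). Let $\alpha\in(0,1)$ and let $\delta>0$ be such that $\delta n$ is an integer. For $R\subseteq[n]$ write $A_{\cdot,R}=\frac1{|R|}\sum_{j\in R}A_{\cdot,j}$, and for vectors $x_1,\dots,x_s$ let $\mathrm{Null}(x_1,\dots,x_s)$ be the space of vectors orthogonal to all of them. Assume: (1) (Well-separatedness) for every $\ell\in[k]$, the orthogonal projection of $M_{\cdot,\ell}$ to $\mathrm{Null}(M_{\cdot,\ell'}:\ell'\ne\ell)$ has length at least $\alpha\max_{\ell'}|M_{\cdot,\ell'}|$; (2) (Proximate latent points) for every $\ell\in[k]$ there is $S_\ell\subseteq[n]$ with $|S_\ell|=\delta n$ and $|M_{\cdot,\ell}-P_{\cdot,j}|\le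 4\sigma/\sqrt\delta$ for all $j\in S_\ell$; (3) (Spectrally bounded perturbations) $\dfrac{\sigma}{\sqrt\delta}\le\dfrac{\alpha^3\min_\ell|M_{\cdot,\ell}|}{4500\,k^9}$. Let $0\le r\le k-1$, let $R_1,\dots,R_r\subseteq[n]$ have cardinality $\delta n$ each, and let $\ell_1,\dots,\ell_r\in[k]$ be distinct with $$|A_{\cdot,R_t}-M_{\cdot,\ell_t}|\le\frac{150k^4}{\alpha}\frac{\sigma}{\sqrt\delta}\qquad(t=1,\dots,r).$$ Let $v_1,\dots,v_k$ be the top $k$ left singular vectors of $\mathbf{A}$ (the first $k$ vectors of any orthonormal basis of left singular vectors ordered by non-increasing singular value), and let $V$ be any $k$-dimensional subspace of $\mathbb{R}^d$ with $$\sin\Theta\big(V,\mathrm{Span}(v_1,\dots,v_k)\big)\le\frac{\alpha^2}{1000k^9},\qquad\text{where } \sin\Theta(F,F')=\max_{x\in F,\,|x|=1}\ \min_{y\in F'}|x-y|.$$ Put $U=V\cap\mathrm{Null}(A_{\cdot,R_1},\dots,A_{\cdot,R_r})$. Then $\dim U=k-r$, and there is a universal constant $c$ such that, if $u$ is a uniformly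 random unit vector of $U$, then with probability at least $1-c/k^{3/2}$ the following holds: for every $S$ that maximizes $|u\cdot A_{\cdot,T}|$ over all $T\subseteq[n]$ with $|T|=\delta n$, $$\exists\,\ell\notin\{\ell_1,\dots,\ell_r\}\ \text{ such that }\ |M_{\cdot,\ell}-A_{\cdot,S}|\le\frac{150k^4}{\alpha}\frac{\sigma}{\sqrt\delta}.$$ Further, drawing $u$ and finding such a maximizer $S$ can be carried out in time $O^*(\mathrm{nnz}(\mathbf{A})+dk)$, where $\mathrm{nnz}(\mathbf{A})$ is the number of nonzero entries of $\mathbf{A}$ and $O^*$ hides logarithmic factors in $n,d,k$ and factors in $1/\delta$ and $1/\alpha$: there are a single program for a randomized real RAM (unit-cost exact real arithmetic and comparisons, index arithmetic by addition and subtraction, and draws of independent standard Gaussians) and universal constants $C,e$ such that, given $d,n,k,r,\delta n$, the nonzero entries of $\mathbf{A}$ listed by columns, $R_1,\dots,R_r$, and an orthonormal basis of $V$, the program always halts within $C\left(\frac{\log(n+d+k)}{\alpha\delta}\right)^{e}(\mathrm{nnz}(\mathbf{A})+dk)$ steps and outputs a vector $u$, which is distributed uniformly on the unit sphere of $U$,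 and a set $S$ that maximizes $|u\cdot A_{\cdot,T}|$ over $|T|=\delta n$. -/

import Mathlib

open MeasureTheory ProbabilityTheory

noncomputable section

namespace LatentSimplex

/-! ### Linear algebra -/

/-- Euclidean space `ℝ^d`. -/
abbrev Eu (d : ℕ) : Type := EuclideanSpace ℝ (Fin d)

/-- The `j`-th column of a matrix, as a point of Euclidean space. -/
def col {d n : ℕ} (A : Matrix (Fin d) (Fin n) ℝ) (j : Fin n) : Eu d :=
  WithLp.toLp 2 (fun i => A i j)

/-- The average `A_{·,R}` of the columns of `A` with index in `R`. -/
def avgCol {d n : ℕ} (A : Matrix (Fin d) (Fin n) ℝ) (R : Finset (Fin n)) : Eu d :=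
  (R.card : ℝ)⁻¹ • ∑ j ∈ R, col A j

/-- The spectral norm of a matrix. -/
def specNorm {d n : ℕ} (B : Matrix (Fin d) (Fin n) ℝ) : ℝ :=
  ‖LinearMap.toContinuousLinearMap (Matrix.toEuclideanLin B)‖

/-- `Null(s)`: the vectors orthogonal to all elements of `s`. -/
def nullOf {d : ℕ} (s : Set (Eu d)) : Submodule ℝ (Eu d) := (Submodule.span ℝ s)ᗮ

/-- `sin Θ(F, F') = max_{u ∈ F, |u| = 1} min_{v ∈ F'} |u - v|`. -/
def sinTheta {d : ℕ} (F F' : Submodule ℝ (Eu d)) : ℝ :=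
  sSup ((fun u => Metric.infDist u (F' : Set (Eu d))) '' {u | u ∈ F ∧ ‖u‖ = 1})

/-- `v` is a full orthonormal system of left singular vectors of `A`, listed in the order of
non-increasing singular values `s`. -/
def IsLeftSingularBasis {d n : ℕ} (A : Matrix (Fin d) (Fin n) ℝ)
    (v : OrthonormalBasis (Fin d) ℝ (Eu d)) : Prop :=
  ∃ s : Fin d → ℝ, Antitone s ∧ (∀ i, 0 ≤ s i) ∧
    ∀ i, (A * A.transpose).mulVec (v i).ofLp = (s i) ^ 2 • (v i).ofLp

/-- The span of the first `k` vectors of an orthonormal basis. -/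
def topSpan {d : ℕ} (v : OrthonormalBasis (Fin d) ℝ (Eu d)) (k : ℕ) : Submodule ℝ (Eu d) :=
  Submodule.span ℝ (v '' {i | i.val < k})

/-! ### The model -/

/-- `σ = ‖A - P‖ / √n`. -/
def noise {d n : ℕ} (A P : Matrix (Fin d) (Fin n) ℝ) : ℝ :=
  specNorm (A - P) / Real.sqrt n

/-- Every latent point lies in the convex hull of the columns of `M`. -/
def LatentPoints {d n k : ℕ} (P : Matrix (Fin d) (Fin n) ℝ) (M : Matrix (Fin d) (Fin k) ℝ) :
    Prop :=
  ∀ j, col P j ∈ convexHull ℝ (Set.range (col M))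

/-- Every column of `M` has a component of length at least `α max_ℓ' |M_{·,ℓ'}|` orthogonal to all
the other columns. -/
def WellSeparated {d k : ℕ} (M : Matrix (Fin d) (Fin k) ℝ) (α : ℝ) : Prop :=
  ∀ ℓ ℓ' : Fin k,
    α * ‖col M ℓ'‖ ≤ ‖(nullOf (col M '' {i | i ≠ ℓ})).starProjection (col M ℓ)‖

/-- For every vertex there are `δ n` latent points within `4 σ / √δ` of it. -/
def ProximateLatentPoints {d n k : ℕ} (A P : Matrix (Fin d) (Fin n) ℝ)
    (M : Matrix (Fin d) (Fin k) ℝ) (δ : ℝ) : Prop :=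
  ∀ ℓ : Fin k, ∃ S : Finset (Fin n), (S.card : ℝ) = δ * n ∧
    ∀ j ∈ S, ‖col M ℓ - col P j‖ ≤ 4 * noise A P / Real.sqrt δ

/-- `σ / √δ ≤ α³ min_ℓ |M_{·,ℓ}| / (4500 k⁹)`. -/
def SpectrallyBounded {d n k : ℕ} (A P : Matrix (Fin d) (Fin n) ℝ)
    (M : Matrix (Fin d) (Fin k) ℝ) (α δ : ℝ) : Prop :=
  ∀ ℓ : Fin k, noise A P / Real.sqrt δ ≤ α ^ 3 * ‖col M ℓ‖ / (4500 * (k : ℝ) ^ 9)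

/-- The error bound `(150 k⁴ / α) σ / √δ`. -/
def errBound {d n : ℕ} (A P : Matrix (Fin d) (Fin n) ℝ) (k : ℕ) (α δ : ℝ) : ℝ :=
  150 * (k : ℝ) ^ 4 / α * (noise A P / Real.sqrt δ)

/-- The subspace `U = V ∩ Null(A_{·,R_1}, …, A_{·,R_r})`. -/
def residual {d n r : ℕ} (A : Matrix (Fin d) (Fin n) ℝ) (V : Submodule ℝ (Eu d))
    (R : Fin r → Finset (Fin n)) : Submodule ℝ (Eu d) :=
  V ⊓ nullOf (Set.range fun t => avgCol A (R t))

/-- `S` maximizes `|u · A_{·,T}|` over all `T` of cardinality `m`. -/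
def IsArgmax {d n : ℕ} (A : Matrix (Fin d) (Fin n) ℝ) (m : ℕ) (u : Eu d)
    (S : Finset (Fin n)) : Prop :=
  S.card = m ∧
    ∀ T : Finset (Fin n), T.card = m → |inner ℝ u (avgCol A T)| ≤ |inner ℝ u (avgCol A S)|

/-- The law of a uniformly random unit vector of the subspace `U`: the normalized surface measure
of the unit sphere of `U`, as a measure on the ambient space. -/
def unifSphere {d : ℕ} (U : Submodule ℝ (Eu d)) : Measure (Eu d) :=
  Measure.map (fun x : Metric.sphere (0 : U) 1 => ((x : U) : Eu d))
    (((volume : Measure U).toSphere Set.univ)⁻¹ • (volume : Measure U).toSphere)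

/-- The number of nonzero entries of a matrix. -/
def nnz {d n : ℕ} (A : Matrix (Fin d) (Fin n) ℝ) : ℕ :=
  Nat.card {p : Fin d × Fin n // A p.1 p.2 ≠ 0}

/-! ### A randomized real RAM

Programs in a small imperative language. The memory consists of arrays of natural numbers (for
indices) and of arrays of real numbers (for data). Arithmetic is exact; on natural numbers only
addition and truncated subtraction are available, and real numbers cannot be converted into natural
numbers. One instruction draws an independent standard Gaussian. Every operation costs one unit. -/

/-- Index expressions. -/
inductive NExp : Type
  | lit (c : ℕ)
  | get (a : ℕ) (i j : NExp)
  | add (x y : NExp)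
  | sub (x y : NExp)

/-- Real expressions. -/
inductive RExp : Type
  | lit (q : ℚ)
  | get (a : ℕ) (i j : NExp)
  | add (x y : RExp)
  | sub (x y : RExp)
  | mul (x y : RExp)
  | div (x y : RExp)
  | sqrt (x : RExp)

/-- Tests. -/
inductive BExp : Type
  | nle (x y : NExp)
  | rle (x y : RExp)
  | not (b : BExp)
  | and (b c : BExp)

/-- Programs. `nset a i j e` and `rset a i j e` store the value of `e` in cell `(i, j)` of the
natural-number resp. real array `a`, and `gauss a i j` stores a fresh random number there. -/
inductive Prog : Type
  | skip
  | nset (a : ℕ) (i j : NExp) (e : NExp)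
  | rset (a : ℕ) (i j : NExp) (e : RExp)
  | gauss (a : ℕ) (i j : NExp)
  | seq (p q : Prog)
  | ite (b : BExp) (p q : Prog)
  | loop (b : BExp) (p : Prog)

/-- A memory state; `pos` is the number of random numbers used so far. -/
structure State : Type where
  nat : ℕ → ℕ → ℕ → ℕ
  real : ℕ → ℕ → ℕ → ℝ
  pos : ℕ

/-- The array `f` with cell `(i, j)` of array `a` overwritten by `x`. -/
def setCell {X : Type} (f : ℕ → ℕ → ℕ → X) (a i j : ℕ) (x : X) : ℕ → ℕ → ℕ → X :=
  fun a' i' j' => if a' = a ∧ i' = i ∧ j' = j then x else f a' i' j'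

def NExp.eval (s : State) : NExp → ℕ
  | .lit c => c
  | .get a i j => s.nat a (i.eval s) (j.eval s)
  | .add x y => x.eval s + y.eval s
  | .sub x y => x.eval s - y.eval s

def RExp.eval (s : State) : RExp → ℝ
  | .lit q => (q : ℝ)
  | .get a i j => s.real a (i.eval s) (j.eval s)
  | .add x y => x.eval s + y.eval s
  | .sub x y => x.eval s - y.eval s
  | .mul x y => x.eval s * y.eval s
  | .div x y => x.eval s / y.eval s
  | .sqrt x => Real.sqrt (x.eval s)

def BExp.eval (s : State) : BExp → Prop
  | .nle x y => x.eval s ≤ y.eval s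
  | .rle x y => x.eval s ≤ y.eval s
  | .not b => ¬ b.eval s
  | .and b c => b.eval s ∧ c.eval s

def NExp.cost : NExp → ℕ
  | .lit _ => 1
  | .get _ i j => i.cost + j.cost + 1
  | .add x y => x.cost + y.cost + 1
  | .sub x y => x.cost + y.cost + 1

def RExp.cost : RExp → ℕ
  | .lit _ => 1
  | .get _ i j => i.cost + j.cost + 1
  | .add x y => x.cost + y.cost + 1
  | .sub x y => x.cost + y.cost + 1
  | .mul x y => x.cost + y.cost + 1
  | .div x y => x.cost + y.cost + 1
  | .sqrt x => x.cost + 1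

def BExp.cost : BExp → ℕ
  | .nle x y => x.cost + y.cost + 1
  | .rle x y => x.cost + y.cost + 1
  | .not b => b.cost + 1
  | .and b c => b.cost + c.cost + 1

/-- `Exec ω p s t s'`: with the random numbers `ω 0, ω 1, …`, the program `p` started in state `s`
halts in state `s'` after exactly `t` steps. -/
inductive Exec (ω : ℕ → ℝ) : Prog → State → ℕ → State → Prop
  | skip (s : State) : Exec ω .skip s 1 s
  | nset (s : State) (a : ℕ) (i j e : NExp) :
      Exec ω (.nset a i j e) s (i.cost + j.cost + e.cost + 1)
        { s with nat := setCell s.nat a (i.eval s) (j.eval s) (e.eval s) }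
  | rset (s : State) (a : ℕ) (i j : NExp) (e : RExp) :
      Exec ω (.rset a i j e) s (i.cost + j.cost + e.cost + 1)
        { s with real := setCell s.real a (i.eval s) (j.eval s) (e.eval s) }
  | gauss (s : State) (a : ℕ) (i j : NExp) :
      Exec ω (.gauss a i j) s (i.cost + j.cost + 1)
        { s with real := setCell s.real a (i.eval s) (j.eval s) (ω s.pos), pos := s.pos + 1 }
  | seq {p q : Prog} {s s₁ s₂ : State} {t₁ t₂ : ℕ} :
      Exec ω p s t₁ s₁ → Exec ω q s₁ t₂ s₂ → Exec ω (.seq p q) s (t₁ + t₂) s₂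
  | ite_true {b : BExp} {p q : Prog} {s s₁ : State} {t : ℕ} :
      b.eval s → Exec ω p s t s₁ → Exec ω (.ite b p q) s (b.cost + t) s₁
  | ite_false {b : BExp} {p q : Prog} {s s₁ : State} {t : ℕ} :
      ¬ b.eval s → Exec ω q s t s₁ → Exec ω (.ite b p q) s (b.cost + t) s₁
  | loop_false {b : BExp} {p : Prog} {s : State} :
      ¬ b.eval s → Exec ω (.loop b p) s b.cost s
  | loop_true {b : BExp} {p : Prog} {s s₁ s₂ : State} {t₁ t₂ : ℕ} :
      b.eval s → Exec ω p s t₁ s₁ → Exec ω (.loop b p) s₁ t₂ s₂ →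
        Exec ω (.loop b p) s (b.cost + t₁ + t₂) s₂

/-- The law of a sequence of independent standard Gaussians. -/
def gaussTape : Measure (ℕ → ℝ) := Measure.infinitePi fun _ => gaussianReal 0 1

/-- `f 0, …, f (m - 1)` lists the elements of `S` without repetition. -/
def Lists {n : ℕ} (f : ℕ → ℕ) (m : ℕ) (S : Finset (Fin n)) : Prop :=
  Set.BijOn f (Set.Iio m) ((fun j : Fin n => j.val) '' (S : Set (Fin n)))

/-- The input of the step. Natural-number array `0` holds the sizes `d, n, k, r, m`. The matrix `A`
is stored column by column as a list of its nonzero entries: natural-number array `1` holds the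
number of nonzero entries of each column, natural-number array `2` their row indices, and real
array `0` their values. Natural-number array `3` lists the sets `R_t`. Real array `1` holds the
coordinates of an orthonormal basis `q` of `V`. All other cells are arbitrary. -/
structure IsInput {d n k r : ℕ} (A : Matrix (Fin d) (Fin n) ℝ) (m : ℕ)
    (R : Fin r → Finset (Fin n)) (q : Fin k → Eu d) (s : State) : Prop where
  size_d : s.nat 0 0 0 = d
  size_n : s.nat 0 0 1 = n
  size_k : s.nat 0 0 2 = k
  size_r : s.nat 0 0 3 = r
  size_m : s.nat 0 0 4 = m
  rows : ∀ j : Fin n,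
    Lists (s.nat 2 j.val) (s.nat 1 j.val 0) (Finset.univ.filter fun i : Fin d => A i j ≠ 0)
  vals : ∀ (j : Fin n) (p : ℕ) (i : Fin d), p < s.nat 1 j.val 0 → s.nat 2 j.val p = i.val →
    s.real 0 j.val p = A i j
  sets : ∀ t : Fin r, Lists (s.nat 3 t.val) m (R t)
  basis : ∀ (i : Fin d) (l : Fin k), s.real 1 i.val l.val = q l i
  fresh : s.pos = 0

/-- The output of the step: real array `2` holds the vector `u` and natural-number array `4` lists
the set `S`. -/
def IsOutput {d n : ℕ} (m : ℕ) (u : Eu d) (S : Finset (Fin n)) (s : State) : Prop :=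
  (∀ i : Fin d, s.real 2 i.val 0 = u i) ∧ Lists (s.nat 4 0) m S

end LatentSimplex

end

namespace LatentSimplex

/-! ### Geometry of the latent simplex -/

/-! Write `τ = σ/√δ` and `B = max |M_ℓ|`. Averaging over `δn` columns damps the perturbation to `τ`
(`norm_avgCol_sub_le`). Since `P` has rank at most `k`, such averages also lie within `τ` of the top
singular space (`norm_avgCol_sub_topSpan_le`). Hence every vertex is close to `V`
(`IsStep.norm_col_sub_le`). Replace the found vertices by their approximations and project
everything to `V`. The resulting frame is a small perturbation of `M`, so it keeps half of the
separation of `M` (`IsStep.frame_coeff_bound`). This gives `dim U = k - r`. It also shows that the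
vectors `M_ℓ` and `M_ℓ ± M_ℓ'`, for new vertices, have projections to `U` of length at least `αB/2`
(`IsStep.norm_residual_proj_ge`).

A uniform unit vector of `U` is a normalized Gaussian, and its norm before normalization is rarely
above `2√k`. A union bound over at most `3k²` vectors therefore shows that, outside an event of
probability `10/k^{3/2}`, all the inner products of `u` with these vectors are at least `αB/(8k⁴)`
in absolute value. Then one new vertex beats all other vertices in `|u · M_ℓ|` by a definite gap.
Found vertices do not compete, because `u` is orthogonal to their approximations. A maximizer is, up
to `τ`, a convex combination of vertices that must do as well as the points near the best vertex, so
almost all of its weight sits there (`IsStep.argmax_near_of_gap`).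

The program works in coordinates with respect to the basis of `V`. Gram–Schmidt applied to the
column sums over the `R_t`, followed by a Gaussian vector, produces the projection of that vector to
`U`. The columns are sorted by their inner product with `u`, and the optimal set is one of the two
ends of the sorted list (`Runs.step`). The running time is almost linear because the model forces `k
≤ 1/δ` (`IsModel.card_mul_le`) and `δn ≤ 2 nnz(A)` (`IsModel.m_le_nnz`). -/

lemma starProjection_nullOf_sum {d k : ℕ} (M : Matrix (Fin d) (Fin k) ℝ) (c : Fin k → ℝ)
    (ℓ : Fin k) :
    (nullOf (col M '' {i | i ≠ ℓ})).starProjection (∑ i, c i • col M i) =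
      c ℓ • (nullOf (col M '' {i | i ≠ ℓ})).starProjection (col M ℓ) := by
  rw [map_sum, Finset.sum_eq_single ℓ]
  · rw [map_smul]
  · intro i _ hi
    rw [map_smul]
    have : col M i ∈ Submodule.span ℝ (col M '' {i | i ≠ ℓ}) :=
      Submodule.subset_span ⟨i, hi, rfl⟩
    rw [nullOf, Submodule.starProjection_orthogonal_apply_eq_zero this, smul_zero]
  · simp

/-- Projecting orthogonally to the other columns kills every term but the `ℓ`-th, and projections do
not increase length. The index `ℓ'` is free so that it can be the longest column. -/
lemma WellSeparated.coeff_bound {d k : ℕ} {M : Matrix (Fin d) (Fin k) ℝ} {α : ℝ}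
    (h : WellSeparated M α) (c : Fin k → ℝ) (ℓ ℓ' : Fin k) :
    |c ℓ| * (α * ‖col M ℓ'‖) ≤ ‖∑ i, c i • col M i‖ := by
  have h1 := Submodule.norm_starProjection_apply_le (nullOf (col M '' {i | i ≠ ℓ}))
    (∑ i, c i • col M i)
  rw [starProjection_nullOf_sum, norm_smul, Real.norm_eq_abs] at h1
  exact (mul_le_mul_of_nonneg_left (h ℓ ℓ') (abs_nonneg _)).trans h1

/-- The conditioning of the vertices survives small perturbations. -/
lemma WellSeparated.coeff_bound_of_near {d k : ℕ} {M : Matrix (Fin d) (Fin k) ℝ} {α η : ℝ}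
    (h : WellSeparated M α) (b : Fin k → Eu d) (ℓ₀ : Fin k)
    (hb : ∀ ℓ, ‖b ℓ - col M ℓ‖ ≤ η) (hη : k * η ≤ α * ‖col M ℓ₀‖ / 2) (hη0 : 0 ≤ η)
    (c : Fin k → ℝ) (ℓ : Fin k) :
    |c ℓ| * (α * ‖col M ℓ₀‖ / 2) ≤ ‖∑ i, c i • b i‖ := by
  -- The perturbation error is at most `k |c i₀| η` for the largest coefficient, so the unperturbed
  -- bound is used at `i₀` and half of it survives; `|c ℓ| ≤ |c i₀|` gives the rest.
  obtain ⟨i₀, -, hi₀⟩ := Finset.exists_max_image Finset.univ (fun i => |c i|)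
    ⟨ℓ, Finset.mem_univ ℓ⟩
  have h1 := h.coeff_bound c i₀ ℓ₀
  have h2 : ‖∑ i, c i • col M i‖ ≤ ‖∑ i, c i • b i‖ + k * (|c i₀| * η) := by
    have : ∑ i, c i • col M i = ∑ i, c i • b i - ∑ i, c i • (b i - col M i) := by
      rw [← Finset.sum_sub_distrib]
      refine Finset.sum_congr rfl fun i _ => ?_
      rw [smul_sub]; abel
    rw [this]
    refine (norm_sub_le _ _).trans ?_
    gcongr
    refine (norm_sum_le _ _).trans ?_
    refine (Finset.sum_le_card_nsmul _ _ (|c i₀| * η) fun i _ => ?_).trans ?_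
    · rw [norm_smul, Real.norm_eq_abs]
      exact mul_le_mul (hi₀ i (Finset.mem_univ _)) (hb i) (norm_nonneg _) (abs_nonneg _)
    · simp
  have h3 := hi₀ ℓ (Finset.mem_univ _)
  have h4 : 0 ≤ α * ‖col M ℓ₀‖ / 2 := le_trans (by positivity) hη
  have h5 := mul_le_mul_of_nonneg_left hη (abs_nonneg (c i₀))
  have h6 := mul_le_mul_of_nonneg_right h3 h4
  nlinarith

lemma toEuclideanLin_indicator {d n : ℕ} (B : Matrix (Fin d) (Fin n) ℝ) (S : Finset (Fin n)) :
    Matrix.toEuclideanLin B (WithLp.toLp 2 fun j => if j ∈ S then 1 else 0) =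
      ∑ j ∈ S, col B j := by
  ext i
  simp [Matrix.toLpLin_apply, Matrix.mulVec, dotProduct, col]

lemma norm_indicator {n : ℕ} (S : Finset (Fin n)) :
    ‖(WithLp.toLp 2 fun j => if j ∈ S then 1 else 0 : Eu n)‖ = Real.sqrt S.card := by
  rw [EuclideanSpace.norm_eq]
  congr 1
  simp [apply_ite, Finset.sum_ite_mem]

lemma norm_toEuclideanLin_le {d n : ℕ} (B : Matrix (Fin d) (Fin n) ℝ) (x : Eu n) :
    ‖Matrix.toEuclideanLin B x‖ ≤ specNorm B * ‖x‖ :=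
  (LinearMap.toContinuousLinearMap (Matrix.toEuclideanLin B)).le_opNorm x

lemma specNorm_nonneg {d n : ℕ} (B : Matrix (Fin d) (Fin n) ℝ) : 0 ≤ specNorm B :=
  norm_nonneg _

/-- The sum is the image of the indicator vector of `S`, which has length `√|S|`. After division by
`|S| = δn` this becomes `σ/√δ`, the unit in which all errors are measured. -/
lemma norm_sum_col_le {d n : ℕ} (B : Matrix (Fin d) (Fin n) ℝ) (S : Finset (Fin n)) :
    ‖∑ j ∈ S, col B j‖ ≤ specNorm B * Real.sqrt S.card := by
  rw [← toEuclideanLin_indicator, ← norm_indicator]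
  exact norm_toEuclideanLin_le _ _

lemma col_sub {d n : ℕ} (A P : Matrix (Fin d) (Fin n) ℝ) (j : Fin n) :
    col (A - P) j = col A j - col P j := rfl

lemma avgCol_sub {d n : ℕ} (A P : Matrix (Fin d) (Fin n) ℝ) (S : Finset (Fin n)) :
    avgCol (A - P) S = avgCol A S - avgCol P S := by
  simp [avgCol, col_sub, smul_sub]

lemma specNorm_eq_noise {d n : ℕ} (A P : Matrix (Fin d) (Fin n) ℝ) (hn : 0 < n) :
    specNorm (A - P) = noise A P * Real.sqrt n := by
  rw [noise, div_mul_cancel₀]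
  positivity

lemma noise_nonneg {d n : ℕ} (A P : Matrix (Fin d) (Fin n) ℝ) : 0 ≤ noise A P :=
  div_nonneg (specNorm_nonneg _) (Real.sqrt_nonneg _)

lemma noise_div_sqrt {d n : ℕ} (A P : Matrix (Fin d) (Fin n) ℝ) {δ m : ℝ} (hn : 0 < n)
    (hδ : 0 < δ) (hm : m = δ * n) :
    m⁻¹ * (specNorm (A - P) * Real.sqrt m) = noise A P / Real.sqrt δ := by
  have hn' : (0 : ℝ) < n := by exact_mod_cast hn
  have h1 : Real.sqrt δ ≠ 0 := by positivity
  have h2 : Real.sqrt n ≠ 0 := by positivity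
  rw [specNorm_eq_noise A P hn, hm, Real.sqrt_mul hδ.le]
  have h3 : δ * n = (Real.sqrt δ * Real.sqrt n) * (Real.sqrt δ * Real.sqrt n) := by
    rw [mul_mul_mul_comm, Real.mul_self_sqrt hδ.le, Real.mul_self_sqrt hn'.le]
  rw [h3]
  field_simp

lemma norm_avgCol_sub_le {d n : ℕ} (A P : Matrix (Fin d) (Fin n) ℝ) {δ : ℝ} (hn : 0 < n)
    (hδ : 0 < δ) {S : Finset (Fin n)} (hS : (S.card : ℝ) = δ * n) :
    ‖avgCol A S - avgCol P S‖ ≤ noise A P / Real.sqrt δ := by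
  rw [← avgCol_sub, avgCol, norm_smul, ← noise_div_sqrt A P hn hδ hS]
  rw [Real.norm_of_nonneg (by positivity)]
  gcongr
  exact norm_sum_col_le _ _

lemma exists_weights {d n k : ℕ} {P : Matrix (Fin d) (Fin n) ℝ} {M : Matrix (Fin d) (Fin k) ℝ}
    (h : LatentPoints P M) {S : Finset (Fin n)} (hS : S.Nonempty) :
    ∃ w : Fin k → ℝ, (∀ i, 0 ≤ w i) ∧ ∑ i, w i = 1 ∧ avgCol P S = ∑ i, w i • col M i := by
  have h1 : avgCol P S ∈ convexHull ℝ (Set.range (col M)) := by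
    rw [avgCol, Finset.smul_sum]
    refine (convex_convexHull ℝ _).sum_mem (fun _ _ => by positivity) ?_ fun j _ => h j
    have : (S.card : ℝ) ≠ 0 := by exact_mod_cast hS.card_pos.ne'
    simp [this]
  rw [convexHull_range_eq_exists_affineCombination] at h1
  obtain ⟨s, w, hw0, hw1, hw⟩ := h1
  refine ⟨fun i => if i ∈ s then w i else 0, fun i => ?_, ?_, ?_⟩
  · dsimp only
    split_ifs with hi
    · exact hw0 i hi
    · exact le_rfl
  · simpa using hw1
  · rw [← hw, Finset.affineCombination_eq_linear_combination _ _ _ hw1]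
    simp [ite_smul]

/-- The constant is `4` for the proximity of the latent points plus `1` for the averaged
perturbation. -/
lemma norm_vertex_sub_avgCol_le {d n : ℕ} (A P : Matrix (Fin d) (Fin n) ℝ) {δ : ℝ} (x : Eu d)
    (hn : 0 < n) (hδ : 0 < δ) {S : Finset (Fin n)} (hS : (S.card : ℝ) = δ * n)
    (hx : ∀ j ∈ S, ‖x - col P j‖ ≤ 4 * noise A P / Real.sqrt δ) :
    ‖x - avgCol A S‖ ≤ 5 * (noise A P / Real.sqrt δ) := by
  have h1 := norm_avgCol_sub_le A P hn hδ hS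
  have hS0 : (0 : ℝ) < S.card := by rw [hS]; positivity
  have h2 : ‖x - avgCol P S‖ ≤ 4 * (noise A P / Real.sqrt δ) := by
    have : x - avgCol P S = (S.card : ℝ)⁻¹ • ∑ j ∈ S, (x - col P j) := by
      rw [Finset.sum_sub_distrib, smul_sub, avgCol, Finset.sum_const, ← Nat.cast_smul_eq_nsmul ℝ,
        smul_smul, inv_mul_cancel₀ hS0.ne', one_smul]
    rw [this, norm_smul, Real.norm_of_nonneg (by positivity), inv_mul_le_iff₀ hS0]
    refine (norm_sum_le_of_le _ hx).trans ?_
    simp [mul_div_assoc]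
  have : x - avgCol A S = (x - avgCol P S) - (avgCol A S - avgCol P S) := by abel
  rw [this]
  refine (norm_sub_le _ _).trans ?_
  linarith

/-! ### The top singular space and the perturbation. -/

lemma inner_toEuclideanLin_transpose {d n : ℕ} (A : Matrix (Fin d) (Fin n) ℝ) (x : Eu d)
    (y : Eu n) :
    inner ℝ (Matrix.toEuclideanLin A.transpose x) y = inner ℝ x (Matrix.toEuclideanLin A y) := by
  simp only [Matrix.toLpLin_apply, EuclideanSpace.inner_eq_star_dotProduct,
    star_trivial]
  rw [Matrix.mulVec_transpose, dotProduct_comm, dotProduct_comm _ x.ofLp,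
    Matrix.dotProduct_mulVec, dotProduct_comm]

lemma toEuclideanLin_transpose_apply {d n : ℕ} (A : Matrix (Fin d) (Fin n) ℝ) (x : Eu d)
    (j : Fin n) : Matrix.toEuclideanLin A.transpose x j = inner ℝ (col A j) x := by
  simp [Matrix.toLpLin_apply, Matrix.mulVec, dotProduct, col, PiLp.inner_apply, mul_comm]

/-- With `y = Bᵀx`, moving `B` across the inner product gives `|y|² = x · By ≤ |x| ‖B‖ |y|`. -/
lemma norm_toEuclideanLin_transpose_le {d n : ℕ} (B : Matrix (Fin d) (Fin n) ℝ) (x : Eu d) :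
    ‖Matrix.toEuclideanLin B.transpose x‖ ≤ specNorm B * ‖x‖ := by
  set y := Matrix.toEuclideanLin B.transpose x with hy
  have h1 : ‖y‖ * ‖y‖ ≤ (specNorm B * ‖x‖) * ‖y‖ := by
    rw [← real_inner_self_eq_norm_mul_norm]
    nth_rewrite 1 [hy]
    rw [inner_toEuclideanLin_transpose]
    refine (real_inner_le_norm _ _).trans ?_
    have := norm_toEuclideanLin_le B y
    nlinarith [norm_nonneg x, norm_nonneg y]
  rcases (norm_nonneg y).eq_or_lt with h | h
  · rw [← h]; exact mul_nonneg (specNorm_nonneg _) (norm_nonneg _)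
  · exact le_of_mul_le_mul_right h1 h

lemma norm_sq_toEuclideanLin_transpose {d n : ℕ} {A : Matrix (Fin d) (Fin n) ℝ}
    {v : OrthonormalBasis (Fin d) ℝ (Eu d)} {s : Fin d → ℝ}
    (hs : ∀ i, (A * A.transpose).mulVec (v i).ofLp = (s i) ^ 2 • (v i).ofLp) (x : Eu d) :
    ‖Matrix.toEuclideanLin A.transpose x‖ ^ 2 = ∑ i, s i ^ 2 * (inner ℝ (v i) x) ^ 2 := by
  rw [← real_inner_self_eq_norm_sq, inner_toEuclideanLin_transpose]
  have h1 : ∀ i, Matrix.toEuclideanLin A (Matrix.toEuclideanLin A.transpose (v i)) =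
      s i ^ 2 • v i := by
    intro i
    rw [Matrix.toLpLin_apply, Matrix.toLpLin_apply, Matrix.mulVec_mulVec, hs]
    rfl
  have h2 : Matrix.toEuclideanLin A (Matrix.toEuclideanLin A.transpose x) =
      ∑ i, (inner ℝ (v i) x * s i ^ 2) • v i := by
    conv_lhs => rw [← v.sum_repr' x]
    simp only [map_sum, map_smul, h1, smul_smul]
  rw [h2, inner_sum]
  refine Finset.sum_congr rfl fun i _ => ?_
  rw [inner_smul_right, real_inner_comm]
  ring

/-- The columns of `P` lie in the span of the vertices, so `Pᵀ` kills everything orthogonal to that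
span. This is how the low rank of `P` is used. -/
lemma transpose_apply_eq_zero {d n k : ℕ} {P : Matrix (Fin d) (Fin n) ℝ}
    {M : Matrix (Fin d) (Fin k) ℝ} (h : LatentPoints P M) {z : Eu d}
    (hz : ∀ ℓ, inner ℝ (col M ℓ) z = 0) : Matrix.toEuclideanLin P.transpose z = 0 := by
  ext j
  rw [toEuclideanLin_transpose_apply]
  have h1 : convexHull ℝ (Set.range (col M)) ⊆ (Submodule.span ℝ {z})ᗮ := by
    refine convexHull_min ?_ (Submodule.convex _)
    rintro _ ⟨ℓ, rfl⟩
    rw [SetLike.mem_coe, Submodule.mem_orthogonal_singleton_iff_inner_left]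
    exact hz ℓ
  exact Submodule.mem_orthogonal_singleton_iff_inner_left.1 (h1 (h j))

lemma finrank_topSpan {d k : ℕ} (v : OrthonormalBasis (Fin d) ℝ (Eu d)) (hk : k ≤ d) :
    Module.finrank ℝ (topSpan v k) = k := by
  have h1 : v '' {i | i.val < k} = Set.range fun i : Fin k => v (Fin.castLE hk i) := by
    ext x
    constructor
    · rintro ⟨i, hi, rfl⟩
      exact ⟨⟨i, hi⟩, rfl⟩
    · rintro ⟨i, rfl⟩
      exact ⟨Fin.castLE hk i, i.2, rfl⟩
  rw [topSpan, h1, finrank_span_eq_card]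
  · simp
  · exact (v.orthonormal.comp _ (Fin.castLE_injective hk)).linearIndependent

lemma inner_eq_zero_of_mem_topSpan {d k : ℕ} (v : OrthonormalBasis (Fin d) ℝ (Eu d)) {z : Eu d}
    (hz : z ∈ topSpan v k) {i : Fin d} (hi : k ≤ i.val) : inner ℝ (v i) z = 0 := by
  have : topSpan v k ≤ (Submodule.span ℝ {v i})ᗮ := by
    rw [topSpan, Submodule.span_le]
    rintro _ ⟨j, hj, rfl⟩
    rw [SetLike.mem_coe, Submodule.mem_orthogonal_singleton_iff_inner_right]
    refine v.orthonormal.2 fun h => ?_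
    subst h
    simp only [Set.mem_ofPred_eq] at hj
    omega
  exact Submodule.mem_orthogonal_singleton_iff_inner_right.1 (this hz)

/-- Orthogonally to the top singular space, the matrix is bounded by the perturbation. -/
lemma norm_transpose_le_of_mem_orthogonal {d n k : ℕ} {A P : Matrix (Fin d) (Fin n) ℝ}
    {M : Matrix (Fin d) (Fin k) ℝ} (h : LatentPoints P M)
    {v : OrthonormalBasis (Fin d) ℝ (Eu d)} (hv : IsLeftSingularBasis A v) {x : Eu d}
    (hx : x ∈ (topSpan v k)ᗮ) :
    ‖Matrix.toEuclideanLin A.transpose x‖ ≤ specNorm (A - P) * ‖x‖ := by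
  obtain ⟨s, hs, hs0, hsv⟩ := hv
  have hx0 : ∀ i : Fin d, i.val < k → inner ℝ (v i) x = 0 := fun i hi =>
    hx _ (Submodule.subset_span ⟨i, hi, rfl⟩)
  have hxn : ‖x‖ ^ 2 = ∑ i, (inner ℝ (v i) x) ^ 2 := by
    rw [← v.sum_sq_norm_inner_right x]
    simp
  refine le_of_sq_le_sq ?_ (mul_nonneg (specNorm_nonneg _) (norm_nonneg _))
  rw [norm_sq_toEuclideanLin_transpose hsv, mul_pow, hxn, Finset.mul_sum]
  by_cases hkd : k < d
  swap
  · refine Finset.sum_le_sum fun i _ => ?_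
    rw [hx0 i (by omega)]; simp
  -- Weyl's inequality by dimension count: `k` equations on a space of dimension `k + 1` leave a
  -- nonzero `z`. On it `Aᵀ` agrees with `(A - P)ᵀ`, while `|Aᵀz|` is at least `|z|` times the
  -- `(k+1)`-st singular value (index `k` counting from zero). So that singular value is at most `‖A
  -- - P‖`.
  obtain ⟨z, hz, hz0, hzM⟩ : ∃ z ∈ topSpan v (k + 1), z ≠ 0 ∧ ∀ ℓ, inner ℝ (col M ℓ) z = 0 := by
    let f : topSpan v (k + 1) →ₗ[ℝ] (Fin k → ℝ) :=
      LinearMap.pi fun ℓ => (innerₛₗ ℝ (col M ℓ)).comp (topSpan v (k + 1)).subtype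
    have hf : LinearMap.ker f ≠ ⊥ := LinearMap.ker_ne_bot_of_finrank_lt (by
      rw [finrank_topSpan v hkd]; simp)
    obtain ⟨z, hz, hz0⟩ := Submodule.exists_mem_ne_zero_of_ne_bot hf
    refine ⟨z, z.2, by simpa using hz0, fun ℓ => ?_⟩
    exact congrFun (LinearMap.mem_ker.1 hz) ℓ
  have hzn : ‖z‖ ^ 2 = ∑ i, (inner ℝ (v i) z) ^ 2 := by
    rw [← v.sum_sq_norm_inner_right z]
    simp
  have h1 : ‖Matrix.toEuclideanLin A.transpose z‖ ≤ specNorm (A - P) * ‖z‖ := by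
    have : Matrix.toEuclideanLin A.transpose z = Matrix.toEuclideanLin (A - P).transpose z := by
      rw [Matrix.transpose_sub, map_sub, LinearMap.sub_apply, transpose_apply_eq_zero h hzM,
        sub_zero]
    rw [this]
    exact norm_toEuclideanLin_transpose_le _ _
  have h2 : s ⟨k, hkd⟩ ^ 2 * ‖z‖ ^ 2 ≤ ‖Matrix.toEuclideanLin A.transpose z‖ ^ 2 := by
    rw [norm_sq_toEuclideanLin_transpose hsv, hzn, Finset.mul_sum]
    refine Finset.sum_le_sum fun i _ => ?_
    by_cases hi : i.val ≤ k
    · have := hs (show i ≤ ⟨k, hkd⟩ from hi)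
      have := hs0 ⟨k, hkd⟩
      gcongr
    · rw [inner_eq_zero_of_mem_topSpan v hz (by omega)]; simp
  have h3 : s ⟨k, hkd⟩ ^ 2 ≤ specNorm (A - P) ^ 2 := by
    have hzp : 0 < ‖z‖ ^ 2 := by positivity
    refine le_of_mul_le_mul_right ?_ hzp
    rw [← mul_pow (specNorm _)]
    exact h2.trans (by gcongr)
  refine Finset.sum_le_sum fun i _ => ?_
  by_cases hi : i.val < k
  · rw [hx0 i hi]; simp
  · have := hs (show (⟨k, hkd⟩ : Fin d) ≤ i from not_lt.1 hi)
    refine mul_le_mul_of_nonneg_right (le_trans ?_ h3) (sq_nonneg _)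
    have := hs0 i
    gcongr

/-- Let `y` be the component orthogonal to the top space. Then `|y|² = y · A_S` is the inner product
of `Aᵀy` with the indicator vector of `S`, divided by `|S|`, and `Aᵀ` is bounded by `‖A - P‖` at
`y`. -/
lemma norm_avgCol_sub_topSpan_le {d n k : ℕ} {A P : Matrix (Fin d) (Fin n) ℝ}
    {M : Matrix (Fin d) (Fin k) ℝ} (h : LatentPoints P M)
    {v : OrthonormalBasis (Fin d) ℝ (Eu d)} (hv : IsLeftSingularBasis A v) {δ : ℝ} (hn : 0 < n)
    (hδ : 0 < δ) {S : Finset (Fin n)} (hS : (S.card : ℝ) = δ * n) :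
    ‖avgCol A S - (topSpan v k).starProjection (avgCol A S)‖ ≤ noise A P / Real.sqrt δ := by
  set y := avgCol A S - (topSpan v k).starProjection (avgCol A S) with hy
  have hyo : y ∈ (topSpan v k)ᗮ := Submodule.sub_starProjection_mem_orthogonal _
  have h1 : ‖y‖ * ‖y‖ = inner ℝ y (avgCol A S) := by
    rw [← real_inner_self_eq_norm_mul_norm]
    nth_rewrite 2 [hy]
    rw [inner_sub_right, Submodule.inner_left_of_mem_orthogonal
      (Submodule.starProjection_apply_mem _ _) hyo, sub_zero]
  have h2 : ‖y‖ * ‖y‖ ≤ noise A P / Real.sqrt δ * ‖y‖ := by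
    rw [h1, avgCol, inner_smul_right, ← toEuclideanLin_indicator,
      ← inner_toEuclideanLin_transpose, ← noise_div_sqrt A P hn hδ hS]
    have h3 := (real_inner_le_norm (Matrix.toEuclideanLin A.transpose y)
      (WithLp.toLp 2 fun j => if j ∈ S then 1 else 0)).trans
      (mul_le_mul_of_nonneg_right (norm_transpose_le_of_mem_orthogonal h hv hyo) (norm_nonneg _))
    rw [norm_indicator] at h3
    calc _ ≤ _ := mul_le_mul_of_nonneg_left h3 (by positivity)
      _ = _ := by ring
  rcases (norm_nonneg y).eq_or_lt with h | h
  · rw [← h]; exact div_nonneg (noise_nonneg _ _) (Real.sqrt_nonneg _)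
  · exact le_of_mul_le_mul_right h2 h

lemma infDist_eq_norm_sub_starProjection {d : ℕ} (F : Submodule ℝ (Eu d)) (x : Eu d) :
    Metric.infDist x (F : Set (Eu d)) = ‖x - F.starProjection x‖ := by
  rw [Submodule.starProjection_minimal, Metric.infDist_eq_iInf]
  simp [dist_eq_norm]

lemma norm_sub_starProjection_le_sinTheta {d : ℕ} (F F' : Submodule ℝ (Eu d)) {x : Eu d}
    (hx : x ∈ F) : ‖x - F'.starProjection x‖ ≤ sinTheta F F' * ‖x‖ := by
  rcases eq_or_ne x 0 with rfl | h0
  · simp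
  have hx0 : 0 < ‖x‖ := norm_pos_iff.2 h0
  -- The supremum of an unbounded set would default to `0`; here `0 ∈ F'` bounds the distances by
  -- `1`.
  have hb : BddAbove ((fun u => Metric.infDist u (F' : Set (Eu d))) '' {u | u ∈ F ∧ ‖u‖ = 1}) := by
    refine ⟨1, ?_⟩
    rintro _ ⟨u, ⟨-, hu⟩, rfl⟩
    refine (Metric.infDist_le_dist_of_mem (SetLike.mem_coe.2 F'.zero_mem)).trans ?_
    simp [hu]
  have h1 := le_csSup hb ⟨‖x‖⁻¹ • x, ⟨F.smul_mem _ hx, norm_smul_inv_norm h0⟩, rfl⟩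
  simp only [infDist_eq_norm_sub_starProjection, map_smul, ← smul_sub, norm_smul, norm_inv,
    norm_norm] at h1
  rw [inv_mul_le_iff₀ hx0, mul_comm] at h1
  simpa only [sinTheta, infDist_eq_norm_sub_starProjection] using h1

/-- For subspaces of equal dimension, closeness is symmetric. -/
lemma norm_sub_starProjection_le_of_sinTheta {d : ℕ} (F F' : Submodule ℝ (Eu d))
    (hF : Module.finrank ℝ F = Module.finrank ℝ F') {ε : ℝ} (hε : sinTheta F F' ≤ ε)
    (hε' : ε ≤ 1 / 2) {y : Eu d} (hy : y ∈ F') : ‖y - F.starProjection y‖ ≤ 2 * ε * ‖y‖ := by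
  have hnear : ∀ x ∈ F, ‖x - F'.starProjection x‖ ≤ ε * ‖x‖ := fun x hx =>
    (norm_sub_starProjection_le_sinTheta F F' hx).trans
      (mul_le_mul_of_nonneg_right hε (norm_nonneg _))
  -- Since `ε < 1`, the projection from `F` to `F'` is injective, hence bijective by equality of
  -- dimensions. The preimage `x` of `y` is within `ε|x| ≤ 2ε|y|` of `y`.
  let f : F →ₗ[ℝ] F' := (F'.orthogonalProjectionOnto.comp F.subtypeL).toLinearMap
  have hf : ∀ x : F, (f x : Eu d) = F'.starProjection x := fun x => rfl
  have hinj : Function.Injective f := by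
    rw [injective_iff_map_eq_zero]
    intro x hx
    have h1 := hnear x x.2
    rw [← hf, hx] at h1
    simp only [ZeroMemClass.coe_zero, sub_zero] at h1
    have : ‖(x : Eu d)‖ = 0 := by nlinarith [norm_nonneg (x : Eu d)]
    simpa using this
  obtain ⟨x, hx⟩ := (LinearMap.injective_iff_surjective_of_finrank_eq_finrank hF).1 hinj ⟨y, hy⟩
  have hxy : F'.starProjection x = y := by rw [← hf, hx]
  have h1 := hnear x x.2
  rw [hxy] at h1
  have h2 : ‖(x : Eu d)‖ ≤ ‖y‖ + ‖(x : Eu d) - y‖ := by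
    have := norm_add_le y ((x : Eu d) - y)
    rwa [add_sub_cancel] at this
  have h3 : ‖y - F.starProjection y‖ ≤ ‖(x : Eu d) - y‖ := by
    rw [← infDist_eq_norm_sub_starProjection, ← dist_eq_norm, dist_comm]
    exact Metric.infDist_le_dist_of_mem x.2
  -- The sign of `ε` is not assumed; a negative `ε` forces `x = 0`.
  have h4 : 0 ≤ ε ∨ ‖(x : Eu d)‖ ≤ 0 := by
    by_contra! hcon
    nlinarith [norm_nonneg ((x : Eu d) - y)]
  rcases h4 with h4 | h4
  · have h5 : ε * ‖(x : Eu d)‖ ≤ 1 / 2 * ‖(x : Eu d)‖ :=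
      mul_le_mul_of_nonneg_right hε' (norm_nonneg _)
    have h6 : ‖(x : Eu d)‖ ≤ 2 * ‖y‖ := by linarith
    have h7 := mul_le_mul_of_nonneg_left h6 h4
    linarith
  · have hx0 : (x : Eu d) = 0 := norm_le_zero_iff.1 h4
    have : y = 0 := by rw [← hxy, hx0, map_zero]
    simp [this]

/-- The standing assumptions on the data matrix, the latent points and the vertices. -/
structure IsModel {d n k : ℕ} (A P : Matrix (Fin d) (Fin n) ℝ) (M : Matrix (Fin d) (Fin k) ℝ)
    (α δ : ℝ) (m : ℕ) : Prop where
  two_le : 2 ≤ k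
  n_pos : 0 < n
  α_pos : 0 < α
  α_lt : α < 1
  δ_pos : 0 < δ
  m_eq : (m : ℝ) = δ * n
  indep : LinearIndependent ℝ (col M)
  latent : LatentPoints P M
  sep : WellSeparated M α
  prox : ProximateLatentPoints A P M δ
  spec : SpectrallyBounded A P M α δ

/-- The assumptions on the approximations found so far and on the subspace `V`. -/
structure IsStep {d n k r : ℕ} (A P : Matrix (Fin d) (Fin n) ℝ) (M : Matrix (Fin d) (Fin k) ℝ)
    (α δ : ℝ) (m : ℕ) (R : Fin r → Finset (Fin n)) (L : Fin r → Fin k)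
    (v : OrthonormalBasis (Fin d) ℝ (Eu d)) (V : Submodule ℝ (Eu d)) : Prop
    extends IsModel A P M α δ m where
  r_lt : r < k
  card_R : ∀ t, (R t).card = m
  inj : Function.Injective L
  near : ∀ t, ‖avgCol A (R t) - col M (L t)‖ ≤ errBound A P k α δ
  sing : IsLeftSingularBasis A v
  rank_V : Module.finrank ℝ V = k
  sin_le : sinTheta V (topSpan v k) ≤ α ^ 2 / (1000 * (k : ℝ) ^ 9)

/-- The numerical content of the spectral assumption, with `X = K⁴τ/α` as error scale, so that the
allowed error is `150 X`. The third bound is the smallness condition needed to perturb the vertices: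
`K` times the displacement of a frame vector is at most half of the separation. -/
lemma scaled_noise_bounds {K α B τ : ℝ} (hK : 2 ≤ K) (hα : 0 < α) (hα1 : α < 1) (hB : 0 < B)
    (hτ0 : 0 ≤ τ) (hτ : τ ≤ α ^ 3 * B / (4500 * K ^ 9)) :
    τ ≤ K ^ 4 / α * τ ∧ 4500 * K ^ 5 * (K ^ 4 / α * τ) ≤ α ^ 2 * B ∧
      K * (150 * (K ^ 4 / α * τ) + 6 * τ + 2 * (α ^ 2 / (1000 * K ^ 9)) * B) ≤ α * B / 2 := by
  have hK0 : 0 < K := by linarith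
  have hK4 : 16 ≤ K ^ 4 := by
    calc (16 : ℝ) = 2 ^ 4 := by norm_num
      _ ≤ K ^ 4 := by gcongr
  have h1 : τ ≤ K ^ 4 / α * τ := by
    have : 1 ≤ K ^ 4 / α := by rw [le_div_iff₀ hα]; linarith
    nlinarith
  have h2 : 4500 * K ^ 5 * (K ^ 4 / α * τ) ≤ α ^ 2 * B := by
    rw [le_div_iff₀ (by positivity)] at hτ
    have : 4500 * K ^ 5 * (K ^ 4 / α * τ) = (τ * (4500 * K ^ 9)) / α := by field_simp
    rw [this, div_le_iff₀ hα]
    linarith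
  refine ⟨h1, h2, ?_⟩
  set X := K ^ 4 / α * τ with hX
  have hX0 : 0 ≤ X := by positivity
  have hαB : α ^ 2 * B ≤ α * B := by nlinarith [mul_pos hα hB]
  -- Here `72000 = 4500 · 16`, from `K⁴ ≥ 16`.
  have h3 : 72000 * (K * X) ≤ α * B := by
    have h4 : 4500 * K ^ 5 * X = 4500 * (K ^ 4 * (K * X)) := by ring
    have h5 : 16 * (K * X) ≤ K ^ 4 * (K * X) := mul_le_mul_of_nonneg_right hK4 (by positivity)
    linarith
  have h6 : K * (2 * (α ^ 2 / (1000 * K ^ 9)) * B) = α ^ 2 * B / (500 * K ^ 8) := by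
    field_simp
    norm_num
  have h7 : α ^ 2 * B / (500 * K ^ 8) ≤ α * B / 500 := by
    have hK8 : 1 ≤ K ^ 8 := one_le_pow₀ (by linarith)
    refine div_le_div₀ (by positivity) hαB (by norm_num) (by linarith)
  have h8 : K * τ ≤ K * X := mul_le_mul_of_nonneg_left h1 hK0.le
  have h9 := mul_pos hα hB
  have h10 : K * (150 * X + 6 * τ + 2 * (α ^ 2 / (1000 * K ^ 9)) * B) =
      150 * (K * X) + 6 * (K * τ) + K * (2 * (α ^ 2 / (1000 * K ^ 9)) * B) := by ring
  rw [h10, h6]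
  linarith

/-! ### Conditioning of the projected frame and the residual space. -/

section Model

variable {d n k m : ℕ} {A P : Matrix (Fin d) (Fin n) ℝ} {M : Matrix (Fin d) (Fin k) ℝ} {α δ : ℝ}

lemma IsModel.norm_col_pos (h : IsModel A P M α δ m) (ℓ : Fin k) : 0 < ‖col M ℓ‖ :=
  norm_pos_iff.2 (h.indep.ne_zero ℓ)

lemma IsModel.exists_max (h : IsModel A P M α δ m) : ∃ ℓ₀, ∀ ℓ, ‖col M ℓ‖ ≤ ‖col M ℓ₀‖ := by
  have : Nonempty (Fin k) := ⟨⟨0, by have := h.two_le; omega⟩⟩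
  exact Finite.exists_max fun ℓ => ‖col M ℓ‖

lemma IsModel.two_le_real (h : IsModel A P M α δ m) : (2 : ℝ) ≤ k := by exact_mod_cast h.two_le

lemma IsModel.m_pos (h : IsModel A P M α δ m) : 0 < m := by
  have h1 : (0 : ℝ) < m := by
    rw [h.m_eq]
    exact mul_pos h.δ_pos (by exact_mod_cast h.n_pos)
  exact_mod_cast h1

lemma IsModel.noise_nonneg (_h : IsModel A P M α δ m) : 0 ≤ noise A P / Real.sqrt δ :=
  div_nonneg (LatentSimplex.noise_nonneg _ _) (Real.sqrt_nonneg _)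

lemma IsModel.scaled_noise_bounds (h : IsModel A P M α δ m) (ℓ : Fin k) :
    noise A P / Real.sqrt δ ≤ (k : ℝ) ^ 4 / α * (noise A P / Real.sqrt δ) ∧
      4500 * (k : ℝ) ^ 5 * ((k : ℝ) ^ 4 / α * (noise A P / Real.sqrt δ)) ≤ α ^ 2 * ‖col M ℓ‖ ∧
      k * (150 * ((k : ℝ) ^ 4 / α * (noise A P / Real.sqrt δ)) + 6 * (noise A P / Real.sqrt δ) +
        2 * (α ^ 2 / (1000 * (k : ℝ) ^ 9)) * ‖col M ℓ‖) ≤ α * ‖col M ℓ‖ / 2 :=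
  LatentSimplex.scaled_noise_bounds h.two_le_real h.α_pos h.α_lt (h.norm_col_pos ℓ) h.noise_nonneg
    (h.spec ℓ)

lemma errBound_eq : errBound A P k α δ =
    150 * ((k : ℝ) ^ 4 / α * (noise A P / Real.sqrt δ)) := by
  rw [errBound]; ring

variable {r : ℕ} {R : Fin r → Finset (Fin n)} {L : Fin r → Fin k}
  {v : OrthonormalBasis (Fin d) ℝ (Eu d)} {V : Submodule ℝ (Eu d)}

lemma IsStep.k_le_d (h : IsStep A P M α δ m R L v V) : k ≤ d := by
  have := Submodule.finrank_le V
  rw [h.rank_V] at this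
  simpa using this

/-- Every vertex is close to `V`. -/
lemma IsStep.norm_col_sub_le (h : IsStep A P M α δ m R L v V) (ℓ : Fin k) :
    ‖col M ℓ - V.starProjection (col M ℓ)‖ ≤
      6 * (noise A P / Real.sqrt δ) + 2 * (α ^ 2 / (1000 * (k : ℝ) ^ 9)) * ‖col M ℓ‖ := by
  obtain ⟨S, hS, hSM⟩ := h.prox ℓ
  set T := topSpan v k with hT
  have hε : α ^ 2 / (1000 * (k : ℝ) ^ 9) ≤ 1 / 2 := by
    have h1 : (1 : ℝ) ≤ (k : ℝ) ^ 9 := one_le_pow₀ (by linarith [h.two_le_real])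
    have h2 : α ^ 2 ≤ 1 := pow_le_one₀ h.α_pos.le h.α_lt.le
    rw [div_le_iff₀ (by positivity)]
    linarith
  -- The `6` is `5` from the vertex to the average of its proximate columns and `1` from there to
  -- the top singular space.
  have h1 : ‖col M ℓ - T.starProjection (col M ℓ)‖ ≤ 6 * (noise A P / Real.sqrt δ) := by
    have h2 := norm_vertex_sub_avgCol_le A P (col M ℓ) h.n_pos h.δ_pos hS hSM
    have h3 := norm_avgCol_sub_topSpan_le h.latent h.sing h.n_pos h.δ_pos hS
    rw [← hT] at h3
    rw [← infDist_eq_norm_sub_starProjection]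
    refine (Metric.infDist_le_dist_of_mem
      (Submodule.starProjection_apply_mem T (avgCol A S))).trans ?_
    refine (dist_triangle _ (avgCol A S) _).trans ?_
    rw [dist_eq_norm, dist_eq_norm]
    linarith
  -- The angle hypothesis goes from `V` to the top space and is needed in the other direction; this
  -- costs the factor `2`.
  have h4 := norm_sub_starProjection_le_of_sinTheta V T
    (by rw [h.rank_V, finrank_topSpan v h.k_le_d]) h.sin_le hε
    (Submodule.starProjection_apply_mem T (col M ℓ))
  have h5 := Submodule.norm_starProjection_apply_le T (col M ℓ)
  rw [← infDist_eq_norm_sub_starProjection]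
  refine (Metric.infDist_le_dist_of_mem
      (Submodule.starProjection_apply_mem V (T.starProjection (col M ℓ)))).trans ?_
  refine (dist_triangle _ (T.starProjection (col M ℓ)) _).trans ?_
  rw [dist_eq_norm, dist_eq_norm]
  refine add_le_add h1 (h4.trans ?_)
  have := h.α_pos
  gcongr

/-- The projections to `V` of the approximations found so far and of the other vertices. -/
noncomputable def frame (A : Matrix (Fin d) (Fin n) ℝ) (M : Matrix (Fin d) (Fin k) ℝ)
    (R : Fin r → Finset (Fin n)) (L : Fin r → Fin k) (V : Submodule ℝ (Eu d)) : Fin k → Eu d :=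
  Function.extend L (fun t => V.starProjection (avgCol A (R t)))
    fun ℓ => V.starProjection (col M ℓ)

lemma IsStep.frame_found (h : IsStep A P M α δ m R L v V) (t : Fin r) :
    frame A M R L V (L t) = V.starProjection (avgCol A (R t)) :=
  h.inj.extend_apply _ _ _

lemma frame_other {ℓ : Fin k} (hℓ : ℓ ∉ Set.range L) :
    frame A M R L V ℓ = V.starProjection (col M ℓ) :=
  Function.extend_apply' _ _ _ hℓ

/-- Each frame vector is near its vertex: projecting to `V` moves a vertex little, and a found
vertex is moved by at most `150 X` more. The separation of the vertices therefore survives with half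
its constant. -/
lemma IsStep.frame_coeff_bound (h : IsStep A P M α δ m R L v V) {ℓ₀ : Fin k}
    (hℓ₀ : ∀ ℓ, ‖col M ℓ‖ ≤ ‖col M ℓ₀‖) (c : Fin k → ℝ) (ℓ : Fin k) :
    |c ℓ| * (α * ‖col M ℓ₀‖ / 2) ≤ ‖∑ i, c i • frame A M R L V i‖ := by
  have h0 := h.noise_nonneg
  have hα := h.α_pos
  refine h.sep.coeff_bound_of_near _ ℓ₀ (fun ℓ => ?_) (h.scaled_noise_bounds ℓ₀).2.2
    (by positivity) c ℓ
  have h1 : ‖V.starProjection (col M ℓ) - col M ℓ‖ ≤ 6 * (noise A P / Real.sqrt δ) +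
      2 * (α ^ 2 / (1000 * (k : ℝ) ^ 9)) * ‖col M ℓ₀‖ := by
    rw [norm_sub_rev]
    refine (h.norm_col_sub_le ℓ).trans ?_
    have := hℓ₀ ℓ
    gcongr
  by_cases hℓ : ℓ ∈ Set.range L
  · obtain ⟨t, rfl⟩ := hℓ
    rw [h.frame_found]
    have h2 : V.starProjection (avgCol A (R t)) - col M (L t) =
        V.starProjection (avgCol A (R t) - col M (L t)) +
          (V.starProjection (col M (L t)) - col M (L t)) := by
      rw [map_sub]; abel
    rw [h2]
    refine (norm_add_le _ _).trans ?_
    have h3 := (Submodule.norm_starProjection_apply_le V _).trans (h.near t)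
    rw [errBound_eq] at h3
    linarith
  · rw [frame_other hℓ]
    refine h1.trans ?_
    have : 0 ≤ 150 * ((k : ℝ) ^ 4 / α * (noise A P / Real.sqrt δ)) := by positivity
    linarith

lemma IsStep.frame_linearIndependent (h : IsStep A P M α δ m R L v V) :
    LinearIndependent ℝ (frame A M R L V) := by
  obtain ⟨ℓ₀, hℓ₀⟩ := h.exists_max
  rw [Fintype.linearIndependent_iff]
  intro c hc ℓ
  have h1 := h.frame_coeff_bound hℓ₀ c ℓ
  rw [hc, norm_zero] at h1
  have h2 : 0 < α * ‖col M ℓ₀‖ / 2 := by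
    have := h.norm_col_pos ℓ₀
    have := h.α_pos
    positivity
  have h3 : |c ℓ| ≤ 0 := le_of_mul_le_mul_right (by simpa using h1) h2
  simpa using h3

/-- The span of the projections to `V` of the approximations found so far. -/
def foundSpan (A : Matrix (Fin d) (Fin n) ℝ) (R : Fin r → Finset (Fin n))
    (V : Submodule ℝ (Eu d)) : Submodule ℝ (Eu d) :=
  Submodule.span ℝ (Set.range fun t => V.starProjection (avgCol A (R t)))

lemma foundSpan_le (A : Matrix (Fin d) (Fin n) ℝ) (R : Fin r → Finset (Fin n))
    (V : Submodule ℝ (Eu d)) : foundSpan A R V ≤ V := by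
  rw [foundSpan, Submodule.span_le]
  rintro _ ⟨t, rfl⟩
  exact Submodule.starProjection_apply_mem _ _

lemma mem_orthogonal_span_range {E ι : Type*} [NormedAddCommGroup E] [InnerProductSpace ℝ E]
    {f : ι → E} {x : E} :
    x ∈ (Submodule.span ℝ (Set.range f))ᗮ ↔ ∀ t, inner ℝ (f t) x = 0 := by
  refine ⟨fun h t => h _ (Submodule.subset_span ⟨t, rfl⟩), fun h => ?_⟩
  have h1 : Submodule.span ℝ (Set.range f) ≤ (Submodule.span ℝ {x})ᗮ := by
    rw [Submodule.span_le]
    rintro _ ⟨t, rfl⟩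
    exact Submodule.mem_orthogonal_singleton_iff_inner_left.2 (h t)
  exact fun y hy => Submodule.mem_orthogonal_singleton_iff_inner_left.1 (h1 hy)

/-- A vector of `V` has the same inner product with a vector as with its projection to `V`. So the
residual space is an orthogonal complement inside `V`, which gives its dimension and its projection.
-/
lemma residual_eq (A : Matrix (Fin d) (Fin n) ℝ) (R : Fin r → Finset (Fin n))
    (V : Submodule ℝ (Eu d)) : residual A V R = (foundSpan A R V)ᗮ ⊓ V := by
  ext x
  simp only [residual, nullOf, foundSpan, Submodule.mem_inf, and_comm (b := x ∈ V)]
  refine and_congr_right fun hx => ?_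
  simp only [mem_orthogonal_span_range]
  refine forall_congr' fun t => ?_
  rw [Submodule.inner_starProjection_left_eq_right, Submodule.starProjection_eq_self_iff.2 hx]

lemma IsStep.finrank_residual (h : IsStep A P M α δ m R L v V) :
    Module.finrank ℝ (residual A V R) + r = k := by
  have h1 : Module.finrank ℝ (foundSpan A R V) = r := by
    rw [foundSpan, finrank_span_eq_card, Fintype.card_fin]
    have := h.frame_linearIndependent.comp L h.inj
    convert this using 1
    ext1 t
    exact (h.frame_found t).symm
  have h2 := Submodule.finrank_add_inf_finrank_orthogonal (foundSpan_le A R V)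
  rw [h1, ← residual_eq, h.rank_V] at h2
  omega

/-- The projections of `w` to `V` and to `U` differ by an element of `foundSpan`. As `w` involves
new vertices only, its projection to `U` is a combination of the frame whose coefficients at new
vertices are still those of `w`. The conditioning of the frame then bounds it from below. -/
lemma IsStep.norm_residual_proj_ge (h : IsStep A P M α δ m R L v V) {ℓ₀ : Fin k}
    (hℓ₀ : ∀ ℓ, ‖col M ℓ‖ ≤ ‖col M ℓ₀‖) (c : Fin k → ℝ) (hc : ∀ t, c (L t) = 0) (ℓ : Fin k)
    (hℓ : ℓ ∉ Set.range L) :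
    |c ℓ| * (α * ‖col M ℓ₀‖ / 2) ≤
      ‖(residual A V R).starProjection (∑ i, c i • col M i)‖ := by
  set w := ∑ i, c i • col M i with hw
  set U := residual A V R with hU
  have hUV : U ≤ V := inf_le_left
  have h1 : V.starProjection w - U.starProjection w ∈ foundSpan A R V := by
    have h2 : V.starProjection w - U.starProjection w ∈ V :=
      V.sub_mem (Submodule.starProjection_apply_mem _ _)
        (hUV (Submodule.starProjection_apply_mem _ _))
    have h3 : V.starProjection w - (foundSpan A R V).starProjection w =
        U.starProjection w := by
      refine (Submodule.eq_starProjection_of_mem_orthogonal ?_ ?_).symm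
      · rw [hU, residual_eq]
        refine ⟨?_, V.sub_mem (Submodule.starProjection_apply_mem _ _)
          (foundSpan_le A R V (Submodule.starProjection_apply_mem _ _))⟩
        have : V.starProjection w - (foundSpan A R V).starProjection w =
          (w - (foundSpan A R V).starProjection w) - (w - V.starProjection w) := by abel
        rw [this]
        exact Submodule.sub_mem _ (Submodule.sub_starProjection_mem_orthogonal _)
          (Submodule.orthogonal_le (foundSpan_le A R V)
            (Submodule.sub_starProjection_mem_orthogonal _))
      · have : w - (V.starProjection w - (foundSpan A R V).starProjection w) =
          (w - V.starProjection w) + (foundSpan A R V).starProjection w := by abel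
        rw [this]
        refine Submodule.add_mem _ (Submodule.orthogonal_le hUV
            (Submodule.sub_starProjection_mem_orthogonal _)) ?_
        have h4 : U ≤ (foundSpan A R V)ᗮ := by rw [hU, residual_eq]; exact inf_le_left
        exact Submodule.le_orthogonal_iff_le_orthogonal.1 h4
          (Submodule.starProjection_apply_mem _ _)
    rw [← h3, sub_sub_cancel]
    exact Submodule.starProjection_apply_mem _ _
  obtain ⟨x, hx⟩ := (Submodule.mem_span_range_iff_exists_fun ℝ).1 h1
  have h5 : U.starProjection w =
      ∑ i, Function.extend L (fun t => - x t) c i • frame A M R L V i := by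
    have h6 : V.starProjection w =
        ∑ i, Function.extend L (fun _ => 0) c i • frame A M R L V i := by
      rw [hw, map_sum]
      refine Finset.sum_congr rfl fun i _ => ?_
      rw [map_smul]
      by_cases hi : i ∈ Set.range L
      · obtain ⟨t, rfl⟩ := hi
        rw [hc, h.inj.extend_apply, zero_smul, zero_smul]
      · rw [Function.extend_apply' _ _ _ hi, frame_other hi]
    have h7 : ∑ t, x t • V.starProjection (avgCol A (R t)) =
        ∑ i, Function.extend L x 0 i • frame A M R L V i := by
      rw [← Fintype.sum_of_injective L h.inj]
      · intro i hi
        rw [Function.extend_apply' _ _ _ hi, Pi.zero_apply, zero_smul]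
      · intro t
        rw [h.inj.extend_apply, h.frame_found]
    rw [← sub_sub_cancel (V.starProjection w) (U.starProjection w), ← hx, h6, h7,
      ← Finset.sum_sub_distrib]
    refine Finset.sum_congr rfl fun i _ => ?_
    rw [← sub_smul]
    congr 1
    by_cases hi : i ∈ Set.range L
    · obtain ⟨t, rfl⟩ := hi
      simp [h.inj.extend_apply]
    · simp [Function.extend_apply' _ _ _ hi]
  rw [h5]
  have := h.frame_coeff_bound hℓ₀ (Function.extend L (fun t => - x t) c) ℓ
  rwa [Function.extend_apply' _ _ _ hℓ] at this

end Model

/-- The distance between `|x|` and `|y|` is the smaller of `|x - y|` and `|x + y|`. This is why both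
sums and differences of vertices are kept away from the orthogonal complement of `u`. -/
lemma abs_le_abs_sub_of_gap {x y θ : ℝ} (h1 : θ ≤ |x - y|) (h2 : θ ≤ |x + y|)
    (h3 : |y| ≤ |x|) : |y| ≤ |x| - θ := by
  rcases abs_cases x with ⟨_, _⟩ | ⟨_, _⟩ <;> rcases abs_cases y with ⟨_, _⟩ | ⟨_, _⟩ <;>
  rcases abs_cases (x - y) with ⟨_, _⟩ | ⟨_, _⟩ <;>
  rcases abs_cases (x + y) with ⟨_, _⟩ | ⟨_, _⟩ <;> linarith

/-! ### Maximizers in a direction that separates the vertices. -/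

section Model

variable {d n k m : ℕ} {A P : Matrix (Fin d) (Fin n) ℝ} {M : Matrix (Fin d) (Fin k) ℝ} {α δ : ℝ}
  {r : ℕ} {R : Fin r → Finset (Fin n)} {L : Fin r → Fin k}
  {v : OrthonormalBasis (Fin d) ℝ (Eu d)} {V : Submodule ℝ (Eu d)}

/-- Let `ls` be the new vertex with the largest `|u · M_ℓ|`. The average of the latent points over a
maximizer is a convex combination of vertices; weight `1 - w` away from `ls` costs `(1 - w)` times
the gap. Comparison with the proximate set of `ls` allows a loss of `6τ` only, so `1 - w` is small
and the average is near `M_ls`. -/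
lemma IsStep.argmax_near_of_gap (h : IsStep A P M α δ m R L v V) {ℓ₀ : Fin k}
    (hℓ₀ : ∀ ℓ, ‖col M ℓ‖ ≤ ‖col M ℓ₀‖) {u : Eu d} (hu : u ∈ residual A V R) (hu1 : ‖u‖ = 1)
    (h1 : ∀ ℓ, ℓ ∉ Set.range L → α * ‖col M ℓ₀‖ / (8 * (k : ℝ) ^ 4) ≤ |inner ℝ u (col M ℓ)|)
    (h2 : ∀ ℓ ℓ', ℓ ∉ Set.range L → ℓ' ∉ Set.range L → ℓ ≠ ℓ' →
      α * ‖col M ℓ₀‖ / (8 * (k : ℝ) ^ 4) ≤ |inner ℝ u (col M ℓ - col M ℓ')| ∧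
      α * ‖col M ℓ₀‖ / (8 * (k : ℝ) ^ 4) ≤ |inner ℝ u (col M ℓ + col M ℓ')|)
    {S : Finset (Fin n)} (hS : IsArgmax A m u S) :
    ∃ ℓ, ℓ ∉ Set.range L ∧ ‖col M ℓ - avgCol A S‖ ≤ errBound A P k α δ := by
  have hα := h.α_pos
  have hB := h.norm_col_pos ℓ₀
  have hk := h.two_le_real
  have hk4 : (0 : ℝ) < (k : ℝ) ^ 4 := by positivity
  obtain ⟨hτX, hX, -⟩ := h.scaled_noise_bounds ℓ₀
  rw [errBound_eq]
  have hτ0 := h.noise_nonneg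
  have hnear := h.near
  rw [errBound_eq] at hnear
  set τ := noise A P / Real.sqrt δ
  set X := (k : ℝ) ^ 4 / α * τ with hXdef
  set B := ‖col M ℓ₀‖
  have hX0 : 0 ≤ X := by positivity
  set Y := α * B / (k : ℝ) ^ 4 with hYdef
  have hY0 : 0 < Y := by positivity
  have hθ : α * B / (8 * (k : ℝ) ^ 4) = Y / 8 := by rw [hYdef]; field_simp
  rw [hθ] at h1 h2
  have hYX : Y * X = B * τ := by rw [hYdef, hXdef]; field_simp
  -- The second scaled noise bound with one factor `k ≥ 2` taken out of `k⁵`.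
  have hXY : 9000 * X ≤ Y := by
    rw [hYdef, le_div_iff₀ hk4]
    have h3 : 2 * ((k : ℝ) ^ 4 * X) ≤ k * ((k : ℝ) ^ 4 * X) := by gcongr
    have h4 : α ^ 2 * B ≤ α * B := by nlinarith [mul_pos hα hB, h.α_lt]
    have h5 : 4500 * (k : ℝ) ^ 5 * X = 4500 * (k * ((k : ℝ) ^ 4 * X)) := by ring
    linarith
  have hcs : ∀ x : Eu d, |inner ℝ u x| ≤ ‖x‖ := fun x => by
    simpa [hu1] using abs_real_inner_le_norm u x
  obtain ⟨ls, hls, hmax⟩ : ∃ ℓ, ℓ ∉ Set.range L ∧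
      ∀ ℓ', ℓ' ∉ Set.range L → |inner ℝ u (col M ℓ')| ≤ |inner ℝ u (col M ℓ)| := by
    classical
    obtain ⟨ℓ, hℓ, hmax⟩ := Finset.exists_max_image
      (Finset.univ.filter fun ℓ => ℓ ∉ Set.range L) (fun ℓ => |inner ℝ u (col M ℓ)|) (by
        by_contra hcon
        rw [Finset.not_nonempty_iff_eq_empty, Finset.filter_eq_empty_iff] at hcon
        have hs : Function.Surjective L := fun ℓ => by simpa using hcon (Finset.mem_univ ℓ)
        have := Fintype.card_le_of_surjective L hs
        simp only [Fintype.card_fin] at this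
        have := h.r_lt
        omega)
    exact ⟨ℓ, (Finset.mem_filter.1 hℓ).2,
      fun ℓ' hℓ' => hmax ℓ' (Finset.mem_filter.2 ⟨Finset.mem_univ _, hℓ'⟩)⟩
  -- New vertices have the gap `Y/8` directly. For a found vertex `|u · M| ≤ 150 X ≤ Y/60`, because
  -- `u` is orthogonal to its approximation, and `Y/8 - Y/60 ≥ Y/10`.
  have hgap : ∀ ℓ, ℓ ≠ ls → |inner ℝ u (col M ℓ)| ≤ |inner ℝ u (col M ls)| - Y / 10 := by
    intro ℓ hℓ
    by_cases hr : ℓ ∈ Set.range L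
    · obtain ⟨t, rfl⟩ := hr
      have h3 : inner ℝ u (avgCol A (R t)) = 0 :=
        
        Submodule.inner_left_of_mem_orthogonal (Submodule.subset_span (Set.mem_range_self t)) hu.2
      have h4 := (hcs (avgCol A (R t) - col M (L t))).trans (hnear t)
      rw [inner_sub_right, h3, zero_sub, abs_neg] at h4
      have h5 := h1 ls hls
      linarith
    · obtain ⟨h3, h4⟩ := h2 ls ℓ hls hr hℓ.symm
      have h5 := hmax ℓ hr
      rw [inner_sub_right] at h3
      rw [inner_add_right] at h4
      linarith [abs_le_abs_sub_of_gap h3 h4 h5]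
  refine ⟨ls, hls, ?_⟩
  have hScard : (S.card : ℝ) = δ * n := by rw [hS.1, h.m_eq]
  have hSne : S.Nonempty := by rw [← Finset.card_pos, hS.1]; exact h.m_pos
  obtain ⟨w, hw0, hw1, hw⟩ := exists_weights h.latent hSne
  have hAP := norm_avgCol_sub_le A P h.n_pos h.δ_pos hScard
  obtain ⟨T, hT, hTM⟩ := h.prox ls
  have hTA := norm_vertex_sub_avgCol_le A P (col M ls) h.n_pos h.δ_pos hT hTM
  have hTcard : T.card = m := by
    have : (T.card : ℝ) = m := by rw [hT, h.m_eq]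
    exact_mod_cast this
  -- The loss is `5τ` for replacing the vertex by the average of its proximate columns and `τ` for
  -- replacing `A` by `P` on `S`.
  have h6 : |inner ℝ u (col M ls)| - 6 * τ ≤ |inner ℝ u (avgCol P S)| := by
    have e1 := hS.2 T hTcard
    have e2 := (hcs _).trans hTA
    have e3 := (hcs _).trans hAP
    rw [inner_sub_right] at e2 e3
    have e4 := abs_sub_abs_le_abs_sub (inner ℝ u (col M ls)) (inner ℝ u (avgCol A T))
    have e5 := abs_sub_abs_le_abs_sub (inner ℝ u (avgCol A S)) (inner ℝ u (avgCol P S))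
    linarith
  have hsum1 : ∑ i ∈ Finset.univ.erase ls, w i = 1 - w ls := by
    rw [← hw1, ← Finset.add_sum_erase _ _ (Finset.mem_univ ls)]; ring
  have h7 : |inner ℝ u (avgCol P S)| ≤ |inner ℝ u (col M ls)| - (1 - w ls) * (Y / 10) := by
    rw [hw, inner_sum]
    refine (Finset.abs_sum_le_sum_abs _ _).trans ?_
    rw [← Finset.add_sum_erase _ _ (Finset.mem_univ ls)]
    have e1 : ∑ i ∈ Finset.univ.erase ls, |inner ℝ u (w i • col M i)| ≤
        ∑ i ∈ Finset.univ.erase ls, w i * (|inner ℝ u (col M ls)| - Y / 10) := by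
      refine Finset.sum_le_sum fun i hi => ?_
      rw [inner_smul_right, abs_mul, abs_of_nonneg (hw0 i)]
      exact mul_le_mul_of_nonneg_left (hgap i (Finset.ne_of_mem_erase hi)) (hw0 i)
    rw [← Finset.sum_mul, hsum1] at e1
    rw [inner_smul_right, abs_mul, abs_of_nonneg (hw0 ls)]
    linarith
  have h8 : (1 - w ls) * Y ≤ 60 * τ := by linarith
  have h9 : ‖col M ls - avgCol P S‖ ≤ (1 - w ls) * (2 * B) := by
    have e1 : col M ls - avgCol P S = ∑ i ∈ Finset.univ.erase ls, w i • (col M ls - col M i) := by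
      rw [Finset.sum_erase _ (by simp)]
      simp only [smul_sub, Finset.sum_sub_distrib, ← Finset.sum_smul, hw1, one_smul, hw]
    rw [e1, ← hsum1, Finset.sum_mul]
    refine norm_sum_le_of_le _ fun i _ => ?_
    rw [norm_smul, Real.norm_of_nonneg (hw0 i)]
    refine mul_le_mul_of_nonneg_left ((norm_sub_le _ _).trans ?_) (hw0 i)
    linarith [hℓ₀ ls, hℓ₀ i]
  -- By `YX = Bτ`, the bound `60τ/Y` on the missing weight becomes `120 X` after multiplication by
  -- the diameter bound `2B`. Adding `τ ≤ X` stays below `150 X`.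
  have h10 : (1 - w ls) * (2 * B) ≤ 120 * X := by
    refine le_of_mul_le_mul_right ?_ hY0
    have := mul_le_mul_of_nonneg_left h8 (show 0 ≤ 2 * B by positivity)
    nlinarith
  have h11 : col M ls - avgCol A S = (col M ls - avgCol P S) - (avgCol A S - avgCol P S) := by
    abel
  rw [h11]
  refine (norm_sub_le _ _).trans ?_
  linarith

/-! ### Relations between `k`, `m`, `n` and the number of nonzero entries. -/

lemma IsModel.vertex_sub_ge (h : IsModel A P M α δ m) {ℓ ℓ' : Fin k} (hne : ℓ ≠ ℓ')
    (ℓ₀ : Fin k) : α * ‖col M ℓ₀‖ ≤ ‖col M ℓ - col M ℓ'‖ := by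
  have h1 := h.sep.coeff_bound (fun i => if i = ℓ then 1 else if i = ℓ' then -1 else 0) ℓ ℓ₀
  simp only [if_true, abs_one, one_mul] at h1
  convert h1 using 2
  rw [← Finset.add_sum_erase _ _ (Finset.mem_univ ℓ),
    Finset.sum_eq_single_of_mem ℓ' (by simp [hne.symm])]
  · simp [hne.symm, sub_eq_add_neg]
  · intro b hb hb'
    simp [Finset.ne_of_mem_erase hb, hb']

lemma IsModel.noise_lt (h : IsModel A P M α δ m) (ℓ : Fin k) :
    100 * (noise A P / Real.sqrt δ) < α * ‖col M ℓ‖ := by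
  have hp := mul_pos h.α_pos (h.norm_col_pos ℓ)
  obtain ⟨h1, h2, -⟩ := h.scaled_noise_bounds ℓ
  have hk5 : (1 : ℝ) ≤ (k : ℝ) ^ 5 := one_le_pow₀ (by linarith [h.two_le_real])
  have h0 := h.noise_nonneg
  set X := (k : ℝ) ^ 4 / α * (noise A P / Real.sqrt δ)
  have h3 : α ^ 2 * ‖col M ℓ‖ ≤ α * ‖col M ℓ‖ := by nlinarith [h.α_lt]
  have h4 : 4500 * X ≤ 4500 * (k : ℝ) ^ 5 * X := by nlinarith
  linarith

/-- Proximate sets of different vertices are disjoint: a common latent point would put two vertices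
within `8τ` of each other, but they are `αB` apart. In terms of `δ` this says `k ≤ 1/δ`. -/
lemma IsModel.card_mul_le (h : IsModel A P M α δ m) : k * m ≤ n := by
  choose S hS hSM using h.prox
  have hcard : ∀ ℓ, (S ℓ).card = m := fun ℓ => by
    have : ((S ℓ).card : ℝ) = m := by rw [hS, h.m_eq]
    exact_mod_cast this
  have hdisj : ((Finset.univ : Finset (Fin k)) : Set (Fin k)).PairwiseDisjoint S := by
    intro ℓ _ ℓ' _ hne
    rw [Function.onFun, Finset.disjoint_left]
    intro j hj hj'
    have h1 := h.vertex_sub_ge hne ℓ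
    have h2 := hSM ℓ j hj
    have h3 := hSM ℓ' j hj'
    have h4 := norm_sub_le (col M ℓ - col P j) (col M ℓ' - col P j)
    rw [sub_sub_sub_cancel_right] at h4
    rw [mul_div_assoc] at h2 h3
    have h5 := h.noise_lt ℓ
    have h6 := h.noise_nonneg
    linarith
  have h1 := Finset.card_biUnion hdisj
  simp only [hcard, Finset.sum_const, Finset.card_univ, Fintype.card_fin, smul_eq_mul] at h1
  rw [← h1]
  simpa using Finset.card_le_univ (Finset.univ.biUnion S)

lemma card_nonzero_col_le_nnz (A : Matrix (Fin d) (Fin n) ℝ) (S : Finset (Fin n))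
    (hS : ∀ j ∈ S, col A j ≠ 0) : S.card ≤ nnz A := by
  have h1 : ∀ j : S, ∃ i, A i j ≠ 0 := by
    intro j
    by_contra! hcon
    exact hS j j.2 (by ext i; exact hcon i)
  choose f hf using h1
  have := Nat.card_le_card_of_injective
    (fun j : S => (⟨(f j, j), hf j⟩ : {p : Fin d × Fin n // A p.1 p.2 ≠ 0})) (by
      intro a b hab
      simp only [Subtype.mk.injEq, Prod.mk.injEq] at hab
      exact Subtype.ext hab.2)
  simpa [nnz] using this

/-- At most half of the columns in a proximate set vanish. On a set `Z` of vanishing columns the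
perturbation is `-P`, so its sum over `Z` has length at least `|Z|(|M_ℓ| - 4τ)`. It is also at most
`τ √m √|Z|`, which is below `2τ|Z|` once `m < 2|Z|`. This would give `|M_ℓ| ≤ 6τ`, against the noise
bound. -/
lemma IsModel.m_le_nnz (h : IsModel A P M α δ m) : m ≤ 2 * nnz A := by
  classical
  obtain ⟨ℓ, -⟩ := h.exists_max
  obtain ⟨S, hS, hSM⟩ := h.prox ℓ
  have hcard : S.card = m := by
    have : (S.card : ℝ) = m := by rw [hS, h.m_eq]
    exact_mod_cast this
  have h1 := card_nonzero_col_le_nnz A (S.filter fun j => ¬ col A j = 0) (by simp)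
  have h2 := Finset.card_filter_add_card_filter_not (s := S) (fun j => col A j = 0)
  set Z := S.filter fun j => col A j = 0 with hZ
  suffices h3 : 2 * Z.card ≤ m by omega
  by_contra! hcon
  have hτ := h.noise_nonneg
  have hZ0 : (0 : ℝ) < Z.card := by
    have : 0 < Z.card := by omega
    exact_mod_cast this
  have hm0 : (0 : ℝ) < m := by exact_mod_cast h.m_pos
  have hspec : specNorm (A - P) = noise A P / Real.sqrt δ * Real.sqrt m := by
    rw [← noise_div_sqrt A P h.n_pos h.δ_pos h.m_eq]
    have : Real.sqrt m * Real.sqrt m = m := Real.mul_self_sqrt hm0.le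
    field_simp
    rw [Real.sq_sqrt hm0.le]
  have h4 := norm_sum_col_le (A - P) Z
  rw [hspec] at h4
  have h5 : ∑ j ∈ Z, col (A - P) j = - ∑ j ∈ Z, col P j := by
    rw [← Finset.sum_neg_distrib]
    refine Finset.sum_congr rfl fun j hj => ?_
    rw [col_sub, (Finset.mem_filter.1 hj).2, zero_sub]
  rw [h5, norm_neg] at h4
  have h6 : ‖∑ j ∈ Z, (col M ℓ - col P j)‖ ≤ Z.card * (4 * (noise A P / Real.sqrt δ)) := by
    refine (norm_sum_le_of_le _ fun j hj => hSM j (Finset.mem_filter.1 hj).1).trans ?_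
    simp only [Finset.sum_const, nsmul_eq_mul, mul_div_assoc]
    exact le_rfl
  rw [Finset.sum_sub_distrib, Finset.sum_const, ← Nat.cast_smul_eq_nsmul ℝ] at h6
  have h7 := norm_sub_norm_le ((Z.card : ℝ) • col M ℓ) (∑ j ∈ Z, col P j)
  rw [norm_smul, Real.norm_of_nonneg hZ0.le] at h7
  have h8 : Real.sqrt m * Real.sqrt Z.card ≤ 2 * Z.card := by
    have e1 : Real.sqrt m ≤ 2 * Real.sqrt Z.card := by
      rw [Real.sqrt_le_left (by positivity), mul_pow, Real.sq_sqrt hZ0.le]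
      have : (m : ℝ) ≤ 2 * Z.card := by exact_mod_cast hcon.le
      linarith
    have e2 : Real.sqrt Z.card * Real.sqrt Z.card = Z.card := Real.mul_self_sqrt hZ0.le
    nlinarith [Real.sqrt_nonneg (Z.card : ℝ)]
  have h9 := mul_le_mul_of_nonneg_left h8 hτ
  have h10 : (Z.card : ℝ) * ‖col M ℓ‖ ≤ Z.card * (6 * (noise A P / Real.sqrt δ)) := by
    nlinarith
  have h11 := le_of_mul_le_mul_left h10 hZ0
  have h12 := h.noise_lt ℓ
  have h13 := h.norm_col_pos ℓ
  nlinarith [h.α_lt]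

end Model

/-! ### Gaussian vectors and the uniform law on the sphere -/

section Gaussian

variable {E : Type*} [NormedAddCommGroup E] [InnerProductSpace ℝ E] [FiniteDimensional ℝ E]
  [MeasurableSpace E] [BorelSpace E]

/-- The density of the standard Gaussian of dimension `p` at distance `x` from the origin. -/
noncomputable def gaussDensity (p : ℕ) (x : ℝ) : ℝ :=
  (2 * Real.pi) ^ (-(p : ℝ) / 2) * Real.exp (-(1 / 2) * x ^ 2)

/-- The known value of the integral is positive, while the integral of a non-integrable function is
`0` by convention. -/
lemma integrable_exp_neg_mul_sq_norm {b : ℝ} (hb : 0 < b) :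
    Integrable (fun x : E => Real.exp (-b * ‖x‖ ^ 2)) := by
  by_contra h
  have h1 := GaussianFourier.integral_rexp_neg_mul_sq_norm (V := E) hb
  rw [integral_undef h] at h1
  have : 0 < (Real.pi / b) ^ (Module.finrank ℝ E / 2 : ℝ) := by positivity
  linarith

lemma measurable_gaussDensity (p : ℕ) : Measurable (gaussDensity p) := by
  unfold gaussDensity; fun_prop

lemma gaussDensity_nonneg (p : ℕ) (x : ℝ) : 0 ≤ gaussDensity p x := by
  unfold gaussDensity; positivity

/-- Both measures have the same characteristic function. The density gives access to polar
coordinates and to the tail bound. -/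
lemma stdGaussian_eq_withDensity :
    stdGaussian E = (volume : Measure E).withDensity
      fun x => ENNReal.ofReal (gaussDensity (Module.finrank ℝ E) ‖x‖) := by
  have hint : Integrable (fun x : E => gaussDensity (Module.finrank ℝ E) ‖x‖) :=
    (integrable_exp_neg_mul_sq_norm (by norm_num)).const_mul _
  have : IsFiniteMeasure ((volume : Measure E).withDensity
      fun x => ENNReal.ofReal (gaussDensity (Module.finrank ℝ E) ‖x‖)) :=
    isFiniteMeasure_withDensity_ofReal hint.2
  refine Measure.ext_of_charFun ?_
  ext t
  rw [charFun_stdGaussian, charFun_apply]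
  have hm : Measurable fun x : E => ENNReal.ofReal (gaussDensity (Module.finrank ℝ E) ‖x‖) :=
    ((measurable_gaussDensity _).comp measurable_norm).ennreal_ofReal
  rw [integral_withDensity_eq_integral_toReal_smul hm (Filter.Eventually.of_forall fun _ => ENNReal.ofReal_lt_top)]
  have h1 : ∀ x : E, (ENNReal.ofReal (gaussDensity (Module.finrank ℝ E) ‖x‖)).toReal •
      Complex.exp (inner ℝ x t * Complex.I) =
      (((2 * Real.pi) ^ (-(Module.finrank ℝ E : ℝ) / 2) : ℝ) : ℂ) *
        Complex.exp (-((1 / 2 : ℝ) : ℂ) * ‖x‖ ^ 2 + Complex.I * inner ℝ t x) := by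
    intro x
    rw [ENNReal.toReal_ofReal (gaussDensity_nonneg _ _), gaussDensity, Complex.real_smul,
      Complex.exp_add, real_inner_comm]
    push_cast
    ring_nf
  simp_rw [h1]
  rw [integral_const_mul, GaussianFourier.integral_cexp_neg_mul_sq_norm_add (by norm_num)]
  have h2 : ((Real.pi : ℂ) / ((1 / 2 : ℝ) : ℂ)) ^ ((Module.finrank ℝ E : ℂ) / 2) =
      (((2 * Real.pi) ^ ((Module.finrank ℝ E : ℝ) / 2) : ℝ) : ℂ) := by
    rw [Complex.ofReal_cpow (by positivity)]
    push_cast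
    congr 1
    ring
  rw [h2, ← mul_assoc, ← Complex.ofReal_mul, ← Real.rpow_add (by positivity)]
  rw [← add_div, neg_add_cancel, zero_div, Real.rpow_zero, Complex.ofReal_one, one_mul]
  congr 1
  rw [Complex.I_sq]
  push_cast
  ring

/-- In polar coordinates Lebesgue measure is the product of the surface measure and a radial
measure; the origin is a null set. -/
lemma lintegral_polar [Nontrivial E] {F : E → ENNReal} (hF : Measurable F) {φ : ℝ → ENNReal}
    (hφ : Measurable φ) :
    ∫⁻ x : E, F (‖x‖⁻¹ • x) * φ ‖x‖ =
      (∫⁻ s, F (s : E) ∂(volume : Measure E).toSphere) *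
        ∫⁻ x, φ (x : ℝ) ∂(Measure.volumeIoiPow (Module.finrank ℝ E - 1)) := by
  have h1 : ∫⁻ x : E, F (‖x‖⁻¹ • x) * φ ‖x‖ =
      ∫⁻ x in ({0}ᶜ : Set E), F (‖x‖⁻¹ • x) * φ ‖x‖ := by
    rw [restrict_compl_singleton]
  rw [h1, ← lintegral_subtype_comap (measurableSet_singleton _).compl]
  have h2 := (Measure.measurePreserving_homeomorphUnitSphereProd (volume : Measure E))
  have h3 := h2.lintegral_comp (f := fun p => F (p.1 : E) * φ (p.2 : ℝ)) (by fun_prop)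
  simp only [homeomorphUnitSphereProd_apply_fst_coe, homeomorphUnitSphereProd_apply_snd_coe] at h3
  rw [h3, lintegral_prod_mul (f := fun s : Metric.sphere (0 : E) 1 => F s)
    (g := fun x : Set.Ioi (0 : ℝ) => φ x) (by fun_prop) (by fun_prop)]

/-- A normalized standard Gaussian vector is uniformly distributed on the unit sphere. -/
lemma map_normalize_stdGaussian [Nontrivial E] :
    (stdGaussian E).map (fun x => ‖x‖⁻¹ • x) =
      (((volume : Measure E).toSphere Set.univ)⁻¹ • (volume : Measure E).toSphere).map
        Subtype.val := by
  set φ : ℝ → ENNReal := fun x => ENNReal.ofReal (gaussDensity (Module.finrank ℝ E) x) with hφ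
  have hφm : Measurable φ := (measurable_gaussDensity _).ennreal_ofReal
  set C := ∫⁻ x, φ (x : ℝ) ∂(Measure.volumeIoiPow (Module.finrank ℝ E - 1))
  have hNm : Measurable fun x : E => ‖x‖⁻¹ • x := by fun_prop
  have key : ∀ t : Set E, MeasurableSet t → (stdGaussian E).map (fun x => ‖x‖⁻¹ • x) t =
      (volume : Measure E).toSphere (Subtype.val ⁻¹' t) * C := by
    intro t ht
    rw [Measure.map_apply hNm ht, stdGaussian_eq_withDensity, withDensity_apply _ (hNm ht),
      ← lintegral_indicator (hNm ht)]
    have h1 := lintegral_polar (E := E) (F := t.indicator 1) (measurable_one.indicator ht) hφm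
    have h2 : ∫⁻ s, t.indicator 1 (s : E) ∂(volume : Measure E).toSphere =
        (volume : Measure E).toSphere (Subtype.val ⁻¹' t) := by
      rw [← lintegral_indicator_one (measurable_subtype_coe ht)]
      rfl
    rw [h2] at h1
    rw [← h1]
    refine lintegral_congr fun x => ?_
    by_cases hx : ‖x‖⁻¹ • x ∈ t
    · rw [Set.indicator_of_mem (show x ∈ (fun x => ‖x‖⁻¹ • x) ⁻¹' t from hx),
        Set.indicator_of_mem hx, Pi.one_apply, one_mul]
    · rw [Set.indicator_of_notMem (show x ∉ (fun x => ‖x‖⁻¹ • x) ⁻¹' t from hx),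
        Set.indicator_of_notMem hx, zero_mul]
  -- Total mass one identifies the radial constant, so it need not be computed.
  have htot : (volume : Measure E).toSphere Set.univ * C = 1 := by
    have h1 := key Set.univ MeasurableSet.univ
    rw [Measure.map_apply hNm MeasurableSet.univ, Set.preimage_univ, Set.preimage_univ,
      measure_univ] at h1
    exact h1.symm
  have hC : C = ((volume : Measure E).toSphere Set.univ)⁻¹ :=
    ENNReal.eq_inv_of_mul_eq_one_left (by rw [mul_comm]; exact htot)
  ext t ht
  rw [key t ht, Measure.map_apply measurable_subtype_coe ht, Measure.smul_apply, smul_eq_mul,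
    mul_comm, hC]

end Gaussian

/-- The uniform law on the sphere of a subspace is the law of a normalized Gaussian vector. -/
lemma unifSphere_eq {d : ℕ} (U : Submodule ℝ (Eu d)) (hU : 0 < Module.finrank ℝ U) :
    unifSphere U = (stdGaussian U).map fun x => ((‖x‖⁻¹ • x : U) : Eu d) := by
  have : Nontrivial U := Module.finrank_pos_iff.1 hU
  have h1 := congrArg (Measure.map (Subtype.val : U → Eu d)) (map_normalize_stdGaussian (E := U))
  rw [Measure.map_map measurable_subtype_coe (by fun_prop),
    Measure.map_map measurable_subtype_coe measurable_subtype_coe] at h1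
  exact h1.symm

/-! ### Anti-concentration and tails. -/

section Gaussian

variable {E : Type*} [NormedAddCommGroup E] [InnerProductSpace ℝ E] [FiniteDimensional ℝ E]
  [MeasurableSpace E] [BorelSpace E]

/-- The density is at most `1/√(2π) ≤ 1/2` and the interval has length `2a`. -/
lemma gaussianReal_abs_le (a : ℝ) :
    gaussianReal 0 1 {x | |x| ≤ a} ≤ ENNReal.ofReal a := by
  rw [gaussianReal_apply _ one_ne_zero]
  have h1 : ∀ x, gaussianPDF 0 1 x ≤ ENNReal.ofReal (1 / 2) := by
    intro x
    rw [gaussianPDF, gaussianPDFReal]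
    refine ENNReal.ofReal_le_ofReal ?_
    have h2 : Real.exp (-(x - 0) ^ 2 / (2 * ((1 : NNReal) : ℝ))) ≤ 1 := by
      rw [Real.exp_le_one_iff]
      exact div_nonpos_of_nonpos_of_nonneg (neg_nonpos.2 (sq_nonneg _)) (by positivity)
    have h3 : (Real.sqrt (2 * Real.pi * ((1 : NNReal) : ℝ)))⁻¹ ≤ 1 / 2 := by
      rw [one_div]
      refine inv_anti₀ (by norm_num) (Real.le_sqrt_of_sq_le ?_)
      have := Real.pi_gt_three
      simp only [NNReal.coe_one]
      linarith
    calc _ ≤ 1 / 2 * 1 := mul_le_mul h3 h2 (Real.exp_pos _).le (by norm_num)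
      _ = _ := mul_one _
  have h2 : {x : ℝ | |x| ≤ a} = Set.Icc (-a) a := by
    ext x; simp [abs_le]
  calc _ ≤ ∫⁻ _ in {x : ℝ | |x| ≤ a}, ENNReal.ofReal (1 / 2) := lintegral_mono h1
    _ = ENNReal.ofReal a := by
      rw [h2, setLIntegral_const, Real.volume_Icc, ← ENNReal.ofReal_mul (by norm_num)]
      congr 1; ring

/-- Anti-concentration of a one-dimensional marginal. -/
lemma stdGaussian_abs_inner_le {w : E} (hw : ‖w‖ = 1) (a : ℝ) :
    stdGaussian E {x | |inner ℝ w x| ≤ a} ≤ ENNReal.ofReal a := by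
  have h1 := IsGaussian.map_eq_gaussianReal (μ := stdGaussian E) (innerSL ℝ w)
  rw [integral_strongDual_stdGaussian, variance_dual_stdGaussian, innerSL_apply_norm, hw] at h1
  have h2 : MeasurableSet {x : ℝ | |x| ≤ a} := measurableSet_le (by fun_prop) (by fun_prop)
  have h3 := Measure.map_apply (μ := stdGaussian E) (innerSL ℝ w).measurable h2
  rw [h1] at h3
  simp only [one_pow, Real.toNNReal_one] at h3
  exact h3.symm.le.trans (gaussianReal_abs_le a)

/-- From `2 ≤ e` the left side is at most `e^{-K/2}`, and the exponential series gives `e^{K/2} ≥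
K²/8`. -/
lemma exp_neg_mul_two_rpow_le {K p : ℝ} (hK : 2 ≤ K) (hp : p ≤ K) :
    Real.exp (-K) * 2 ^ (p / 2) ≤ 8 / K ^ 2 := by
  have h1 : (2 : ℝ) ^ (p / 2) ≤ Real.exp (K / 2) := by
    calc (2 : ℝ) ^ (p / 2) ≤ 2 ^ (K / 2) := Real.rpow_le_rpow_of_exponent_le (by norm_num)
          (by linarith)
      _ ≤ (Real.exp 1) ^ (K / 2) := by
          refine Real.rpow_le_rpow (by norm_num) ?_ (by linarith)
          have := Real.add_one_le_exp 1
          linarith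
      _ = Real.exp (K / 2) := by rw [← Real.exp_mul, one_mul]
  have h2 : Real.exp (-K) * Real.exp (K / 2) = (Real.exp (K / 2))⁻¹ := by
    rw [← Real.exp_add, ← Real.exp_neg]; congr 1; ring
  have h3 : K ^ 2 / 8 ≤ Real.exp (K / 2) := by
    have := Real.quadratic_le_exp_of_nonneg (show 0 ≤ K / 2 by linarith)
    nlinarith
  calc _ ≤ Real.exp (-K) * Real.exp (K / 2) := mul_le_mul_of_nonneg_left h1 (Real.exp_pos _).le
    _ = (Real.exp (K / 2))⁻¹ := h2
    _ ≤ (K ^ 2 / 8)⁻¹ := inv_anti₀ (by positivity) h3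
    _ = 8 / K ^ 2 := inv_div _ _

/-- A Chernoff bound: on this event half of the Gaussian exponent is already worth `e^{-k}`, and
integrating the other half costs only the factor `2^{p/2}`. -/
lemma stdGaussian_norm_sq_gt {k : ℕ} (hk : 2 ≤ k) (hE : Module.finrank ℝ E ≤ k) :
    stdGaussian E {x | 4 * (k : ℝ) < ‖x‖ ^ 2} ≤ ENNReal.ofReal (8 / (k : ℝ) ^ 2) := by
  have hs : MeasurableSet {x : E | 4 * (k : ℝ) < ‖x‖ ^ 2} :=
    measurableSet_lt (by fun_prop) (by fun_prop)
  rw [stdGaussian_eq_withDensity, withDensity_apply _ hs]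
  set p := Module.finrank ℝ E with hp
  set c : ℝ := (2 * Real.pi) ^ (-(p : ℝ) / 2) with hc
  have hc0 : 0 ≤ c := by positivity
  have h1 : ∫⁻ x in {x : E | 4 * (k : ℝ) < ‖x‖ ^ 2}, ENNReal.ofReal (gaussDensity p ‖x‖) ≤
      ∫⁻ x : E, ENNReal.ofReal (c * Real.exp (-k) * Real.exp (-(1 / 4) * ‖x‖ ^ 2)) := by
    refine (setLIntegral_mono' hs fun x hx => ?_).trans (setLIntegral_le_lintegral _ _)
    refine ENNReal.ofReal_le_ofReal ?_
    rw [gaussDensity, mul_assoc, ← Real.exp_add]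
    refine mul_le_mul_of_nonneg_left (Real.exp_le_exp.2 ?_) hc0
    have : 4 * (k : ℝ) < ‖x‖ ^ 2 := hx
    linarith
  refine h1.trans ?_
  rw [← ofReal_integral_eq_lintegral_ofReal
    ((integrable_exp_neg_mul_sq_norm (by norm_num)).const_mul _)
    (Filter.Eventually.of_forall fun _ => by positivity)]
  refine ENNReal.ofReal_le_ofReal ?_
  rw [integral_const_mul, GaussianFourier.integral_rexp_neg_mul_sq_norm (by norm_num), ← hp]
  have h2 : (Real.pi / (1 / 4)) ^ ((p : ℝ) / 2) = (2 * Real.pi) ^ ((p : ℝ) / 2) * 2 ^ ((p : ℝ) / 2) := by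
    rw [← Real.mul_rpow (by positivity) (by norm_num)]
    congr 1; ring
  have h3 : c * (2 * Real.pi) ^ ((p : ℝ) / 2) = 1 := by
    rw [hc, ← Real.rpow_add (by positivity), ← add_div, neg_add_cancel, zero_div, Real.rpow_zero]
  have h4 : c * Real.exp (-k) * ((2 * Real.pi) ^ ((p : ℝ) / 2) * 2 ^ ((p : ℝ) / 2)) =
      (c * (2 * Real.pi) ^ ((p : ℝ) / 2)) * (Real.exp (-k) * 2 ^ ((p : ℝ) / 2)) := by ring
  rw [h2, h4, h3, one_mul]
  exact exp_neg_mul_two_rpow_le (by exact_mod_cast hk) (by exact_mod_cast hE)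

end Gaussian

/-- A uniformly random unit vector of `U` is unlikely to be almost orthogonal to one of the vectors
of a finite family. -/
lemma unifSphere_exists_small_le {d k : ℕ} (hk : 2 ≤ k) (U : Submodule ℝ (Eu d))
    (hU : 0 < Module.finrank ℝ U) (hUk : Module.finrank ℝ U ≤ k) {ι : Type*} (I : Finset ι)
    (w : ι → Eu d) {θ ε : ℝ} (hε : 0 ≤ ε) (hθ : 0 < θ)
    (hw : ∀ i ∈ I, θ ≤ ε * ‖U.starProjection (w i)‖) :
    unifSphere U {u | ∃ i ∈ I, |inner ℝ u (w i)| < θ} ≤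
      ENNReal.ofReal (8 / (k : ℝ) ^ 2 + I.card * (ε * (2 * Real.sqrt k))) := by
  have hm : MeasurableSet {u : Eu d | ∃ i ∈ I, |inner ℝ u (w i)| < θ} := by
    have : {u : Eu d | ∃ i ∈ I, |inner ℝ u (w i)| < θ} =
        ⋃ i ∈ I, {u : Eu d | |inner ℝ u (w i)| < θ} := by ext; simp
    rw [this]
    exact Finset.measurableSet_biUnion _ fun i _ => measurableSet_lt (by fun_prop) (by fun_prop)
  have hk0 : (0 : ℝ) < k := by positivity
  set b : ℝ := ε * (2 * Real.sqrt k) with hb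
  have hb0 : 0 ≤ b := by positivity
  let e : ι → U := fun i => ‖U.starProjection (w i)‖⁻¹ • U.orthogonalProjectionOnto (w i)
  have hpos : ∀ i ∈ I, 0 < ‖U.starProjection (w i)‖ := by
    intro i hi
    by_contra! hcon
    have := hw i hi
    have h0 : ‖U.starProjection (w i)‖ = 0 := le_antisymm hcon (norm_nonneg _)
    rw [h0, mul_zero] at this
    linarith
  rw [unifSphere_eq U hU, Measure.map_apply (by fun_prop) hm]
  -- If `u = x/|x|` with `|x| ≤ 2√k`, then `|u · w| < θ` makes the marginal of `x` along the
  -- normalized projection of `w` at most `2√k θ/|proj w| ≤ b`.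
  have hsub : (fun x : U => ((‖x‖⁻¹ • x : U) : Eu d)) ⁻¹'
      {u | ∃ i ∈ I, |inner ℝ u (w i)| < θ} ⊆
      {x : U | 4 * (k : ℝ) < ‖x‖ ^ 2} ∪ ⋃ i ∈ I, {x : U | |inner ℝ (e i) x| ≤ b} := by
    rintro x ⟨i, hi, hx⟩
    by_cases hx4 : 4 * (k : ℝ) < ‖x‖ ^ 2
    · exact Or.inl hx4
    refine Or.inr (Set.mem_biUnion hi ?_)
    have hxn : ‖x‖ ≤ 2 * Real.sqrt k := by
      refine le_of_sq_le_sq ?_ (by positivity)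
      rw [mul_pow, Real.sq_sqrt hk0.le]
      linarith
    have h1 : inner ℝ (e i) x = ‖U.starProjection (w i)‖⁻¹ * inner ℝ (w i) (x : Eu d) := by
      change inner ℝ (‖U.starProjection (w i)‖⁻¹ • U.orthogonalProjectionOnto (w i)) x = _
      rw [real_inner_smul_left]
      congr 1
      rw [Submodule.coe_inner, ← Submodule.starProjection_apply,
        Submodule.inner_starProjection_left_eq_right, Submodule.starProjection_eq_self_iff.2 x.2]
    have h2 : |inner ℝ (w i) (x : Eu d)| ≤ ‖x‖ * θ := by
      rcases eq_or_ne x 0 with rfl | hx0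
      · simp
      have hxp : 0 < ‖x‖ := norm_pos_iff.2 hx0
      change |inner ℝ (((‖x‖⁻¹ • x : U) : Eu d)) (w i)| < θ at hx
      rw [Submodule.coe_smul, real_inner_smul_left, abs_mul, abs_of_nonneg (by positivity),
        real_inner_comm, inv_mul_lt_iff₀ hxp] at hx
      exact hx.le
    change |inner ℝ (e i) x| ≤ b
    rw [h1, abs_mul, abs_of_nonneg (by positivity), inv_mul_le_iff₀ (hpos i hi)]
    refine h2.trans ?_
    calc ‖x‖ * θ ≤ (2 * Real.sqrt k) * (ε * ‖U.starProjection (w i)‖) :=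
          mul_le_mul hxn (hw i hi) hθ.le (by positivity)
      _ = _ := by rw [hb]; ring
  refine (measure_mono hsub).trans ((measure_union_le _ _).trans ?_)
  rw [ENNReal.ofReal_add (by positivity) (by positivity)]
  refine add_le_add (stdGaussian_norm_sq_gt hk hUk) ?_
  refine (measure_biUnion_finset_le _ _).trans ?_
  refine (Finset.sum_le_card_nsmul _ _ (ENNReal.ofReal b) fun i hi => ?_).trans ?_
  · refine stdGaussian_abs_inner_le ?_ b
    rw [norm_smul, norm_inv, norm_norm, Submodule.starProjection_apply, Submodule.norm_coe]
    refine inv_mul_cancel₀ ?_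
    have := hpos i hi
    rw [Submodule.starProjection_apply, Submodule.norm_coe] at this
    exact this.ne'
  · rw [ENNReal.ofReal_mul (p := (I.card : ℝ)) (by positivity), ENNReal.ofReal_natCast, nsmul_eq_mul]

lemma unifSphere_compl_sphere {d : ℕ} (U : Submodule ℝ (Eu d)) (hU : 0 < Module.finrank ℝ U) :
    unifSphere U {u | ¬ (u ∈ U ∧ ‖u‖ = 1)} = 0 := by
  have hmU : MeasurableSet (U : Set (Eu d)) := U.closed_of_finiteDimensional.measurableSet
  have hm : MeasurableSet {u : Eu d | ¬ (u ∈ U ∧ ‖u‖ = 1)} :=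
    (hmU.inter (measurableSet_eq_fun (by fun_prop) (by fun_prop))).compl
  have hν : Nontrivial U := Module.finrank_pos_iff.1 hU
  rw [unifSphere, Measure.map_apply (by fun_prop) hm]
  convert measure_empty (μ := ((volume : Measure U).toSphere Set.univ)⁻¹ •
    (volume : Measure U).toSphere)
  ext x
  simp only [Set.mem_preimage, Set.mem_ofPred_eq, Set.mem_empty_iff_false, iff_false, not_not]
  exact ⟨x.1.2, norm_eq_of_mem_sphere x⟩

lemma isProbabilityMeasure_unifSphere {d : ℕ} (U : Submodule ℝ (Eu d))
    (hU : 0 < Module.finrank ℝ U) : IsProbabilityMeasure (unifSphere U) := by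
  rw [unifSphere_eq U hU]
  exact Measure.isProbabilityMeasure_map (by fun_prop)

lemma map_gaussTape_fin (k : ℕ) :
    gaussTape.map (fun ω (l : Fin k) => ω l) = Measure.pi fun _ : Fin k => gaussianReal 0 1 := by
  symm
  refine Measure.pi_eq fun s hs => ?_
  have hm : Measurable fun (ω : ℕ → ℝ) (l : Fin k) => ω l := by fun_prop
  rw [Measure.map_apply hm (MeasurableSet.univ_pi hs)]
  have h1 : (fun (ω : ℕ → ℝ) (l : Fin k) => ω l) ⁻¹' Set.univ.pi s =
      Set.pi (Finset.range k) fun i => if h : i < k then s ⟨i, h⟩ else Set.univ := by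
    ext ω
    simp only [Set.mem_preimage, Set.mem_pi, Set.mem_univ, true_imp_iff, Finset.coe_range,
      Set.mem_Iio]
    constructor
    · intro h i hi
      rw [dif_pos hi]
      exact h ⟨i, hi⟩
    · intro h i
      have := h i i.2
      rwa [dif_pos i.2] at this
  rw [h1, gaussTape, Measure.infinitePi_pi]
  · rw [Finset.prod_range]
    refine Finset.prod_congr rfl fun i _ => ?_
    rw [dif_pos i.2]
  · intro i hi
    rw [dif_pos (Finset.mem_range.1 hi)]
    exact hs _

/-- Projecting a Gaussian combination of an orthonormal basis of a space containing `U` to `U` and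
normalizing it gives a uniformly random unit vector. -/
lemma map_gaussTape_eq_unifSphere {d k : ℕ} {q : Fin k → Eu d} (hq : Orthonormal ℝ q)
    (U : Submodule ℝ (Eu d)) (hU : 0 < Module.finrank ℝ U)
    (hUq : U ≤ Submodule.span ℝ (Set.range q)) :
    gaussTape.map (fun ω => ‖U.starProjection (∑ l : Fin k, ω l • q l)‖⁻¹ •
      U.starProjection (∑ l : Fin k, ω l • q l)) = unifSphere U := by
  let T : Eu k → U := fun x => U.orthogonalProjectionOnto (∑ l, x l • q l)
  have hT : Measurable T := by fun_prop
  -- The adjoint of `T` sends `t` to its coordinates in `q`. As `t` lies in the span of `q`, this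
  -- preserves the norm, so the characteristic functions agree.
  have hlaw : (stdGaussian (Eu k)).map T = stdGaussian U := by
    refine Measure.ext_of_charFun ?_
    ext t
    rw [charFun_stdGaussian, charFun_apply, integral_map hT.aemeasurable (by fun_prop)]
    have h1 : ∀ x : Eu k, inner ℝ (T x) t =
        inner ℝ x (WithLp.toLp 2 fun l => inner ℝ (q l) (t : Eu d)) := by
      intro x
      rw [Submodule.coe_inner, ← Submodule.starProjection_apply,
        Submodule.inner_starProjection_left_eq_right, Submodule.starProjection_eq_self_iff.2 t.2,
        sum_inner, PiLp.inner_apply]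
      refine Finset.sum_congr rfl fun l _ => ?_
      rw [real_inner_smul_left]
      simp [mul_comm]
    simp_rw [h1]
    rw [← charFun_apply, charFun_stdGaussian]
    have h2 : ‖(WithLp.toLp 2 fun l => inner ℝ (q l) (t : Eu d) : Eu k)‖ ^ 2 = ‖t‖ ^ 2 := by
      obtain ⟨c, hc⟩ := (Submodule.mem_span_range_iff_exists_fun ℝ).1 (hUq t.2)
      rw [EuclideanSpace.real_norm_sq_eq]
      have h3 : ∀ l, inner ℝ (q l) (t : Eu d) = c l := fun l => by
        rw [← hc, hq.inner_right_fintype]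
      simp only [h3]
      rw [← Submodule.norm_coe, ← real_inner_self_eq_norm_sq, ← hc, hq.inner_sum]
      simp [sq]
    rw [← Complex.ofReal_pow, h2, Complex.ofReal_pow]
  rw [unifSphere_eq U hU, ← hlaw, ← map_pi_eq_stdGaussian, ← map_gaussTape_fin]
  rw [Measure.map_map (by fun_prop) (by fun_prop), Measure.map_map (by fun_prop) (by fun_prop),
    Measure.map_map (by fun_prop) (by fun_prop)]
  rfl

/-! ### The failure probability. -/

section Step

variable {d n k m r : ℕ} {A P : Matrix (Fin d) (Fin n) ℝ} {M : Matrix (Fin d) (Fin k) ℝ}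
  {α δ : ℝ} {R : Fin r → Finset (Fin n)} {L : Fin r → Fin k}
  {v : OrthonormalBasis (Fin d) ℝ (Eu d)} {V : Submodule ℝ (Eu d)}

lemma IsStep.finrank_residual_pos (h : IsStep A P M α δ m R L v V) :
    0 < Module.finrank ℝ (residual A V R) := by
  have := h.finrank_residual
  have := h.r_lt
  omega

/-- The pairs of indices of new vertices, with the sign with which the second one is added. -/
noncomputable def newPairs (L : Fin r → Fin k) : Finset (Fin k × Fin k × SignType) :=
  open Classical in Finset.univ.filter fun p =>
    p.1 ∉ Set.range L ∧ p.2.1 ∉ Set.range L ∧ (p.2.2 = 0 ∨ p.1 ≠ p.2.1)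

/-- The coefficient of the first vertex is `1` in every case: either the sign `0` removes the second
vertex, or the two indices differ. -/
lemma IsStep.newPairs_proj_ge (h : IsStep A P M α δ m R L v V) {ℓ₀ : Fin k}
    (hℓ₀ : ∀ ℓ, ‖col M ℓ‖ ≤ ‖col M ℓ₀‖) {p : Fin k × Fin k × SignType} (hp : p ∈ newPairs L) :
    α * ‖col M ℓ₀‖ / 2 ≤
      ‖(residual A V R).starProjection (col M p.1 + (p.2.2 : ℝ) • col M p.2.1)‖ := by
  classical
  obtain ⟨ℓ, ℓ', s⟩ := p
  simp only [newPairs, Finset.mem_filter, Finset.mem_univ, true_and] at hp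
  obtain ⟨h1, h2, h3⟩ := hp
  have h4 := h.norm_residual_proj_ge hℓ₀
    (fun i => (if i = ℓ then 1 else 0) + (if i = ℓ' then (s : ℝ) else 0)) (fun t => by
      rw [if_neg (fun hc => h1 ⟨t, hc⟩), if_neg (fun hc => h2 ⟨t, hc⟩), add_zero]) ℓ h1
  have h5 : (if ℓ = ℓ' then (s : ℝ) else 0) = 0 := by
    rcases h3 with rfl | h3
    · simp
    · rw [if_neg h3]
  simpa [h5, add_smul, Finset.sum_add_distrib] using h4

lemma card_newPairs_le (L : Fin r → Fin k) : ((newPairs L).card : ℝ) ≤ 3 * (k : ℝ) ^ 2 := by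
  have h1 := Finset.card_le_univ (newPairs L)
  have h2 : Fintype.card (Fin k × Fin k × SignType) = 3 * k ^ 2 := by
    simp only [Fintype.card_prod, Fintype.card_fin]
    have : Fintype.card SignType = 3 := rfl
    rw [this]; ring
  rw [h2] at h1
  exact_mod_cast h1

/-- The union bound contributes at most `3/2` times `K^{-3/2}`, and `8/K² ≤ 8/K^{3/2}`. -/
lemma failure_probability_le {K N : ℝ} (hK : 2 ≤ K) (hN : N ≤ 3 * K ^ 2) :
    8 / K ^ 2 + N * (1 / (4 * K ^ 4) * (2 * Real.sqrt K)) ≤ 10 / K ^ (3 / 2 : ℝ) := by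
  have hK0 : 0 < K := by linarith
  have hs := Real.sqrt_pos.2 hK0
  have h1 : K ^ (3 / 2 : ℝ) = K * Real.sqrt K := by
    rw [Real.sqrt_eq_rpow, ← Real.rpow_one_add' hK0.le (by norm_num)]
    norm_num
  have hsq : Real.sqrt K * Real.sqrt K = K := Real.mul_self_sqrt hK0.le
  have hs1 : 1 ≤ Real.sqrt K := Real.one_le_sqrt.2 (by linarith)
  have h2 : 8 / K ^ 2 ≤ 8 / (K * Real.sqrt K) := by
    refine div_le_div_of_nonneg_left (by norm_num) (by positivity) ?_
    rw [pow_two]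
    refine mul_le_mul_of_nonneg_left ?_ hK0.le
    nlinarith
  have h3 : N * (1 / (4 * K ^ 4) * (2 * Real.sqrt K)) ≤ 2 / (K * Real.sqrt K) := by
    calc _ ≤ 3 * K ^ 2 * (1 / (4 * K ^ 4) * (2 * Real.sqrt K)) :=
          mul_le_mul_of_nonneg_right hN (by positivity)
      _ = (3 / 2) * (Real.sqrt K * Real.sqrt K) / K ^ 2 / Real.sqrt K := by field_simp; norm_num
      _ = (3 / 2) / (K * Real.sqrt K) := by rw [hsq]; field_simp
      _ ≤ _ := div_le_div_of_nonneg_right (by norm_num) (by positivity)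
  rw [h1]
  calc _ ≤ 8 / (K * Real.sqrt K) + 2 / (K * Real.sqrt K) := add_le_add h2 h3
    _ = _ := by rw [← add_div]; norm_num

/-- With high probability, every maximizer is close to a new vertex. -/
lemma IsStep.prob_ge (h : IsStep A P M α δ m R L v V) :
    ENNReal.ofReal (1 - 10 / (k : ℝ) ^ (3 / 2 : ℝ)) ≤
      unifSphere (residual A V R)
        {u | ∀ S : Finset (Fin n), IsArgmax A m u S →
          ∃ ℓ, ℓ ∉ Set.range L ∧ ‖col M ℓ - avgCol A S‖ ≤ errBound A P k α δ} := by
  obtain ⟨ℓ₀, hℓ₀⟩ := h.exists_max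
  have hU := h.finrank_residual_pos
  have hUk : Module.finrank ℝ (residual A V R) ≤ k := by
    have := h.finrank_residual
    omega
  have := isProbabilityMeasure_unifSphere _ hU
  have hk := h.two_le_real
  have hα := h.α_pos
  have hB := h.norm_col_pos ℓ₀
  set θ := α * ‖col M ℓ₀‖ / (8 * (k : ℝ) ^ 4) with hθ
  set μ := unifSphere (residual A V R) with hμ
  set good := {u | ∀ S : Finset (Fin n), IsArgmax A m u S →
    ∃ ℓ, ℓ ∉ Set.range L ∧ ‖col M ℓ - avgCol A S‖ ≤ errBound A P k α δ} with hgood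
  set bad := {u : Eu d | ∃ p ∈ newPairs L,
    |inner ℝ u (col M p.1 + (p.2.2 : ℝ) • col M p.2.1)| < θ} with hbad
  have hbadle : μ bad ≤ ENNReal.ofReal (10 / (k : ℝ) ^ (3 / 2 : ℝ)) := by
    -- The choice `ε = 1/(4k⁴)` turns the lower bound `αB/2` for the projections into `θ`.
    refine (unifSphere_exists_small_le h.two_le _ hU hUk (newPairs L)
      (fun p => col M p.1 + (p.2.2 : ℝ) • col M p.2.1) (θ := θ) (ε := 1 / (4 * (k : ℝ) ^ 4))
      (by positivity) (by positivity) fun p hp => ?_).trans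
      (ENNReal.ofReal_le_ofReal (failure_probability_le hk (card_newPairs_le L)))
    refine le_trans (le_of_eq ?_)
      (mul_le_mul_of_nonneg_left (h.newPairs_proj_ge hℓ₀ hp) (by positivity))
    rw [hθ]; field_simp; norm_num
  -- Only a cover and subadditivity are used, so measurability of the good event is not needed.
  have hcover : Set.univ ⊆ good ∪ (bad ∪ {u | ¬ (u ∈ residual A V R ∧ ‖u‖ = 1)}) := by
    intro u _
    by_cases hu : u ∈ residual A V R ∧ ‖u‖ = 1
    swap
    · exact Or.inr (Or.inr hu)
    by_cases hb : u ∈ bad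
    · exact Or.inr (Or.inl hb)
    refine Or.inl fun S hS => ?_
    simp only [hbad, Set.mem_ofPred_eq, not_exists, not_and, not_lt] at hb
    refine h.argmax_near_of_gap hℓ₀ hu.1 hu.2 (fun ℓ hℓ => ?_) (fun ℓ ℓ' hℓ hℓ' hne => ⟨?_, ?_⟩) hS
    · simpa using hb (ℓ, ℓ, 0) (by simp [newPairs] at hℓ ⊢; exact hℓ)
    · simpa [sub_eq_add_neg] using hb (ℓ, ℓ', -1) (by simp [newPairs] at hℓ hℓ' ⊢; exact ⟨hℓ, hℓ', hne⟩)
    · simpa using hb (ℓ, ℓ', 1) (by simp [newPairs] at hℓ hℓ' ⊢; exact ⟨hℓ, hℓ', hne⟩)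
  have h1 : (1 : ENNReal) ≤ μ good + ENNReal.ofReal (10 / (k : ℝ) ^ (3 / 2 : ℝ)) := by
    rw [← measure_univ (μ := μ)]
    refine (measure_mono hcover).trans ((measure_union_le _ _).trans ?_)
    gcongr
    refine (measure_union_le _ _).trans ?_
    rw [unifSphere_compl_sphere _ hU, add_zero]
    exact hbadle
  rw [ENNReal.ofReal_sub _ (by positivity), ENNReal.ofReal_one]
  exact tsub_le_iff_right.2 h1

end Step

/-! ### Reasoning about programs -/

/-- The program `p` started in `s` halts within `B` steps in a state satisfying `Q`. -/
def Runs (ω : ℕ → ℝ) (p : Prog) (s : State) (B : ℕ) (Q : State → Prop) : Prop :=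
  ∃ t s', Exec ω p s t s' ∧ t ≤ B ∧ Q s'

/-- The states `s` and `s'` agree outside the natural-number arrays in `ns` and the real arrays
in `rs`. -/
structure Frame (ns rs : List ℕ) (s s' : State) : Prop where
  nat : ∀ a, a ∉ ns → s'.nat a = s.nat a
  real : ∀ a, a ∉ rs → s'.real a = s.real a

lemma Frame.refl (ns rs : List ℕ) (s : State) : Frame ns rs s s := ⟨fun _ _ => rfl, fun _ _ => rfl⟩

lemma Frame.trans {ns rs : List ℕ} {s₁ s₂ s₃ : State} (h : Frame ns rs s₁ s₂)
    (h' : Frame ns rs s₂ s₃) : Frame ns rs s₁ s₃ :=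
  ⟨fun a ha => (h'.nat a ha).trans (h.nat a ha), fun a ha => (h'.real a ha).trans (h.real a ha)⟩

lemma Frame.mono {ns rs ns' rs' : List ℕ} {s s' : State} (h : Frame ns rs s s') (hn : ns ⊆ ns')
    (hr : rs ⊆ rs') : Frame ns' rs' s s' :=
  ⟨fun a ha => h.nat a fun h' => ha (hn h'), fun a ha => h.real a fun h' => ha (hr h')⟩

lemma setCell_array_ne {X : Type} (f : ℕ → ℕ → ℕ → X) {a a' : ℕ} (i j : ℕ) (x : X) (h : a' ≠ a) :
    setCell f a i j x a' = f a' := by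
  funext i' j'; simp [setCell, h]

lemma nat_mk_array_ne (f : ℕ → ℕ → ℕ → ℕ) (ρ : ℕ → ℕ → ℕ → ℝ) (pos : ℕ) {a a' : ℕ} (i j x : ℕ)
    (h : a' ≠ a) : (⟨setCell f a i j x, ρ, pos⟩ : State).nat a' = f a' :=
  setCell_array_ne f i j x h

lemma setCell_same {X : Type} (f : ℕ → ℕ → ℕ → X) (a i j : ℕ) (x : X) :
    setCell f a i j x a i j = x := by simp [setCell]

lemma setCell_cell_ne {X : Type} (f : ℕ → ℕ → ℕ → X) (a i : ℕ) {j j' : ℕ} (x : X) (h : j' ≠ j) :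
    setCell f a i j x a i j' = f a i j' := by simp [setCell, h]

lemma Frame.nset {ns : List ℕ} {a : ℕ} (h : a ∈ ns) (rs : List ℕ) (s : State) (i j x : ℕ) :
    Frame ns rs s { s with nat := setCell s.nat a i j x } :=
  ⟨fun _ ha' => setCell_array_ne _ _ _ _ fun h' => ha' (h' ▸ h), fun _ _ => rfl⟩

lemma Frame.rset {rs : List ℕ} {a : ℕ} (h : a ∈ rs) (ns : List ℕ) (s : State) (i j : ℕ) (x : ℝ)
    (pos : ℕ) : Frame ns rs s { s with real := setCell s.real a i j x, pos := pos } :=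
  ⟨fun _ _ => rfl, fun _ ha' => setCell_array_ne _ _ _ _ fun h' => ha' (h' ▸ h)⟩

section Runs

variable {ω : ℕ → ℝ} {p q : Prog} {s : State} {Q : State → Prop} {B : ℕ}

lemma Runs.mono {B' : ℕ} {Q' : State → Prop} (h : Runs ω p s B Q) (hB : B ≤ B')
    (hQ : ∀ s', Q s' → Q' s') : Runs ω p s B' Q' := by
  obtain ⟨t, s', he, ht, hq⟩ := h
  exact ⟨t, s', he, ht.trans hB, hQ _ hq⟩

lemma Runs.seq {B₁ B₂ : ℕ} {Q₁ : State → Prop} (h₁ : Runs ω p s B₁ Q₁)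
    (h₂ : ∀ s₁, Q₁ s₁ → Runs ω q s₁ B₂ Q) (hB : B₁ + B₂ ≤ B) : Runs ω (.seq p q) s B Q := by
  obtain ⟨t₁, s₁, he₁, ht₁, hq₁⟩ := h₁
  obtain ⟨t₂, s₂, he₂, ht₂, hq₂⟩ := h₂ s₁ hq₁
  exact ⟨_, s₂, he₁.seq he₂, by omega, hq₂⟩

lemma Runs.nset {a : ℕ} {i j e : NExp}
    (hQ : Q { s with nat := setCell s.nat a (i.eval s) (j.eval s) (e.eval s) })
    (hB : i.cost + j.cost + e.cost + 1 ≤ B) : Runs ω (.nset a i j e) s B Q :=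
  ⟨_, _, Exec.nset s a i j e, hB, hQ⟩

lemma Runs.rset {a : ℕ} {i j : NExp} {e : RExp}
    (hQ : Q { s with real := setCell s.real a (i.eval s) (j.eval s) (e.eval s) })
    (hB : i.cost + j.cost + e.cost + 1 ≤ B) : Runs ω (.rset a i j e) s B Q :=
  ⟨_, _, Exec.rset s a i j e, hB, hQ⟩

lemma Runs.gauss {a : ℕ} {i j : NExp}
    (hQ : Q { s with real := setCell s.real a (i.eval s) (j.eval s) (ω s.pos), pos := s.pos + 1 })
    (hB : i.cost + j.cost + 1 ≤ B) : Runs ω (.gauss a i j) s B Q :=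
  ⟨_, _, Exec.gauss s a i j, hB, hQ⟩

lemma Runs.ite {b : BExp} {B' : ℕ} (h₁ : b.eval s → Runs ω p s B' Q)
    (h₂ : ¬ b.eval s → Runs ω q s B' Q) (hB : b.cost + B' ≤ B) : Runs ω (.ite b p q) s B Q := by
  by_cases hb : b.eval s
  · obtain ⟨t, s', he, ht, hq⟩ := h₁ hb
    exact ⟨_, s', Exec.ite_true hb he, by omega, hq⟩
  · obtain ⟨t, s', he, ht, hq⟩ := h₂ hb
    exact ⟨_, s', Exec.ite_false hb he, by omega, hq⟩

/-- The test is evaluated once more than the body, which accounts for the last summand. -/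
lemma Runs.loop {b : BExp} (N : ℕ) (c : ℕ → ℕ) (I : ℕ → State → Prop) (h0 : I 0 s)
    (hb : ∀ i s, i ≤ N → I i s → (b.eval s ↔ i < N))
    (hstep : ∀ i < N, ∀ s, I i s → Runs ω p s (c i) (I (i + 1))) :
    Runs ω (.loop b p) s (∑ i ∈ Finset.range N, (c i + b.cost) + b.cost) (I N) := by
  have key : ∀ j, ∀ i, i + j = N → ∀ s, I i s →
      Runs ω (.loop b p) s (∑ l ∈ Finset.Ico i N, (c l + b.cost) + b.cost) (I N) := by
    intro j
    induction j with
    | zero =>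
      intro i hi s hs
      obtain rfl : i = N := by omega
      exact ⟨_, s, Exec.loop_false fun h => by simpa using (hb _ s le_rfl hs).1 h, by simp, hs⟩
    | succ j ih =>
      intro i hi s hs
      have hiN : i < N := by omega
      obtain ⟨t₁, s₁, he₁, ht₁, hq₁⟩ := hstep i hiN s hs
      obtain ⟨t₂, s₂, he₂, ht₂, hq₂⟩ := ih (i + 1) (by omega) s₁ hq₁
      refine ⟨_, s₂, Exec.loop_true ((hb i s hiN.le hs).2 hiN) he₁ he₂, ?_, hq₂⟩
      rw [Finset.sum_eq_sum_Ico_succ_bot hiN]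
      omega
  rw [Finset.range_eq_Ico]
  exact key N 0 (by omega) s h0

end Runs

/-- The value of the natural-number variable stored in cell `(0, 0)` of array `a`. -/
def nvar (a : ℕ) : NExp := .get a (.lit 0) (.lit 0)

/-- The value of the real variable stored in cell `(0, 0)` of array `a`. -/
def rvar (a : ℕ) : RExp := .get a (.lit 0) (.lit 0)

/-- Assignment to a natural-number variable. -/
def nassign (a : ℕ) (e : NExp) : Prog := .nset a (.lit 0) (.lit 0) e

/-- Assignment to a real variable. -/
def rassign (a : ℕ) (e : RExp) : Prog := .rset a (.lit 0) (.lit 0) e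

/-- The test `x < y`. -/
def nlt (x y : NExp) : BExp := .not (.nle y x)

/-- `for x < bound do body`. -/
def forLoop (x : ℕ) (bound : NExp) (body : Prog) : Prog :=
  .seq (nassign x (.lit 0))
    (.loop (nlt (nvar x) bound) (.seq body (nassign x (.add (nvar x) (.lit 1)))))

lemma eval_nvar (s : State) (a : ℕ) : (nvar a).eval s = s.nat a 0 0 := rfl

lemma eval_rvar (s : State) (a : ℕ) : (rvar a).eval s = s.real a 0 0 := rfl

lemma cost_nvar (a : ℕ) : (nvar a).cost = 3 := rfl

lemma cost_rvar (a : ℕ) : (rvar a).cost = 3 := rfl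

lemma eval_nlt (s : State) (x y : NExp) : (nlt x y).eval s ↔ x.eval s < y.eval s := by
  simp [nlt, BExp.eval]

lemma cost_nlt (x y : NExp) : (nlt x y).cost = x.cost + y.cost + 2 := by
  simp only [nlt, BExp.cost]; omega

/-- The invariant must survive a write to the counter, because the counter is advanced after the
body. Each round pays `8` for the increment and `bound.cost + 5` for the test. -/
lemma Runs.forLoop {ω : ℕ → ℝ} {s : State} {x : ℕ} {bound : NExp} {body : Prog} (N : ℕ)
    (ns rs : List ℕ) (J : ℕ → State → Prop) (c : ℕ → ℕ) (hx : x ∈ ns)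
    (hbound : ∀ s', Frame ns rs s s' → bound.eval s' = N)
    (hJ : ∀ i s' v, J i s' → J i { s' with nat := setCell s'.nat x 0 0 v })
    (hJ0 : J 0 s)
    (hbody : ∀ i < N, ∀ s', Frame ns rs s s' → s'.nat x 0 0 = i → J i s' →
      Runs ω body s' (c i) fun s'' => Frame ns rs s' s'' ∧ s''.nat x 0 0 = i ∧ J (i + 1) s'') :
    Runs ω (forLoop x bound body) s
      (∑ i ∈ Finset.range N, (c i + bound.cost + 13) + bound.cost + 9)
      fun s' => Frame ns rs s s' ∧ J N s' := by
  let I : ℕ → State → Prop := fun i s' => (Frame ns rs s s' ∧ J i s') ∧ s'.nat x 0 0 = i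
  refine Runs.seq (Q₁ := I 0) (B₁ := 4)
    (B₂ := ∑ i ∈ Finset.range N, (c i + 8 + (bound.cost + 5)) + (bound.cost + 5)) ?_ ?_ ?_
  · refine Runs.nset ⟨⟨Frame.nset hx _ _ _ _ _, hJ _ _ _ hJ0⟩, setCell_same _ _ _ _ _⟩ le_rfl
  · intro s₁ hs₁
    have hcost : (nlt (nvar x) bound).cost = bound.cost + 5 := by
      rw [cost_nlt, cost_nvar]; omega
    rw [← hcost]
    refine (Runs.loop N (fun i => c i + 8) I hs₁ ?_ ?_).mono le_rfl fun s' h => h.1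
    · intro i s' _ hs'
      rw [eval_nlt, hbound s' hs'.1.1, eval_nvar, hs'.2]
    · intro i hi s' hs'
      refine Runs.seq (hbody i hi s' hs'.1.1 hs'.2 hs'.1.2) (B₂ := 8) (fun s'' hs'' => ?_) le_rfl
      have hv : s''.nat x 0 0 = i := hs''.2.1
      refine Runs.nset ⟨⟨(hs'.1.1.trans hs''.1).trans (Frame.nset hx _ _ _ _ _),
        hJ _ _ _ hs''.2.2⟩, ?_⟩ le_rfl
      simp only [NExp.eval, setCell_same, eval_nvar, hv]
  · have : ∀ i, c i + 8 + (bound.cost + 5) = c i + bound.cost + 13 := fun i => by omega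
    simp only [this]
    omega

/-- A loop whose `i`-th round establishes `G i` and keeps what the earlier rounds established. -/
lemma Runs.forEach {ω : ℕ → ℝ} {s : State} {x : ℕ} {bound : NExp} {body : Prog} (N : ℕ)
    (ns rs : List ℕ) (G : ℕ → State → Prop) (c : ℕ → ℕ) (hx : x ∈ ns)
    (hbound : ∀ s', Frame ns rs s s' → bound.eval s' = N)
    (hG : ∀ i s' v, G i s' → G i { s' with nat := setCell s'.nat x 0 0 v })
    (hbody : ∀ i < N, ∀ s', Frame ns rs s s' → s'.nat x 0 0 = i →
      Runs ω body s' (c i) fun s'' => Frame ns rs s' s'' ∧ s''.nat x 0 0 = i ∧ G i s'' ∧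
        ∀ i' < i, G i' s' → G i' s'') :
    Runs ω (LatentSimplex.forLoop x bound body) s
      (∑ i ∈ Finset.range N, (c i + bound.cost + 13) + bound.cost + 9)
      fun s' => Frame ns rs s s' ∧ ∀ i < N, G i s' := by
  refine Runs.forLoop N ns rs (fun i s' => ∀ i' < i, G i' s') c hx hbound
    (fun i s' v h i' hi' => hG _ _ _ (h i' hi')) (fun i hi => absurd hi (by omega)) ?_
  intro i hi s' hs' hxi hJ
  refine (hbody i hi s' hs' hxi).mono le_rfl fun s'' hs'' => ⟨hs''.1, hs''.2.1, fun i' hi' => ?_⟩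
  rcases Nat.lt_succ_iff_lt_or_eq.1 hi' with h | rfl
  · exact hs''.2.2.2 i' h (hJ i' h)
  · exact hs''.2.2.1

/-- `acc := ∑ x < bound, e`. -/
def sumLoop (acc x : ℕ) (bound : NExp) (e : RExp) : Prog :=
  .seq (rassign acc (.lit 0)) (forLoop x bound (rassign acc (.add (rvar acc) e)))

lemma Runs.sumLoop {ω : ℕ → ℝ} {s : State} {acc x : ℕ} {bound : NExp} {e : RExp} (N : ℕ)
    (f : ℕ → ℝ) (hbound : ∀ s', Frame [x] [acc] s s' → bound.eval s' = N)
    (he : ∀ i < N, ∀ s', Frame [x] [acc] s s' → s'.nat x 0 0 = i → e.eval s' = f i) :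
    Runs ω (sumLoop acc x bound e) s ((N + 1) * (e.cost + bound.cost + 20))
      fun s' => Frame [x] [acc] s s' ∧ s'.real acc 0 0 = ∑ i ∈ Finset.range N, f i := by
  refine Runs.seq (B₁ := 4) (Q₁ := fun s' => Frame [x] [acc] s s' ∧ s'.real acc 0 0 = 0)
    (B₂ := ∑ i ∈ Finset.range N, (e.cost + 7 + bound.cost + 13) + bound.cost + 9) ?_ ?_ ?_
  · refine Runs.rset ⟨Frame.rset (by simp) _ _ _ _ _ _, ?_⟩ le_rfl
    simp [NExp.eval, setCell_same, RExp.eval]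
  · intro s₁ hs₁
    refine (Runs.forLoop N [x] [acc] (fun i s' => s'.real acc 0 0 = ∑ j ∈ Finset.range i, f j)
      (fun _ => e.cost + 7) (by simp) (fun s' hs' => hbound s' (hs₁.1.trans hs'))
      (fun _ _ _ h => h) (by simpa using hs₁.2) ?_).mono le_rfl
      fun s' hs' => ⟨hs₁.1.trans hs'.1, hs'.2⟩
    intro i hi s' hs' hxi hJ
    refine Runs.rset ⟨Frame.rset (by simp) _ _ _ _ _ _, hxi, ?_⟩ ?_
    · simp only [NExp.eval, setCell_same, RExp.eval, eval_rvar]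
      rw [hJ, he i hi s' (hs₁.1.trans hs') hxi, Finset.sum_range_succ]
    · simp only [NExp.cost, RExp.cost, cost_rvar]; omega
  · simp only [Finset.sum_const, Finset.card_range, smul_eq_mul]
    ring_nf
    omega

/-! ### Merge sort -/

/-- The list `f a, …, f (b - 1)`. -/
def seg (f : ℕ → ℕ) (a b : ℕ) : List ℕ := (List.range' a (b - a)).map f

lemma seg_of_le (f : ℕ → ℕ) {a b : ℕ} (h : b ≤ a) : seg f a b = [] := by
  simp [seg, Nat.sub_eq_zero_of_le h]

lemma seg_cons (f : ℕ → ℕ) {a b : ℕ} (h : a < b) : seg f a b = f a :: seg f (a + 1) b := by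
  have : b - a = (b - (a + 1)) + 1 := by omega
  rw [seg, this, List.range'_succ, List.map_cons, seg]

lemma seg_snoc (f : ℕ → ℕ) {a b : ℕ} (h : a ≤ b) : seg f a (b + 1) = seg f a b ++ [f b] := by
  have : b + 1 - a = (b - a) + 1 := by omega
  rw [seg, this, List.range'_1_concat, List.map_append, seg]
  simp [Nat.add_sub_cancel' h]

lemma seg_append (f : ℕ → ℕ) {a b c : ℕ} (h : a ≤ b) (h' : b ≤ c) :
    seg f a b ++ seg f b c = seg f a c := by
  rw [seg, seg, seg, ← List.map_append]
  have h1 : c - a = (b - a) + (c - b) := by omega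
  have h2 : b = a + (b - a) := by omega
  rw [h1, ← List.range'_append_1, ← h2]

lemma seg_congr {f g : ℕ → ℕ} {a b : ℕ} (h : ∀ i, a ≤ i → i < b → f i = g i) :
    seg f a b = seg g a b := by
  refine List.map_congr_left fun i hi => ?_
  rw [List.mem_range'_1] at hi
  exact h i hi.1 (by omega)

/-- Merging two lists of indices by the keys `κ`. -/
noncomputable def mergeBy (κ : ℕ → ℝ) (l l' : List ℕ) : List ℕ :=
  List.merge l l' fun a b => decide (κ a ≤ κ b)

/-- The hypothesis lists the cases in which the program takes from the left run: the right run is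
exhausted, or its head has no smaller key. -/
lemma mergeBy_left (κ : ℕ → ℝ) {f : ℕ → ℕ} {i m j h : ℕ} (hi : i < m)
    (hij : h ≤ j ∨ κ (f i) ≤ κ (f j)) :
    mergeBy κ (seg f i m) (seg f j h) = f i :: mergeBy κ (seg f (i + 1) m) (seg f j h) := by
  rw [seg_cons f hi]
  rcases le_or_gt h j with hj | hj
  · rw [seg_of_le f hj]; simp [mergeBy]
  · rw [seg_cons f hj, mergeBy, List.cons_merge_cons_pos, mergeBy]
    simpa using hij.resolve_left (by omega)

lemma mergeBy_right (κ : ℕ → ℝ) {f : ℕ → ℕ} {i m j h : ℕ} (hj : j < h)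
    (hij : m ≤ i ∨ ¬ κ (f i) ≤ κ (f j)) :
    mergeBy κ (seg f i m) (seg f j h) = f j :: mergeBy κ (seg f i m) (seg f (j + 1) h) := by
  rw [seg_cons f hj]
  rcases le_or_gt m i with hi | hi
  · rw [seg_of_le f hi]; simp [mergeBy]
  · rw [seg_cons f hi, mergeBy, List.cons_merge_cons_neg, mergeBy]
    simpa using hij.resolve_left (by omega)

/-- The list of indices is sorted by the keys `κ`. -/
def SortedBy (κ : ℕ → ℝ) (l : List ℕ) : Prop := l.Pairwise fun a b => κ a ≤ κ b

lemma SortedBy.mergeBy {κ : ℕ → ℝ} {l l' : List ℕ} (h : SortedBy κ l) (h' : SortedBy κ l') :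
    SortedBy κ (mergeBy κ l l') := by
  have := List.pairwise_merge (le := fun a b => decide (κ a ≤ κ b))
    (fun a b c hab hbc => by simp only [decide_eq_true_eq] at *; exact hab.trans hbc)
    (fun a b => by simpa using le_total _ _) l l' (by simpa [SortedBy] using h)
    (by simpa [SortedBy] using h')
  simpa [SortedBy, LatentSimplex.mergeBy] using this

lemma mergeBy_perm (κ : ℕ → ℝ) (l l' : List ℕ) : (mergeBy κ l l').Perm (l ++ l') :=
  List.merge_perm_append _

/-- A loop whose cost is paid by a decreasing potential. -/
lemma Runs.loop_potential {ω : ℕ → ℝ} {p : Prog} {b : BExp} (I : State → Prop) (φ : State → ℕ)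
    (hstep : ∀ s, I s → b.eval s →
      ∃ c, Runs ω p s c fun s' => I s' ∧ φ s' + c + b.cost ≤ φ s) (s : State) (hs : I s) :
    Runs ω (.loop b p) s (φ s + b.cost) fun s' => I s' ∧ ¬ b.eval s' := by
  have hb0 : 0 < b.cost := by cases b <;> simp only [BExp.cost] <;> omega
  have key : ∀ N, ∀ s, φ s < N → I s →
      Runs ω (.loop b p) s (φ s + b.cost) fun s' => I s' ∧ ¬ b.eval s' := by
    intro N
    induction N with
    | zero => intro s h; omega
    | succ N ih =>
      intro s hφ hs
      by_cases hb : b.eval s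
      · obtain ⟨c, t₁, s₁, he₁, ht₁, hI, hc⟩ := hstep s hs hb
        obtain ⟨t₂, s₂, he₂, ht₂, hq₂⟩ := ih s₁ (by omega) hI
        exact ⟨_, s₂, Exec.loop_true hb he₁ he₂, by omega, hq₂⟩
      · exact ⟨_, s, Exec.loop_false hb, by omega, hs, hb⟩
  exact key _ s (Nat.lt_succ_self _) hs

/-- Copy `idx[pass][src]` to `idx[pass + 1][o]` and advance the variable `v` holding `src`. -/
def takeFrom (v : ℕ) : Prog :=
  .seq (.nset 20 (.add (nvar 28) (.lit 1)) (nvar 27) (.get 20 (nvar 28) (nvar v)))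
    (.seq (nassign v (.add (nvar v) (.lit 1))) (nassign 27 (.add (nvar 27) (.lit 1))))

/-- One step of the merge of two neighbouring runs. -/
def mergeStep : Prog :=
  .ite (.nle (nvar 24) (nvar 26)) (takeFrom 25)
    (.ite (.nle (nvar 23) (nvar 25)) (takeFrom 26)
      (.ite (.rle (.get 8 (.lit 0) (.get 20 (nvar 28) (nvar 25)))
          (.get 8 (.lit 0) (.get 20 (nvar 28) (nvar 26)))) (takeFrom 25) (takeFrom 26)))

/-- Merge the runs `[lo, mid)` and `[mid, hi)` of row `pass` of the index array into the next row,
starting with `i = lo`, `j = mid`, `o = lo`. -/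
def mergeRuns : Prog := .loop (nlt (nvar 27) (nvar 24)) mergeStep

/-- The state reached from `s₀` while two runs are merged. -/
structure MergeInv (κ : ℕ → ℝ) (s₀ s : State) (lo mid hi pass : ℕ) : Prop where
  frame : Frame [20, 25, 26, 27] [] s₀ s
  i_ge : lo ≤ s.nat 25 0 0
  i_le : s.nat 25 0 0 ≤ mid
  j_ge : mid ≤ s.nat 26 0 0
  j_le : s.nat 26 0 0 ≤ hi
  o_eq : s.nat 27 0 0 + mid = s.nat 25 0 0 + s.nat 26 0 0
  row : ∀ p, p ≠ pass + 1 → s.nat 20 p = s₀.nat 20 p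
  outside : ∀ p, p < lo ∨ hi ≤ p → s.nat 20 (pass + 1) p = s₀.nat 20 (pass + 1) p
  -- What has been written, followed by the merge of the two remainders, is always the full merge.
  merged : seg (s.nat 20 (pass + 1)) lo (s.nat 27 0 0) ++
    mergeBy κ (seg (s₀.nat 20 pass) (s.nat 25 0 0) mid) (seg (s₀.nat 20 pass) (s.nat 26 0 0) hi) =
    mergeBy κ (seg (s₀.nat 20 pass) lo mid) (seg (s₀.nat 20 pass) mid hi)

/-- The hypothesis on `v` says that the head of the chosen run is the head of the merge of the
remainders, so moving it to the output leaves the concatenation in `merged` unchanged. -/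
lemma MergeInv.takeFrom {ω : ℕ → ℝ} {κ : ℕ → ℝ} {s₀ s : State} {lo mid hi pass v : ℕ}
    (h : MergeInv κ s₀ s lo mid hi pass) (hp : s₀.nat 28 0 0 = pass)
    (hv : v = 25 ∧ s.nat 25 0 0 < mid ∧ (hi ≤ s.nat 26 0 0 ∨
        κ (s₀.nat 20 pass (s.nat 25 0 0)) ≤ κ (s₀.nat 20 pass (s.nat 26 0 0))) ∨
      v = 26 ∧ s.nat 26 0 0 < hi ∧ (mid ≤ s.nat 25 0 0 ∨
        ¬ κ (s₀.nat 20 pass (s.nat 25 0 0)) ≤ κ (s₀.nat 20 pass (s.nat 26 0 0)))) :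
    Runs ω (takeFrom v) s 40 fun s' => MergeInv κ s₀ s' lo mid hi pass ∧
      s'.nat 27 0 0 = s.nat 27 0 0 + 1 := by
  have hp' : s.nat 28 0 0 = pass := by rw [h.frame.nat 28 (by decide), hp]
  obtain ⟨hfr, h1, h2, h3, h4, h5, h6, h7, h8⟩ := h
  have hsrc : s.nat 20 pass = s₀.nat 20 pass := h6 pass (by omega)
  have hseg : ∀ (f : ℕ → ℕ) (x : ℕ), f (s.nat 27 0 0) = x →
      (∀ q, q < s.nat 27 0 0 → f q = s.nat 20 (pass + 1) q) →
      seg f lo (s.nat 27 0 0 + 1) = seg (s.nat 20 (pass + 1)) lo (s.nat 27 0 0) ++ [x] := by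
    intro f x hx hf
    rw [seg_snoc _ (by omega), hx]
    congr 1
    exact seg_congr fun i _ hi => hf i hi
  rcases hv with ⟨rfl, hv1, hv2⟩ | ⟨rfl, hv1, hv2⟩
  · refine Runs.seq (B₁ := 18) (B₂ := 22) 
      (Q₁ := fun s₁ => s₁ = { s with
        nat := setCell s.nat 20 (pass + 1) (s.nat 27 0 0) (s.nat 20 pass (s.nat 25 0 0)) })
      (Runs.nset ?_ ?_) ?_ le_rfl
    · simp [NExp.eval, nvar, hp']
    · simp [NExp.cost, nvar]
    rintro s₁ rfl
    refine Runs.seq (B₁ := 11) (B₂ := 11) 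
      (Q₁ := fun s₂ => s₂ = { s with
        nat := setCell (setCell s.nat 20 (pass + 1) (s.nat 27 0 0)
          (s.nat 20 pass (s.nat 25 0 0))) 25 0 0 (s.nat 25 0 0 + 1) })
      (Runs.nset ?_ ?_) ?_ le_rfl
    · simp [NExp.eval, nvar, setCell]
    · simp [NExp.cost, nvar]
    rintro s₂ rfl
    refine Runs.nset ⟨⟨?_, ?_, ?_, ?_, ?_, ?_, ?_, ?_, ?_⟩, ?_⟩ ?_
    · refine hfr.trans ⟨fun a ha => ?_, fun _ _ => rfl⟩
      simp only [List.mem_cons, not_or] at ha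
      simp [NExp.eval, setCell_array_ne, ha]
    · simp [NExp.eval, setCell]; omega
    · simp [NExp.eval, setCell]; omega
    · simp [NExp.eval, setCell]; omega
    · simp [NExp.eval, setCell]; omega
    · simp [NExp.eval, setCell, nvar]; omega
    · intro p hp
      rw [← h6 p hp]
      funext q
      simp [NExp.eval, setCell, hp]
    · intro p hp
      rw [← h7 p hp]
      have : p ≠ s.nat 27 0 0 := by omega
      simp [NExp.eval, setCell, this]
    · rw [← h8, mergeBy_left κ hv1 hv2]
      simp only [NExp.eval, setCell, nvar]
      simp only [hsrc, reduceCtorEq, Nat.reduceEqDiff, false_and, and_self, if_true,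
        if_false]
      rw [hseg _ (s₀.nat 20 pass (s.nat 25 0 0)) (by simp [setCell])
        (fun q hq => by simp [setCell, hq.ne])]
      simp
    · simp [NExp.eval, setCell, nvar]
    · simp [NExp.cost, nvar]
  · refine Runs.seq (B₁ := 18) (B₂ := 22) 
      (Q₁ := fun s₁ => s₁ = { s with
        nat := setCell s.nat 20 (pass + 1) (s.nat 27 0 0) (s.nat 20 pass (s.nat 26 0 0)) })
      (Runs.nset ?_ ?_) ?_ le_rfl
    · simp [NExp.eval, nvar, hp']
    · simp [NExp.cost, nvar]
    rintro s₁ rfl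
    refine Runs.seq (B₁ := 11) (B₂ := 11) 
      (Q₁ := fun s₂ => s₂ = { s with
        nat := setCell (setCell s.nat 20 (pass + 1) (s.nat 27 0 0)
          (s.nat 20 pass (s.nat 26 0 0))) 26 0 0 (s.nat 26 0 0 + 1) })
      (Runs.nset ?_ ?_) ?_ le_rfl
    · simp [NExp.eval, nvar, setCell]
    · simp [NExp.cost, nvar]
    rintro s₂ rfl
    refine Runs.nset ⟨⟨?_, ?_, ?_, ?_, ?_, ?_, ?_, ?_, ?_⟩, ?_⟩ ?_
    · refine hfr.trans ⟨fun a ha => ?_, fun _ _ => rfl⟩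
      simp only [List.mem_cons, not_or] at ha
      simp [NExp.eval, setCell_array_ne, ha]
    · simp [NExp.eval, setCell]; omega
    · simp [NExp.eval, setCell]; omega
    · simp [NExp.eval, setCell]; omega
    · simp [NExp.eval, setCell]; omega
    · simp [NExp.eval, setCell, nvar]; omega
    · intro p hp
      rw [← h6 p hp]
      funext q
      simp [NExp.eval, setCell, hp]
    · intro p hp
      rw [← h7 p hp]
      have : p ≠ s.nat 27 0 0 := by omega
      simp [NExp.eval, setCell, this]
    · rw [← h8, mergeBy_right κ hv1 hv2]
      simp only [NExp.eval, setCell, nvar]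
      simp only [hsrc, reduceCtorEq, Nat.reduceEqDiff, false_and, and_self, if_true,
        if_false]
      rw [hseg _ (s₀.nat 20 pass (s.nat 26 0 0)) (by simp [setCell])
        (fun q hq => by simp [setCell, hq.ne])]
      simp
    · simp [NExp.eval, setCell, nvar]
    · simp [NExp.cost, nvar]

/-- Every round writes one element, and the potential pays `92` for the body and `8` for the test.
When the output position reaches `hi`, the relation between the three positions shows that both runs
are exhausted. -/
lemma Runs.mergeRuns {ω : ℕ → ℝ} {s₀ : State} {lo mid hi pass : ℕ} (hlm : lo ≤ mid)
    (hmh : mid ≤ hi) (hmid : s₀.nat 23 0 0 = mid) (hhi : s₀.nat 24 0 0 = hi)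
    (hpass : s₀.nat 28 0 0 = pass) (hi0 : s₀.nat 25 0 0 = lo) (hj0 : s₀.nat 26 0 0 = mid)
    (ho0 : s₀.nat 27 0 0 = lo) :
    Runs ω mergeRuns s₀ ((hi - lo) * 100 + 8) fun s =>
      Frame [20, 25, 26, 27] [] s₀ s ∧ (∀ p, p ≠ pass + 1 → s.nat 20 p = s₀.nat 20 p) ∧
      (∀ p, p < lo ∨ hi ≤ p → s.nat 20 (pass + 1) p = s₀.nat 20 (pass + 1) p) ∧
      seg (s.nat 20 (pass + 1)) lo hi =
        mergeBy (s₀.real 8 0) (seg (s₀.nat 20 pass) lo mid) (seg (s₀.nat 20 pass) mid hi) := by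
  have h := Runs.loop_potential (ω := ω) (b := nlt (nvar 27) (nvar 24)) (p := mergeStep)
    (fun s => MergeInv (s₀.real 8 0) s₀ s lo mid hi pass) (fun s => (hi - s.nat 27 0 0) * 100)
    (fun s hs hb => by
      rw [eval_nlt, eval_nvar, eval_nvar, hs.frame.nat 24 (by decide), hhi] at hb
      refine ⟨92, ?_⟩
      have e1 : s.nat 24 0 0 = hi := by rw [hs.frame.nat 24 (by decide), hhi]
      have e2 : s.nat 23 0 0 = mid := by rw [hs.frame.nat 23 (by decide), hmid]
      have e3 : s.nat 28 0 0 = pass := by rw [hs.frame.nat 28 (by decide), hpass]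
      have e4 : s.nat 20 pass = s₀.nat 20 pass := hs.row pass (by omega)
      have e5 : s.real 8 = s₀.real 8 := hs.frame.real 8 (by decide)
      have ho := hs.o_eq
      have hjl := hs.j_le
      have hil := hs.i_le
      have fin : ∀ s' : State, (MergeInv (s₀.real 8 0) s₀ s' lo mid hi pass ∧
          s'.nat 27 0 0 = s.nat 27 0 0 + 1) → MergeInv (s₀.real 8 0) s₀ s' lo mid hi pass ∧
          (hi - s'.nat 27 0 0) * 100 + 92 + (nlt (nvar 27) (nvar 24)).cost ≤
            (hi - s.nat 27 0 0) * 100 := by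
        intro s' hs'
        refine ⟨hs'.1, ?_⟩
        rw [hs'.2, cost_nlt, cost_nvar, cost_nvar]
        omega
      refine Runs.ite (B' := 84) (fun hb1 => ?_) (fun hb1 => ?_) (by simp [BExp.cost, cost_nvar])
      · simp only [BExp.eval, eval_nvar, e1] at hb1
        exact (hs.takeFrom hpass (Or.inl ⟨rfl, by omega, Or.inl hb1⟩)).mono (by omega) fin
      · simp only [BExp.eval, eval_nvar, e1] at hb1
        refine Runs.ite (B' := 76) (fun hb2 => ?_) (fun hb2 => ?_) (by simp [BExp.cost, cost_nvar])
        · simp only [BExp.eval, eval_nvar, e2] at hb2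
          exact (hs.takeFrom hpass (Or.inr ⟨rfl, by omega, Or.inl hb2⟩)).mono (by omega) fin
        · simp only [BExp.eval, eval_nvar, e2] at hb2
          refine Runs.ite (B' := 40) (fun hb3 => ?_) (fun hb3 => ?_)
            (by simp [BExp.cost, RExp.cost, NExp.cost, cost_nvar])
          · simp only [BExp.eval, RExp.eval, NExp.eval, eval_nvar, e3, e4, e5] at hb3
            exact (hs.takeFrom hpass (Or.inl ⟨rfl, by omega, Or.inr hb3⟩)).mono (by omega) fin
          · simp only [BExp.eval, RExp.eval, NExp.eval, eval_nvar, e3, e4, e5] at hb3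
            exact (hs.takeFrom hpass (Or.inr ⟨rfl, by omega, Or.inr hb3⟩)).mono (by omega) fin)
    s₀ ⟨Frame.refl _ _ _, by omega, by omega, by omega, by omega, by omega, fun _ _ => rfl,
      fun _ _ => rfl, by rw [hi0, hj0, ho0, seg_of_le _ le_rfl, List.nil_append]⟩
  refine h.mono (by rw [ho0, cost_nlt, cost_nvar, cost_nvar]) ?_
  rintro s ⟨hs, hb⟩
  refine ⟨hs.frame, hs.row, hs.outside, ?_⟩
  rw [eval_nlt, eval_nvar, eval_nvar, hs.frame.nat 24 (by decide), hhi] at hb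
  have ho := hs.o_eq
  have hjl := hs.j_le
  have hil := hs.i_le
  have := hs.merged
  rw [seg_of_le _ (show mid ≤ s.nat 25 0 0 by omega),
    seg_of_le _ (show hi ≤ s.nat 26 0 0 by omega)] at this
  rw [← this, show s.nat 27 0 0 = hi by omega]
  simp [LatentSimplex.mergeBy]

lemma Runs.nassign_seq {ω : ℕ → ℝ} {q : Prog} {s : State} {Q : State → Prop} {a B B' : ℕ}
    {e : NExp} (h : Runs ω q { s with nat := setCell s.nat a 0 0 (e.eval s) } B' Q)
    (hB : e.cost + 3 + B' ≤ B) : Runs ω (.seq (nassign a e) q) s B Q :=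
  Runs.seq (B₁ := e.cost + 3) (Q₁ := fun s₁ => s₁ = { s with nat := setCell s.nat a 0 0 (e.eval s) })
    (Runs.nset rfl (by simp [NExp.cost]; omega)) (fun s₁ hs₁ => hs₁ ▸ h) hB

/-- The number of columns. -/
def sizeN : NExp := .get 0 (.lit 0) (.lit 1)

/-- `min n e`. -/
def minN (e : NExp) : NExp := .sub sizeN (.sub sizeN e)

/-- Subtraction is truncated, so `n - (n - e)` is `e` or `n`, whichever is smaller. -/
lemma eval_minN (s : State) (e : NExp) : (minN e).eval s = min (s.nat 0 0 1) (e.eval s) := by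
  simp only [minN, sizeN, NExp.eval]; omega

/-- Set the borders and positions for merging the two runs of length `w` that start at `lo`. -/
def mergeSetup : Prog :=
  .seq (nassign 23 (minN (.add (nvar 22) (nvar 21))))
    (.seq (nassign 24 (minN (.add (nvar 22) (.add (nvar 21) (nvar 21)))))
      (.seq (nassign 25 (nvar 22)) (.seq (nassign 26 (nvar 23)) (nassign 27 (nvar 22)))))

lemma Runs.mergeSetup {ω : ℕ → ℝ} {s₀ : State} {n w lo : ℕ} (hn : s₀.nat 0 0 1 = n)
    (hw : s₀.nat 21 0 0 = w) (hlo : s₀.nat 22 0 0 = lo) :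
    Runs ω mergeSetup s₀ 64 fun s => Frame [23, 24, 25, 26, 27] [] s₀ s ∧
      s.nat 23 0 0 = min n (lo + w) ∧ s.nat 24 0 0 = min n (lo + 2 * w) ∧ s.nat 25 0 0 = lo ∧
      s.nat 26 0 0 = min n (lo + w) ∧ s.nat 27 0 0 = lo := by
  have hadd : lo + (w + w) = lo + 2 * w := by omega
  refine Runs.nassign_seq (B' := 44) ?_ (by simp [NExp.cost, minN, sizeN, cost_nvar])
  refine Runs.nassign_seq (B' := 20) ?_ (by simp [NExp.cost, minN, sizeN, cost_nvar])
  refine Runs.nassign_seq (B' := 14) ?_ (by simp [cost_nvar])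
  refine Runs.nassign_seq (B' := 8) ?_ (by simp [cost_nvar])
  refine Runs.nset ⟨⟨fun a ha => ?_, fun a ha => rfl⟩, ?_⟩ (by simp [NExp.cost, cost_nvar])
  · simp only [List.mem_cons, not_or] at ha
    simp [setCell_array_ne, ha]
  · simp [setCell, eval_minN, NExp.eval, eval_nvar, hn, hw, hlo, hadd]

/-- Merge the two runs of length `w` that start at `lo`, and advance `lo`. -/
def mergeBlock : Prog := .seq mergeSetup (.seq mergeRuns (nassign 22 (nvar 24)))

/-- A nonempty block pays for the constant setup, so the cost is proportional to its length. The
subtracted `10` leaves room for the loop test of the pass. -/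
lemma Runs.mergeBlock {ω : ℕ → ℝ} {s₀ : State} {n w lo pass : ℕ} (hn : s₀.nat 0 0 1 = n)
    (hw : s₀.nat 21 0 0 = w) (hlo : s₀.nat 22 0 0 = lo) (hpass : s₀.nat 28 0 0 = pass)
    (hlt : lo < n) (hw0 : 0 < w) :
    Runs ω mergeBlock s₀ ((min n (lo + 2 * w) - lo) * 300 - 10) fun s =>
      Frame [20, 22, 23, 24, 25, 26, 27] [] s₀ s ∧ s.nat 22 0 0 = min n (lo + 2 * w) ∧
      (∀ p, p ≠ pass + 1 → s.nat 20 p = s₀.nat 20 p) ∧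
      (∀ p, p < lo ∨ min n (lo + 2 * w) ≤ p → s.nat 20 (pass + 1) p = s₀.nat 20 (pass + 1) p) ∧
      seg (s.nat 20 (pass + 1)) lo (min n (lo + 2 * w)) =
        mergeBy (s₀.real 8 0) (seg (s₀.nat 20 pass) lo (min n (lo + w)))
          (seg (s₀.nat 20 pass) (min n (lo + w)) (min n (lo + 2 * w))) := by
  set hi := min n (lo + 2 * w) with hhi
  set mid := min n (lo + w) with hmid
  have hlh : lo < hi := by omega
  refine Runs.seq (Runs.mergeSetup hn hw hlo) (B₂ := (hi - lo) * 100 + 8 + 10) ?_ (by omega)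
  rintro s₁ ⟨f1, e23, e24, e25, e26, e27⟩
  refine Runs.seq (B₂ := 10) (Runs.mergeRuns (lo := lo) (mid := mid) (hi := hi) (pass := pass)
    (by omega) (by omega) e23 e24 (by rw [f1.nat 28 (by decide), hpass]) e25 e26 e27) ?_ le_rfl
  rintro s ⟨h1, h2, h3, h4⟩
  have h24 : s.nat 24 0 0 = hi := by rw [h1.nat 24 (by decide), e24]
  rw [f1.nat 20 (by decide)] at h2 h3 h4
  rw [f1.real 8 (by decide)] at h4
  refine Runs.nset ⟨?_, ?_, ?_, ?_, ?_⟩ (by simp [NExp.cost, cost_nvar])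
  · exact ((f1.mono (by decide) (by decide)).trans (h1.mono (by decide) (by decide))).trans
      (Frame.nset (by decide) _ _ _ _ _)
  · simp [NExp.eval, setCell, eval_nvar, h24]
  · intro p hp
    rw [← h2 p hp, nat_mk_array_ne _ _ _ _ _ _ (by decide)]
  · intro p hp
    rw [← h3 p hp, nat_mk_array_ne _ _ _ _ _ _ (by decide)]
  · rw [← h4, nat_mk_array_ne _ _ _ _ _ _ (by decide)]

/-- One pass of the sort: merge all pairs of neighbouring runs of length `w`. -/
def mergePass : Prog := .seq (nassign 22 (.lit 0)) (.loop (nlt (nvar 22) sizeN) mergeBlock)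

/-- The first `n` entries of `f` consist of runs of length `w` sorted by `κ`. -/
def SortedRuns (κ : ℕ → ℝ) (f : ℕ → ℕ) (n w b : ℕ) : Prop :=
  ∀ p, w ∣ p → p < b → SortedBy κ (seg f p (min n (p + w)))

/-- The state reached from `s₀` during a pass of the sort. -/
structure PassInv (κ : ℕ → ℝ) (s₀ s : State) (n w pass : ℕ) : Prop where
  frame : Frame [20, 22, 23, 24, 25, 26, 27] [] s₀ s
  lo_le : s.nat 22 0 0 ≤ n
  lo_dvd : 2 * w ∣ s.nat 22 0 0 ∨ s.nat 22 0 0 = n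
  row : ∀ p, p ≠ pass + 1 → s.nat 20 p = s₀.nat 20 p
  perm : (seg (s.nat 20 (pass + 1)) 0 (s.nat 22 0 0)).Perm (seg (s₀.nat 20 pass) 0 (s.nat 22 0 0))
  sorted : SortedRuns κ (s.nat 20 (pass + 1)) n (2 * w) (s.nat 22 0 0)

lemma Runs.mergePass {ω : ℕ → ℝ} {s₀ : State} {n w pass : ℕ} (hn : s₀.nat 0 0 1 = n)
    (hw : s₀.nat 21 0 0 = w) (hpass : s₀.nat 28 0 0 = pass) (hw0 : 0 < w)
    (hs : SortedRuns (s₀.real 8 0) (s₀.nat 20 pass) n w n) :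
    Runs ω mergePass s₀ (n * 300 + 20) fun s =>
      Frame [20, 22, 23, 24, 25, 26, 27] [] s₀ s ∧
      (seg (s.nat 20 (pass + 1)) 0 n).Perm (seg (s₀.nat 20 pass) 0 n) ∧
      SortedRuns (s₀.real 8 0) (s.nat 20 (pass + 1)) n (2 * w) n := by
  refine Runs.nassign_seq (B' := n * 300 + 8) ?_ (by simp [NExp.cost]; omega)
  have hfr0 : Frame [20, 22, 23, 24, 25, 26, 27] [] s₀
      { s₀ with nat := setCell s₀.nat 22 0 0 ((NExp.lit 0).eval s₀) } :=
    Frame.nset (by decide) _ _ _ _ _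
  have hcost : (nlt (nvar 22) sizeN).cost = 8 := rfl
  refine (Runs.loop_potential (fun s => PassInv (s₀.real 8 0) s₀ s n w pass)
    (fun s => (n - s.nat 22 0 0) * 300) (fun s h hb => ?_) _ ⟨hfr0, ?_, ?_, ?_, ?_, ?_⟩).mono ?_ ?_
  · have en : s.nat 0 0 1 = n := by rw [h.frame.nat 0 (by decide), hn]
    have ew : s.nat 21 0 0 = w := by rw [h.frame.nat 21 (by decide), hw]
    have ep : s.nat 28 0 0 = pass := by rw [h.frame.nat 28 (by decide), hpass]
    have e8 : s.real 8 = s₀.real 8 := h.frame.real 8 (by decide)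
    have e20 : s.nat 20 pass = s₀.nat 20 pass := h.row pass (by omega)
    set lo := s.nat 22 0 0 with hlo
    have hlt : lo < n := by
      rw [eval_nlt, eval_nvar] at hb
      simpa [sizeN, NExp.eval, en] using hb
    have hdvd : 2 * w ∣ lo := h.lo_dvd.resolve_right hlt.ne
    refine ⟨_, (Runs.mergeBlock en ew hlo.symm ep hlt hw0).mono le_rfl ?_⟩
    rintro s' ⟨h1, h2, h3, h4, h5⟩
    refine ⟨⟨h.frame.trans h1, by omega, ?_, ?_, ?_, ?_⟩, ?_⟩
    · rcases le_total n (lo + 2 * w) with hle | hle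
      · right; omega
      · left
        rw [h2, min_eq_right hle]
        exact Nat.dvd_add hdvd dvd_rfl
    · intro p hp
      rw [h3 p hp, h.row p hp]
    · rw [h2, ← seg_append _ (Nat.zero_le lo) (by omega), ← seg_append (s₀.nat 20 pass)
        (Nat.zero_le lo) (by omega)]
      refine List.Perm.append ?_ ?_
      · rw [seg_congr fun i _ hi => h4 i (Or.inl hi)]
        exact h.perm
      · rw [h5, ← seg_append (s₀.nat 20 pass) (show lo ≤ min n (lo + w) by omega) (by omega), e20]
        exact mergeBy_perm _ _ _
    · intro p hp hplt
      rw [h2] at hplt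
      rcases lt_or_ge p lo with hpl | hpl
      · have hpw : p + 2 * w ≤ lo := by
          obtain ⟨a, rfl⟩ := hp
          obtain ⟨b, hb'⟩ := hdvd
          rw [hb'] at hpl ⊢
          have : a < b := lt_of_mul_lt_mul_left hpl (Nat.zero_le _)
          calc 2 * w * a + 2 * w = 2 * w * (a + 1) := by ring
            _ ≤ 2 * w * b := Nat.mul_le_mul_left _ this
        rw [seg_congr fun i _ hi => h4 i (Or.inl (by omega))]
        exact h.sorted p hp hpl
      · have hpe : p = lo := by
          obtain ⟨a, rfl⟩ := hp
          obtain ⟨b, hb'⟩ := hdvd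
          rw [hb'] at hpl hplt ⊢
          have h6 : b ≤ a := le_of_mul_le_mul_left hpl (by omega)
          have h7 : 2 * w * a < 2 * w * (b + 1) := by
            calc _ < 2 * w * b + 2 * w := by omega
              _ = _ := by ring
          have h8 : a < b + 1 := lt_of_mul_lt_mul_left h7 (Nat.zero_le _)
          rw [show a = b by omega]
        rw [hpe, h5, e20]
        have hwl : w ∣ lo := (Dvd.intro_left 2 rfl).trans hdvd
        rw [e8]
        refine SortedBy.mergeBy (hs lo hwl hlt) ?_
        -- The last block may consist of a single run; the second one is then empty.
        rcases le_or_gt n (lo + w) with hle | hgt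
        · rw [seg_of_le _ (by omega)]
          exact List.Pairwise.nil
        · rw [min_eq_right hgt.le, show lo + 2 * w = lo + w + w by ring]
          exact hs (lo + w) (Nat.dvd_add hwl dvd_rfl) hgt
    · rw [h2, hcost]
      omega
  · simp [NExp.eval, setCell]
  · left; simp [NExp.eval, setCell]
  · intro p _
    rw [nat_mk_array_ne _ _ _ _ _ _ (by decide)]
  · simp [NExp.eval, setCell, seg_of_le]
  · intro p _ hp
    simp [NExp.eval, setCell] at hp
  · rw [hcost]; simp [NExp.eval, setCell]
  · rintro s ⟨h, hb⟩
    have en : s.nat 0 0 1 = n := by rw [h.frame.nat 0 (by decide), hn]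
    have : s.nat 22 0 0 = n := by
      rw [eval_nlt, eval_nvar] at hb
      simp only [sizeN, NExp.eval, en] at hb
      have := h.lo_le
      omega
    refine ⟨h.frame, ?_, ?_⟩
    · have := h.perm
      simp_all
    · have := h.sorted
      simp_all

/-- Sort the column indices by the keys in real array `8`; the result is the row of array `20`
whose number is left in variable `28`. -/
def sortCols : Prog :=
  .seq (forLoop 25 sizeN (.nset 20 (.lit 0) (nvar 25) (nvar 25)))
    (.seq (nassign 28 (.lit 0)) (.seq (nassign 21 (.lit 1))
      (.loop (nlt (nvar 21) sizeN) (.seq mergePass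
        (.seq (nassign 28 (.add (nvar 28) (.lit 1))) (nassign 21 (.add (nvar 21) (nvar 21))))))))

/-- The state reached from `s₀` between the passes of the sort. -/
structure SortInv (κ : ℕ → ℝ) (s₀ s : State) (n : ℕ) : Prop where
  frame : Frame [20, 21, 22, 23, 24, 25, 26, 27, 28] [] s₀ s
  width : s.nat 21 0 0 = 2 ^ s.nat 28 0 0
  perm : (seg (s.nat 20 (s.nat 28 0 0)) 0 n).Perm (List.range n)
  sorted : SortedRuns κ (s.nat 20 (s.nat 28 0 0)) n (s.nat 21 0 0) n

/-- The run length after `i` passes is `2^i`, so `⌈log₂ n⌉` linear passes suffice. Each pass writes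
to a fresh row, so nothing is copied back. -/
lemma Runs.sortCols {ω : ℕ → ℝ} {s₀ : State} {n : ℕ} (hn : s₀.nat 0 0 1 = n) :
    Runs ω sortCols s₀ ((Nat.clog 2 n + 1) * (n * 300 + 60)) fun s =>
      Frame [20, 21, 22, 23, 24, 25, 26, 27, 28] [] s₀ s ∧
      (seg (s.nat 20 (s.nat 28 0 0)) 0 n).Perm (List.range n) ∧
      SortedBy (s₀.real 8 0) (seg (s.nat 20 (s.nat 28 0 0)) 0 n) := by
  have hcost : (nlt (nvar 21) sizeN).cost = 8 := rfl
  have hcostN : sizeN.cost = 3 := rfl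
  refine Runs.seq (B₁ := n * 24 + 12)
    (B₂ := Nat.clog 2 n * (n * 300 + 60) + 20)
    ((Runs.forEach n [20, 25] [] (fun i s => s.nat 20 0 i = i) (fun _ => 8) (by decide)
      (fun s' hs' => ?_) ?_ ?_).mono ?_ (fun s' h => h)) ?_ ?_
  · simp [sizeN, NExp.eval, hs'.nat 0 (by decide), hn]
  · intro i s' v h
    rwa [nat_mk_array_ne _ _ _ _ _ _ (by decide)]
  · intro i _ s' _ hi
    refine Runs.nset ⟨Frame.nset (by decide) _ _ _ _ _, ?_, ?_, ?_⟩ le_rfl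
    · simp [setCell, hi]
    · simp [setCell, NExp.eval, eval_nvar, hi]
    · intro i' hi' h
      simp [setCell, NExp.eval, eval_nvar, hi, hi'.ne, h]
  · simp [hcostN]
  · rintro s₁ ⟨h1, h2⟩
    refine Runs.nassign_seq (B' := Nat.clog 2 n * (n * 300 + 60) + 8 + 4) ?_
      (by simp only [NExp.cost]; linarith)
    refine Runs.nassign_seq (B' := Nat.clog 2 n * (n * 300 + 60) + 8) ?_
      (by simp only [NExp.cost]; linarith)
    rw [show (NExp.lit 0).eval s₁ = 0 from rfl]
    generalize hs₂ : ({ s₁ with nat := setCell (setCell s₁.nat 28 0 0 0) 21 0 0 1 } : State) = s₂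
    change Runs ω _ ({ s₁ with nat := setCell (setCell s₁.nat 28 0 0 0) 21 0 0 1 } : State) _ _
    rw [hs₂]
    have hfr2 : Frame [20, 21, 22, 23, 24, 25, 26, 27, 28] [] s₀ s₂ := by
      refine (h1.mono (by decide) (by decide)).trans ?_
      refine (Frame.nset (a := 28) (by decide) _ _ 0 0 0).trans ?_
      exact hs₂ ▸ Frame.nset (a := 21) (by decide) _ _ 0 0 1
    have e28 : s₂.nat 28 0 0 = 0 := by simp [← hs₂, setCell]
    have e21 : s₂.nat 21 0 0 = 1 := by simp [← hs₂, setCell]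
    have e20 : s₂.nat 20 = s₁.nat 20 := by
      simp only [← hs₂]
      rw [setCell_array_ne _ _ _ _ (by decide), setCell_array_ne _ _ _ _ (by decide)]
    have hseg : seg (s₁.nat 20 0) 0 n = List.range n := by
      rw [seg_congr (g := id) (fun i _ hi => h2 i hi), seg]
      simp [List.range_eq_range']
    refine (Runs.loop_potential (fun s => SortInv (s₀.real 8 0) s₀ s n)
      (fun s => (Nat.clog 2 n - s.nat 28 0 0) * (n * 300 + 60)) (fun s h hb => ?_) s₂
      ⟨hfr2, ?_, ?_, ?_⟩).mono ?_ ?_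
    · have en : s.nat 0 0 1 = n := by rw [h.frame.nat 0 (by decide), hn]
      have e8 : s.real 8 = s₀.real 8 := h.frame.real 8 (by decide)
      have hlt : s.nat 21 0 0 < n := by
        rw [eval_nlt, eval_nvar] at hb
        simpa [sizeN, NExp.eval, en] using hb
      have hlt' : s.nat 28 0 0 < Nat.clog 2 n := by
        rw [h.width] at hlt
        exact (Nat.lt_clog_iff_pow_lt (by norm_num)).2 hlt
      refine ⟨n * 300 + 20 + 30, Runs.seq (Runs.mergePass en rfl rfl (by
        rw [h.width]; positivity) (by rw [e8]; exact h.sorted)) (B₂ := 30) ?_ le_rfl⟩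
      rintro s' ⟨h3, h4, h5⟩
      refine Runs.nassign_seq (B' := 15) ?_ (by simp [NExp.cost, cost_nvar])
      have e28' : s'.nat 28 0 0 = s.nat 28 0 0 := by rw [h3.nat 28 (by decide)]
      have e21' : s'.nat 21 0 0 = s.nat 21 0 0 := by rw [h3.nat 21 (by decide)]
      refine Runs.nset ⟨⟨?_, ?_, ?_, ?_⟩, ?_⟩ (by simp [NExp.cost, cost_nvar])
      · refine (h.frame.trans (h3.mono (by decide) (by decide))).trans ?_
        refine (Frame.nset (a := 28) (by decide) _ _ 0 0
          (NExp.eval s' ((nvar 28).add (NExp.lit 1)))).trans ?_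
        exact Frame.nset (a := 21) (by decide) _ _ 0 0 _
      · simp [setCell, NExp.eval, eval_nvar, e28', e21', h.width, pow_succ]
        ring
      · rw [nat_mk_array_ne _ _ _ _ _ _ (show 20 ≠ 21 by decide),
          nat_mk_array_ne _ _ _ _ _ _ (show 20 ≠ 28 by decide)]
        simp [setCell, NExp.eval, eval_nvar, e28']
        exact h4.trans h.perm
      · rw [nat_mk_array_ne _ _ _ _ _ _ (show 20 ≠ 21 by decide),
          nat_mk_array_ne _ _ _ _ _ _ (show 20 ≠ 28 by decide)]
        simp [setCell, NExp.eval, eval_nvar, e28', e21']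
        rw [← two_mul, ← e8]
        exact h5
      · simp [setCell, NExp.eval, eval_nvar, e28', hcost]
        have : Nat.clog 2 n - s.nat 28 0 0 = (Nat.clog 2 n - (s.nat 28 0 0 + 1)) + 1 := by omega
        rw [this, add_mul]
        omega
    · rw [e28, e21, pow_zero]
    · rw [e28, e20, hseg]
    · rw [e28, e20, e21]
      intro p _ hp
      rw [min_eq_right (by omega), seg_cons _ (Nat.lt_succ_self p), seg_of_le _ le_rfl]
      exact List.pairwise_singleton _ _
    · rw [e28, hcost, Nat.sub_zero]
    · rintro s ⟨h, hb⟩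
      have en : s.nat 0 0 1 = n := by rw [h.frame.nat 0 (by decide), hn]
      have hle : n ≤ s.nat 21 0 0 := by
        rw [eval_nlt, eval_nvar] at hb
        simpa [sizeN, NExp.eval, en] using hb
      refine ⟨h.frame, h.perm, ?_⟩
      rcases Nat.eq_zero_or_pos n with rfl | hn0
      · exact List.Pairwise.nil
      · have := h.sorted 0 (dvd_zero _) hn0
        rwa [zero_add, min_eq_left hle] at this
  · rw [add_mul, one_mul]; omega

/-! ### Filling tables and rows. -/

/-- `a[i, j] := ∑ z < zbound, e` for all `x < bound`. -/
def sumTable (x : ℕ) (bound : NExp) (z : ℕ) (zbound : NExp) (a : ℕ) (i j : NExp) (e : RExp) : Prog :=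
  forLoop x bound (.seq (sumLoop 5 z zbound e) (.rset a i j (rvar 5)))

/-- Injectivity of the target cells keeps later writes from destroying earlier results. That all
other cells are unchanged is what an enclosing loop needs. -/
lemma Runs.sumTable {ω : ℕ → ℝ} {s : State} {x z a : ℕ} {bound zbound i j : NExp} {e : RExp}
    (N K : ℕ) (I J : ℕ → ℕ) (f : ℕ → ℕ → ℝ) (hxz : x ≠ z)
    (hinj : ∀ l < N, ∀ l' < N, I l = I l' → J l = J l' → l = l')
    (hbound : ∀ s', Frame [x, z] [5, a] s s' → bound.eval s' = N)
    (hz : ∀ s', Frame [x, z] [5, a] s s' → zbound.eval s' = K)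
    (hi : ∀ l < N, ∀ s', Frame [x, z] [5, a] s s' → s'.nat x 0 0 = l → i.eval s' = I l)
    (hj : ∀ l < N, ∀ s', Frame [x, z] [5, a] s s' → s'.nat x 0 0 = l → j.eval s' = J l)
    (he : ∀ l < N, ∀ p < K, ∀ s', Frame [x, z] [5, a] s s' → s'.nat x 0 0 = l →
      s'.nat z 0 0 = p → e.eval s' = f l p) (ha : a ≠ 5) :
    Runs ω (sumTable x bound z zbound a i j e) s
      (N * ((K + 1) * (e.cost + zbound.cost + 20) + i.cost + j.cost + bound.cost + 17)
        + bound.cost + 9)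
      fun s' => Frame [x, z] [5, a] s s' ∧
        (∀ l < N, s'.real a (I l) (J l) = ∑ p ∈ Finset.range K, f l p) ∧
        ∀ i' j', (∀ l < N, i' = I l → j' ≠ J l) → s'.real a i' j' = s.real a i' j' := by
  refine (Runs.forLoop N [x, z] [5, a]
    (fun l s' => (∀ l' < l, s'.real a (I l') (J l') = ∑ p ∈ Finset.range K, f l' p) ∧
      ∀ i' j', (∀ l < N, i' = I l → j' ≠ J l) → s'.real a i' j' = s.real a i' j')
    (fun _ => (K + 1) * (e.cost + zbound.cost + 20) + (i.cost + j.cost + 4)) (by simp) hbound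
    (fun _ _ _ h => h) ⟨fun l hl => absurd hl (by omega), fun _ _ _ => rfl⟩ ?_).mono ?_ ?_
  · intro l hl s' hs' hx hJ
    refine Runs.seq (Runs.sumLoop K (f l)
      (fun s'' hs'' => hz s'' (hs'.trans (hs''.mono (by simp) (by simp))))
      (fun p hp s'' hs'' hzp => he l hl p hp s'' (hs'.trans (hs''.mono (by simp) (by simp)))
        (by rw [hs''.nat x (by simpa using hxz), hx]) hzp)) (B₂ := i.cost + j.cost + 4)
      (fun s₁ hs₁ => ?_) le_rfl
    have hf1 : Frame [x, z] [5, a] s' s₁ := hs₁.1.mono (by simp) (by simp)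
    have hx1 : s₁.nat x 0 0 = l := by rw [hs₁.1.nat x (by simpa using hxz), hx]
    have ea : s₁.real a = s'.real a := hs₁.1.real a (by simpa using ha)
    refine Runs.rset ?_ (by simp only [cost_rvar]; omega)
    rw [hi l hl s₁ (hs'.trans hf1) hx1, hj l hl s₁ (hs'.trans hf1) hx1, eval_rvar, hs₁.2]
    refine ⟨hf1.trans (Frame.rset (by simp) _ _ _ _ _ _), hx1, fun l' hl' => ?_, fun i' j' h => ?_⟩
    · rcases Nat.lt_succ_iff_lt_or_eq.1 hl' with h | rfl
      · have : ¬ (I l' = I l ∧ J l' = J l) := fun h' =>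
          h.ne (hinj l' (h.trans hl) l hl h'.1 h'.2)
        simp only [setCell, true_and, this, if_false]
        rw [ea, hJ.1 l' h]
      · simp [setCell]
    · have : ¬ (i' = I l ∧ j' = J l) := fun h' => h l hl h'.1 h'.2
      simp only [setCell, true_and, this, if_false]
      rw [ea, hJ.2 i' j' h]
  · simp only [Finset.sum_const, Finset.card_range, smul_eq_mul]
    ring_nf
    omega
  · rintro s' ⟨h1, h2, h3⟩
    exact ⟨h1, h2, h3⟩

/-- `a[i, x] := e` for all `x < bound`. -/
def rowUpdate (x : ℕ) (bound : NExp) (a : ℕ) (i : NExp) (e : RExp) : Prog :=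
  forLoop x bound (.rset a i (nvar x) e)

/-- The expression may read the row that is being overwritten: when entry `l` is computed, the
entries from `l` on still have their old values. -/
lemma Runs.rowUpdate {ω : ℕ → ℝ} {s : State} {x a : ℕ} {bound i : NExp} {e : RExp}
    (N I : ℕ) (f : ℕ → ℝ)
    (hbound : ∀ s', Frame [x] [a] s s' → bound.eval s' = N)
    (hi : ∀ s', Frame [x] [a] s s' → i.eval s' = I)
    (he : ∀ l < N, ∀ s', Frame [x] [a] s s' → s'.nat x 0 0 = l →
      (∀ i' j', (i' = I → l ≤ j') → s'.real a i' j' = s.real a i' j') → e.eval s' = f l) :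
    Runs ω (rowUpdate x bound a i e) s
      (N * (i.cost + e.cost + bound.cost + 17) + bound.cost + 9)
      fun s' => Frame [x] [a] s s' ∧ (∀ l < N, s'.real a I l = f l) ∧
        ∀ i' j', (i' = I → N ≤ j') → s'.real a i' j' = s.real a i' j' := by
  refine (Runs.forLoop N [x] [a]
    (fun l s' => (∀ l' < l, s'.real a I l' = f l') ∧
      ∀ i' j', (i' = I → l ≤ j') → s'.real a i' j' = s.real a i' j')
    (fun _ => i.cost + e.cost + 4) (by simp) hbound
    (fun _ _ _ h => h) ⟨fun l hl => absurd hl (by omega), fun _ _ _ => rfl⟩ ?_).mono ?_ ?_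
  · intro l hl s' hs' hx hJ
    refine Runs.rset ?_ (by simp only [cost_nvar]; omega)
    rw [hi s' hs', he l hl s' hs' hx hJ.2, eval_nvar, hx]
    refine ⟨Frame.rset (by simp) _ _ _ _ _ _, rfl, fun l' hl' => ?_, fun i' j' h => ?_⟩
    · rcases Nat.lt_succ_iff_lt_or_eq.1 hl' with h | rfl
      · simp only [setCell_cell_ne _ _ _ _ h.ne, hJ.1 l' h]
      · simp [setCell]
    · have : ¬ (i' = I ∧ j' = l) := fun h' => by have := h h'.1; omega
      simp only [setCell, true_and, this, if_false]
      exact hJ.2 i' j' fun h' => (Nat.le_succ l).trans (h h')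
  · simp only [Finset.sum_const, Finset.card_range, smul_eq_mul]
    ring_nf
    omega
  · rintro s' ⟨h1, h2, h3⟩
    exact ⟨h1, h2, h3⟩

/-! ### The stages of the step -/

/-- The `i`-th of the numbers `d`, `n`, `k`, `r`, `m`. -/
def size (i : ℕ) : NExp := .get 0 (.lit 0) (.lit i)

lemma eval_size (s : State) (i : ℕ) : (size i).eval s = s.nat 0 0 i := rfl

lemma cost_size (i : ℕ) : (size i).cost = 3 := rfl

/-- Draw a Gaussian vector into row `r` of real array `4`. -/
def drawGauss : Prog := forLoop 11 (size 2) (.gauss 4 (size 3) (nvar 11))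

/-- Row `r` makes the Gaussian vector the last one in the orthogonalization, after the `r` column
sums. -/
lemma Runs.drawGauss {ω : ℕ → ℝ} {s : State} {k r : ℕ} (hk : s.nat 0 0 2 = k)
    (hr : s.nat 0 0 3 = r) (hpos : s.pos = 0) :
    Runs ω drawGauss s (k * 23 + 12) fun s' => Frame [11] [4] s s' ∧
      ∀ l < k, s'.real 4 r l = ω l := by
  refine (Runs.forLoop k [11] [4] (fun l s' => s'.pos = l ∧ ∀ l' < l, s'.real 4 r l' = ω l')
    (fun _ => 7) (by simp) (fun s' hs' => ?_) (fun _ _ _ h => h)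
    ⟨hpos, fun l hl => absurd hl (by omega)⟩ ?_).mono ?_ fun s' h => ⟨h.1, h.2.2⟩
  · rw [eval_size, hs'.nat 0 (by decide), hk]
  · intro l hl s' hs' hx hJ
    refine Runs.gauss ?_ le_rfl
    rw [eval_size, hs'.nat 0 (by decide), hr, eval_nvar, hx, hJ.1]
    refine ⟨Frame.rset (by simp) _ _ _ _ _ _, rfl, rfl, fun l' hl' => ?_⟩
    rcases Nat.lt_succ_iff_lt_or_eq.1 hl' with h | rfl
    · simp only [setCell_cell_ne _ _ _ _ h.ne, hJ.2 l' h]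
    · simp [setCell]
  · simp [cost_size]

/-- Compute the coordinates of the columns in the given basis of `V` into real array `3`. -/
def coordCols : Prog :=
  forLoop 10 (size 1) (sumTable 11 (size 2) 12 (.get 1 (nvar 10) (.lit 0)) 3 (nvar 10) (nvar 11)
    (.mul (.get 0 (nvar 10) (nvar 12)) (.get 1 (.get 2 (nvar 10) (nvar 12)) (nvar 11))))

/-- The cost stays a sum over the columns so that the counts can add up to the number of nonzero
entries of `A`. -/
lemma Runs.coordCols {ω : ℕ → ℝ} {s : State} {n k : ℕ} (hn : s.nat 0 0 1 = n)
    (hk : s.nat 0 0 2 = k) :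
    Runs ω coordCols s (∑ j ∈ Finset.range n, (k * ((s.nat 1 j 0 + 1) * 44 + 26) + 28) + 12)
      fun s' => Frame [10, 11, 12] [3, 5] s s' ∧
        ∀ j < n, ∀ l < k, s'.real 3 j l = ∑ p ∈ Finset.range (s.nat 1 j 0),
          s.real 0 j p * s.real 1 (s.nat 2 j p) l := by
  refine (Runs.forEach n [10, 11, 12] [3, 5]
    (fun j s' => ∀ l < k, s'.real 3 j l = ∑ p ∈ Finset.range (s.nat 1 j 0),
          s.real 0 j p * s.real 1 (s.nat 2 j p) l)
    (fun j => k * ((s.nat 1 j 0 + 1) * 44 + 26) + 12) (by simp) (fun s' hs' => ?_)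
    (fun _ _ _ h => h) ?_).mono ?_ fun s' h => h
  · rw [eval_size, hs'.nat 0 (by decide), hn]
  · intro j hj s' hs' hx
    refine (Runs.sumTable k (s.nat 1 j 0) (fun _ => j) id (fun l p => s.real 0 j p *
      s.real 1 (s.nat 2 j p) l) (by decide) (fun l _ l' _ _ h => h) ?_ ?_ ?_ ?_ ?_
      (by decide)).mono ?_ ?_
    · intro s'' h
      rw [eval_size, h.nat 0 (by decide), hs'.nat 0 (by decide), hk]
    · intro s'' h
      rw [NExp.eval, h.nat 1 (by decide), hs'.nat 1 (by decide), eval_nvar, h.nat 10 (by decide), hx]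
      rfl
    · intro l hl s'' h _
      rw [eval_nvar, h.nat 10 (by decide), hx]
    · intro l hl s'' h hl'
      exact hl'
    · intro l hl p hp s'' h hl' hp'
      simp only [RExp.eval, NExp.eval, eval_nvar, hl', hp']
      rw [h.nat 10 (by decide), hx, h.real 0 (by decide), h.real 1 (by decide), h.nat 2 (by decide),
        hs'.real 0 (by decide), hs'.real 1 (by decide), hs'.nat 2 (by decide)]
    · simp [cost_size, cost_nvar, RExp.cost, NExp.cost]
    · rintro s'' ⟨h1, h2, h3⟩
      refine ⟨h1.mono (by decide) (by decide), by rw [h1.nat 10 (by decide), hx], h2, ?_⟩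
      intro j' hj' h l hl
      rw [h3 j' l fun l' _ h' => absurd h' hj'.ne, h l hl]
  · simp [cost_size]

/-- Add up the coordinates of the columns in each of the sets `R_t`, into rows of real array `4`. -/
def coordSums : Prog :=
  forLoop 10 (size 3) (sumTable 11 (size 2) 12 (size 4) 4 (nvar 10) (nvar 11)
    (.get 3 (.get 3 (nvar 10) (nvar 12)) (nvar 11)))

/-- Sums serve as well as averages, since only their span matters. Row `r`, which holds the Gaussian
vector, must survive. -/
lemma Runs.coordSums {ω : ℕ → ℝ} {s : State} {r k m : ℕ} (hr : s.nat 0 0 3 = r)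
    (hk : s.nat 0 0 2 = k) (hm : s.nat 0 0 4 = m) :
    Runs ω coordSums s (r * (k * ((m + 1) * 34 + 26) + 28) + 12)
      fun s' => Frame [10, 11, 12] [4, 5] s s' ∧
        (∀ t < r, ∀ l < k, s'.real 4 t l = ∑ p ∈ Finset.range m, s.real 3 (s.nat 3 t p) l) ∧
        s'.real 4 r = s.real 4 r := by
  refine (Runs.forLoop r [10, 11, 12] [4, 5]
    (fun t s' => (∀ t' < t, ∀ l < k, s'.real 4 t' l =
      ∑ p ∈ Finset.range m, s.real 3 (s.nat 3 t' p) l) ∧ s'.real 4 r = s.real 4 r)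
    (fun j => k * ((m + 1) * 34 + 26) + 12) (by simp) (fun s' hs' => ?_)
    (fun _ _ _ h => h) ⟨fun l hl => absurd hl (by omega), rfl⟩ ?_).mono ?_ fun s' h => h
  · rw [eval_size, hs'.nat 0 (by decide), hr]
  · intro t ht s' hs' hx hJ
    refine (Runs.sumTable k m (fun _ => t) id (fun l p => s.real 3 (s.nat 3 t p) l) (by decide)
      (fun l _ l' _ _ h => h) ?_ ?_ ?_ ?_ ?_ (by decide)).mono ?_ ?_
    · intro s'' h
      rw [eval_size, h.nat 0 (by decide), hs'.nat 0 (by decide), hk]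
    · intro s'' h
      rw [eval_size, h.nat 0 (by decide), hs'.nat 0 (by decide), hm]
    · intro l hl s'' h _
      rw [eval_nvar, h.nat 10 (by decide), hx]
    · intro l hl s'' h hl'
      exact hl'
    · intro l hl p hp s'' h hl' hp'
      simp only [RExp.eval, NExp.eval, eval_nvar, hl', hp']
      rw [h.nat 10 (by decide), hx, h.real 3 (by decide), h.nat 3 (by decide),
        hs'.real 3 (by decide), hs'.nat 3 (by decide)]
    · simp [cost_size, cost_nvar, RExp.cost, NExp.cost]
    · rintro s'' ⟨h1, h2, h3⟩
      refine ⟨h1.mono (by decide) (by decide), by rw [h1.nat 10 (by decide), hx], ?_, ?_⟩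
      · intro t' ht' l hl
        rcases Nat.lt_succ_iff_lt_or_eq.1 ht' with h | rfl
        · rw [h3 t' l fun l' _ h' => absurd h' h.ne, hJ.1 t' h l hl]
        · exact h2 l hl
      · rw [← hJ.2]
        funext l
        exact h3 r l fun l' _ h' => absurd h' ht.ne'
  · simp [cost_size]

/-- The vector of the first `k` entries of a sequence. -/
def headVec (k : ℕ) (f : ℕ → ℝ) : Eu k := WithLp.toLp 2 fun l => f l

lemma inner_headVec (k : ℕ) (f g : ℕ → ℝ) :
    inner ℝ (headVec k f) (headVec k g) = ∑ l ∈ Finset.range k, f l * g l := by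
  rw [Finset.sum_range, PiLp.inner_apply]
  simp [headVec, mul_comm]

lemma headVec_congr {k : ℕ} {f g : ℕ → ℝ} (h : ∀ l < k, f l = g l) : headVec k f = headVec k g := by
  simp only [headVec]
  congr 1
  funext l
  exact h l l.2

/-- Subtract from row `10` of real array `4` its projection onto row `11`. -/
def projectOut : Prog :=
  .seq (sumLoop 5 12 (size 2) (.mul (.get 4 (nvar 11) (nvar 12)) (.get 4 (nvar 10) (nvar 12))))
    (.seq (sumLoop 6 12 (size 2) (.mul (.get 4 (nvar 11) (nvar 12)) (.get 4 (nvar 11) (nvar 12))))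
      (rowUpdate 12 (size 2) 4 (nvar 10) (.sub (.get 4 (nvar 10) (nvar 12))
        (.mul (.div (rvar 5) (rvar 6)) (.get 4 (nvar 11) (nvar 12))))))

/-- If row `i` vanishes, the division by zero yields `0`, in agreement with the projection to the
zero space. The condition `i < t` keeps row `i` intact while row `t` is changed. -/
lemma Runs.projectOut {ω : ℕ → ℝ} {s : State} {k i t : ℕ} (hk : s.nat 0 0 2 = k)
    (ht : s.nat 10 0 0 = t) (hi : s.nat 11 0 0 = i) (hit : i < t) :
    Runs ω projectOut s (k * 130 + 90) fun s' => Frame [12] [4, 5, 6] s s' ∧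
      headVec k (s'.real 4 t) = headVec k (s.real 4 t) -
        (Submodule.span ℝ {headVec k (s.real 4 i)}).starProjection (headVec k (s.real 4 t)) ∧
      ∀ t', t' ≠ t → s'.real 4 t' = s.real 4 t' := by
  refine Runs.seq (Runs.sumLoop k (fun l => s.real 4 i l * s.real 4 t l) (fun s' hs' => ?_)
    (fun l hl s' hs' hx => ?_)) (B₂ := k * 92 + 52) ?_ ?_
  · rw [eval_size, hs'.nat 0 (by decide), hk]
  · simp only [RExp.eval, eval_nvar, hx]
    rw [hs'.nat 10 (by decide), hs'.nat 11 (by decide), hs'.real 4 (by decide), ht, hi]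
  · rintro s₁ ⟨f1, e5⟩
    refine Runs.seq (Runs.sumLoop k (fun l => s.real 4 i l * s.real 4 i l) (fun s' hs' => ?_)
      (fun l hl s' hs' hx => ?_)) (B₂ := k * 46 + 12) ?_ ?_
    · rw [eval_size, hs'.nat 0 (by decide), f1.nat 0 (by decide), hk]
    · simp only [RExp.eval, eval_nvar, hx]
      rw [hs'.nat 11 (by decide), hs'.real 4 (by decide), f1.nat 11 (by decide),
        f1.real 4 (by decide), hi]
    · rintro s₂ ⟨f2, e6⟩
      have e4 : s₂.real 4 = s.real 4 := by rw [f2.real 4 (by decide), f1.real 4 (by decide)]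
      have e5' : s₂.real 5 0 0 = ∑ l ∈ Finset.range k, s.real 4 i l * s.real 4 t l := by
        rw [f2.real 5 (by decide), e5]
      have e10 : s₂.nat 10 0 0 = t := by rw [f2.nat 10 (by decide), f1.nat 10 (by decide), ht]
      have e11 : s₂.nat 11 0 0 = i := by rw [f2.nat 11 (by decide), f1.nat 11 (by decide), hi]
      rw [← inner_headVec] at e5' e6
      rw [real_inner_self_eq_norm_sq] at e6
      refine (Runs.rowUpdate k t (fun l => s.real 4 t l -
        inner ℝ (headVec k (s.real 4 i)) (headVec k (s.real 4 t)) / ‖headVec k (s.real 4 i)‖ ^ 2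
          * s.real 4 i l) ?_ ?_ ?_).mono ?_ ?_
      · intro s' h
        rw [eval_size, h.nat 0 (by decide), f2.nat 0 (by decide), f1.nat 0 (by decide), hk]
      · intro s' h
        rw [eval_nvar, h.nat 10 (by decide), e10]
      · intro l hl s' h hx hu
        simp only [RExp.eval, eval_nvar, eval_rvar, hx]
        rw [h.nat 10 (by decide), h.nat 11 (by decide), h.real 5 (by decide), h.real 6 (by decide),
          e10, e11, e5', e6, hu t l fun _ => le_rfl, hu i l fun h' => absurd h' hit.ne, e4]
      · simp [cost_size, cost_nvar, cost_rvar, RExp.cost]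
      · rintro s' ⟨h1, h2, h3⟩
        refine ⟨(f1.mono (by decide) (by decide)).trans ((f2.mono (by decide) (by decide)).trans
          (h1.mono (by decide) (by decide))), ?_, fun t' ht' => ?_⟩
        · rw [headVec_congr h2, Submodule.starProjection_singleton]
          ext l
          simp [headVec]
        · rw [← e4]
          funext l
          exact h3 t' l fun h' => absurd h' ht'
    · simp [cost_size, cost_nvar, RExp.cost]; omega
  · simp [cost_size, cost_nvar, RExp.cost]; omega

/-- Orthogonalize the first `r + 1` rows of real array `4`. -/
def orthogonalize : Prog :=
  forLoop 10 (.add (size 3) (.lit 1)) (forLoop 11 (nvar 10) projectOut)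

/-- The program is the modified Gram–Schmidt process: each projection is applied to the already
reduced row. -/
lemma Runs.orthogonalize {ω : ℕ → ℝ} {s : State} {k r : ℕ} (hk : s.nat 0 0 2 = k)
    (hr : s.nat 0 0 3 = r) :
    Runs ω orthogonalize s ((r + 1) * (r * (k * 130 + 106) + 30) + 14) fun s' =>
      Frame [10, 11, 12] [4, 5, 6] s s' ∧
      headVec k (s'.real 4 r) =
        InnerProductSpace.gramSchmidt ℝ (fun t => headVec k (s.real 4 t)) r := by
  set F : ℕ → Eu k := fun t => headVec k (s.real 4 t) with hF
  set G := InnerProductSpace.gramSchmidt ℝ F with hG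
  refine (Runs.forLoop (r + 1) [10, 11, 12] [4, 5, 6]
    (fun t s' => (∀ t' < t, headVec k (s'.real 4 t') = G t') ∧
      ∀ t', t ≤ t' → s'.real 4 t' = s.real 4 t')
    (fun t => r * (k * 130 + 106) + 12) (by simp) (fun s' hs' => ?_)
    (fun _ _ _ h => h) ⟨fun l hl => absurd hl (by omega), fun _ _ => rfl⟩ ?_).mono ?_
    fun s' h => ⟨h.1, h.2.1 r (by omega)⟩
  · simp only [NExp.eval, eval_size]
    rw [hs'.nat 0 (by decide), hr]
  · intro t ht s' hs' hx hJ
    refine (Runs.forLoop t [11, 12] [4, 5, 6]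
      (fun i s'' => headVec k (s''.real 4 t) =
        F t - ∑ i' ∈ Finset.range i, (Submodule.span ℝ {G i'}).starProjection (F t) ∧
        ∀ t', t' ≠ t → s''.real 4 t' = s'.real 4 t')
      (fun _ => k * 130 + 90) (by simp) (fun s'' hs'' => ?_) (fun _ _ _ h => h) ⟨?_, fun _ _ => rfl⟩
      ?_).mono ?_ ?_
    · rw [eval_nvar, hs''.nat 10 (by decide), hx]
    · simp [hF, hJ.2 t le_rfl]
    · intro i hi s'' hs'' hxi hJ'
      have e10 : s''.nat 10 0 0 = t := by rw [hs''.nat 10 (by decide), hx]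
      refine (Runs.projectOut (by rw [hs''.nat 0 (by decide), hs'.nat 0 (by decide), hk]) e10 hxi
        hi).mono le_rfl ?_
      rintro s₃ ⟨h1, h2, h3⟩
      refine ⟨h1.mono (by decide) (by decide), by rw [h1.nat 11 (by decide), hxi], ?_, ?_⟩
      · have hz : ∑ i' ∈ Finset.range i, (Submodule.span ℝ {G i}).starProjection
            ((Submodule.span ℝ {G i'}).starProjection (F t)) = 0 := by
          refine Finset.sum_eq_zero fun i' hi' => ?_
          rw [Submodule.starProjection_singleton, Submodule.starProjection_singleton,
            inner_smul_right, InnerProductSpace.gramSchmidt_orthogonal ℝ F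
              (show i ≠ i' by have := Finset.mem_range.1 hi'; omega)]
          simp
        rw [h2, hJ'.1, hJ'.2 i hi.ne, hJ.1 i hi, Finset.sum_range_succ, map_sub, map_sum, hz]
        abel
      · intro t' ht'
        rw [h3 t' ht', hJ'.2 t' ht']
    · simp only [Finset.sum_const, Finset.card_range, smul_eq_mul, cost_nvar]
      have : t * (k * 130 + 106) ≤ r * (k * 130 + 106) := Nat.mul_le_mul_right _ (by omega)
      rw [show k * 130 + 90 + 3 + 13 = k * 130 + 106 by ring]
      omega
    · rintro s₃ ⟨h1, h2, h3⟩
      refine ⟨h1.mono (by decide) (by decide), by rw [h1.nat 10 (by decide), hx], ?_, ?_⟩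
      · intro t' ht'
        rcases Nat.lt_succ_iff_lt_or_eq.1 ht' with h | rfl
        · rw [h3 t' h.ne, hJ.1 t' h]
        · rw [h2, hG, InnerProductSpace.gramSchmidt_def, ← Nat.Iio_eq_range]
      · intro t' ht'
        rw [h3 t' (by omega), hJ.2 t' (by omega)]
  · rw [Finset.sum_const, Finset.card_range, smul_eq_mul, NExp.cost, cost_size, NExp.cost]

/-- Normalize row `r` of real array `4` into real array `7`. -/
def normalize : Prog :=
  .seq (sumLoop 5 12 (size 2) (.mul (.get 4 (size 3) (nvar 12)) (.get 4 (size 3) (nvar 12))))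
    (rowUpdate 12 (size 2) 7 (.lit 0) (.div (.get 4 (size 3) (nvar 12)) (.sqrt (rvar 5))))

lemma Runs.normalize {ω : ℕ → ℝ} {s : State} {k r : ℕ} (hk : s.nat 0 0 2 = k)
    (hr : s.nat 0 0 3 = r) :
    Runs ω normalize s (k * 80 + 60) fun s' => Frame [12] [5, 7] s s' ∧
      headVec k (s'.real 7 0) = ‖headVec k (s.real 4 r)‖⁻¹ • headVec k (s.real 4 r) := by
  refine Runs.seq (Runs.sumLoop k (fun l => s.real 4 r l * s.real 4 r l) (fun s' hs' => ?_)
    (fun l hl s' hs' hx => ?_)) (B₂ := k * 33 + 12) ?_ ?_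
  · rw [eval_size, hs'.nat 0 (by decide), hk]
  · simp only [RExp.eval, eval_nvar, hx, eval_size]
    rw [hs'.nat 0 (by decide), hs'.real 4 (by decide), hr]
  · rintro s₁ ⟨f1, e5⟩
    rw [← inner_headVec, real_inner_self_eq_norm_sq] at e5
    refine (Runs.rowUpdate k 0 (fun l => s.real 4 r l / ‖headVec k (s.real 4 r)‖) ?_ ?_ ?_).mono ?_ ?_
    · intro s' h
      rw [eval_size, h.nat 0 (by decide), f1.nat 0 (by decide), hk]
    · intro s' h
      rfl
    · intro l hl s' h hx _
      simp only [RExp.eval, eval_nvar, eval_rvar, eval_size, hx]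
      rw [h.nat 0 (by decide), f1.nat 0 (by decide), h.real 4 (by decide), f1.real 4 (by decide),
        h.real 5 (by decide), e5, hr, Real.sqrt_sq (norm_nonneg _)]
    · simp [cost_size, cost_nvar, cost_rvar, RExp.cost, NExp.cost]
    · rintro s' ⟨h1, h2, h3⟩
      refine ⟨(f1.mono (by decide) (by decide)).trans (h1.mono (by decide) (by decide)), ?_⟩
      rw [headVec_congr h2]
      ext l
      simp [headVec, div_eq_inv_mul]
  · simp [cost_size, cost_nvar, RExp.cost]; omega

/-- Compute the vector `u` from its coordinates. -/
def assemble : Prog :=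
  sumTable 10 (size 0) 12 (size 2) 2 (nvar 10) (.lit 0)
    (.mul (.get 7 (.lit 0) (nvar 12)) (.get 1 (nvar 10) (nvar 12)))

lemma Runs.assemble {ω : ℕ → ℝ} {s : State} {d k : ℕ} (hd : s.nat 0 0 0 = d)
    (hk : s.nat 0 0 2 = k) :
    Runs ω assemble s (d * ((k + 1) * 36 + 24) + 12) fun s' => Frame [10, 12] [2, 5] s s' ∧
      ∀ i < d, s'.real 2 i 0 = ∑ l ∈ Finset.range k, s.real 7 0 l * s.real 1 i l := by
  refine (Runs.sumTable d k id (fun _ => 0) (fun i l => s.real 7 0 l * s.real 1 i l) (by decide)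
    (fun l _ l' _ h _ => h) ?_ ?_ ?_ ?_ ?_ (by decide)).mono ?_ ?_
  · intro s' h
    rw [eval_size, h.nat 0 (by decide), hd]
  · intro s' h
    rw [eval_size, h.nat 0 (by decide), hk]
  · intro l _ s' h hl
    exact hl
  · intro l _ s' h _
    rfl
  · intro l _ p _ s' h hl hp
    simp only [RExp.eval, eval_nvar, hl, hp, NExp.eval]
    rw [h.real 7 (by decide), h.real 1 (by decide)]
  · simp [cost_size, cost_nvar, RExp.cost, NExp.cost]
  · rintro s' ⟨h1, h2, _⟩
    exact ⟨h1.mono (by decide) (by decide), h2⟩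

/-- Compute the inner products of `u` with the columns from their coordinates. -/
def columnKeys : Prog :=
  sumTable 10 (size 1) 12 (size 2) 8 (.lit 0) (nvar 10)
    (.mul (.get 7 (.lit 0) (nvar 12)) (.get 3 (nvar 10) (nvar 12)))

lemma Runs.columnKeys {ω : ℕ → ℝ} {s : State} {n k : ℕ} (hn : s.nat 0 0 1 = n)
    (hk : s.nat 0 0 2 = k) :
    Runs ω columnKeys s (n * ((k + 1) * 36 + 24) + 12) fun s' => Frame [10, 12] [5, 8] s s' ∧
      ∀ j < n, s'.real 8 0 j = ∑ l ∈ Finset.range k, s.real 7 0 l * s.real 3 j l := by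
  refine (Runs.sumTable n k (fun _ => 0) id (fun i l => s.real 7 0 l * s.real 3 i l) (by decide)
    (fun l _ l' _ _ h => h) ?_ ?_ ?_ ?_ ?_ (by decide)).mono ?_ ?_
  · intro s' h
    rw [eval_size, h.nat 0 (by decide), hn]
  · intro s' h
    rw [eval_size, h.nat 0 (by decide), hk]
  · intro l _ s' h _
    rfl
  · intro l _ s' h hl
    exact hl
  · intro l _ p _ s' h hl hp
    simp only [RExp.eval, eval_nvar, hl, hp, NExp.eval]
    rw [h.real 7 (by decide), h.real 3 (by decide)]
  · simp [cost_size, cost_nvar, RExp.cost, NExp.cost]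
  · rintro s' ⟨h1, h2, _⟩
    exact ⟨h1.mono (by decide) (by decide), h2⟩

/-- The `12`-th column in the sorted order, from below. -/
def lowIdx : NExp := .get 20 (nvar 28) (nvar 12)

/-- The `12`-th column in the sorted order, from above. -/
def highIdx : NExp := .get 20 (nvar 28) (.sub (size 1) (.add (.lit 1) (nvar 12)))

/-- Output either the first or the last `m` columns in the sorted order. -/
def selectSet : Prog :=
  .seq (sumLoop 5 12 (size 4) (.get 8 (.lit 0) lowIdx))
    (.seq (sumLoop 6 12 (size 4) (.get 8 (.lit 0) highIdx))
      (.ite (.rle (.lit 0) (.add (rvar 5) (rvar 6)))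
        (forLoop 12 (size 4) (.nset 4 (.lit 0) (nvar 12) highIdx))
        (forLoop 12 (size 4) (.nset 4 (.lit 0) (nvar 12) lowIdx))))

lemma Runs.fillRow {ω : ℕ → ℝ} {s : State} {m : ℕ} {e : NExp} (f : ℕ → ℕ) (hm : s.nat 0 0 4 = m)
    (he : ∀ p < m, ∀ s', Frame [4, 12] [] s s' → s'.nat 12 0 0 = p → e.eval s' = f p) :
    Runs ω (LatentSimplex.forLoop 12 (size 4) (.nset 4 (.lit 0) (nvar 12) e)) s (m * (e.cost + 21) + 12)
      fun s' => Frame [4, 12] [] s s' ∧ ∀ p < m, s'.nat 4 0 p = f p := by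
  refine (Runs.forEach m [4, 12] [] (fun p s' => s'.nat 4 0 p = f p) (fun _ => e.cost + 5)
    (by decide) (fun s' hs' => ?_) ?_ ?_).mono ?_ fun s' h => h
  · rw [eval_size, hs'.nat 0 (by decide), hm]
  · intro i s' v h
    rwa [nat_mk_array_ne _ _ _ _ _ _ (by decide)]
  · intro p hp s' hs' hx
    refine Runs.nset ⟨Frame.nset (by decide) _ _ _ _ _, ?_, ?_, ?_⟩ (by
      simp only [NExp.cost, cost_nvar]; omega)
    · simp [setCell, hx]
    · simp [setCell, NExp.eval, eval_nvar, hx, he p hp s' hs' hx]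
    · intro p' hp' h
      simp [setCell, NExp.eval, eval_nvar, hx, hp'.ne, h]
  · simp only [Finset.sum_const, Finset.card_range, smul_eq_mul, cost_size]
    rw [show e.cost + 5 + 3 + 13 = e.cost + 21 by ring]

/-- The sum of the lowest keys is at most that of the highest, so the sign of their total tells
which is larger in absolute value. Position `n - (1 + p)` is the `p`-th from the top, counting from
zero. -/
lemma Runs.selectSet {ω : ℕ → ℝ} {s : State} {n m : ℕ} (g : ℕ → ℕ) (w : ℕ → ℝ)
    (hn : s.nat 0 0 1 = n) (hm : s.nat 0 0 4 = m) (hg : s.nat 20 (s.nat 28 0 0) = g)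
    (hw : s.real 8 0 = w) :
    Runs ω selectSet s (m * 150 + 150) fun s' => Frame [4, 12] [5, 6] s s' ∧
      ((0 ≤ ∑ p ∈ Finset.range m, w (g p) + ∑ p ∈ Finset.range m, w (g (n - (1 + p))) ∧
          ∀ p < m, s'.nat 4 0 p = g (n - (1 + p))) ∨
        (∑ p ∈ Finset.range m, w (g p) + ∑ p ∈ Finset.range m, w (g (n - (1 + p))) < 0 ∧
          ∀ p < m, s'.nat 4 0 p = g p)) := by
  have hlow : ∀ s', Frame [4, 12] [5, 6] s s' → lowIdx.eval s' = g (s'.nat 12 0 0) := by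
    intro s' h
    simp only [lowIdx, NExp.eval, eval_nvar]
    rw [h.nat 20 (by decide), h.nat 28 (by decide), hg]
  have hhigh : ∀ s', Frame [4, 12] [5, 6] s s' → highIdx.eval s' = g (n - (1 + s'.nat 12 0 0)) := by
    intro s' h
    simp only [highIdx, NExp.eval, eval_nvar, eval_size]
    rw [h.nat 20 (by decide), h.nat 28 (by decide), hg, h.nat 0 (by decide), hn]
  refine Runs.seq (Runs.sumLoop m (fun p => w (g p)) (fun s' hs' => ?_)
    (fun l hl s' hs' hx => ?_)) (B₂ := m * 110 + 110) ?_ ?_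
  · rw [eval_size, hs'.nat 0 (by decide), hm]
  · simp only [RExp.eval, NExp.eval]
    rw [hlow s' (hs'.mono (by decide) (by decide)), hx, hs'.real 8 (by decide), hw]
  · rintro s₁ ⟨f1, e5⟩
    refine Runs.seq (Runs.sumLoop m (fun p => w (g (n - (1 + p)))) (fun s' hs' => ?_)
      (fun l hl s' hs' hx => ?_)) (B₂ := m * 60 + 60) ?_ ?_
    · rw [eval_size, hs'.nat 0 (by decide), f1.nat 0 (by decide), hm]
    · simp only [RExp.eval, NExp.eval]
      rw [hhigh s' ((f1.mono (by decide) (by decide)).trans (hs'.mono (by decide) (by decide))),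
        hx, hs'.real 8 (by decide), f1.real 8 (by decide), hw]
    · rintro s₂ ⟨f2, e6⟩
      have f12 : Frame [4, 12] [5, 6] s s₂ :=
        (f1.mono (by decide) (by decide)).trans (f2.mono (by decide) (by decide))
      have e5' : s₂.real 5 0 0 = ∑ p ∈ Finset.range m, w (g p) := by
        rw [f2.real 5 (by decide), e5]
      have hm2 : s₂.nat 0 0 4 = m := by rw [f12.nat 0 (by decide), hm]
      refine Runs.ite (B' := m * 60 + 40) (fun hb => ?_) (fun hb => ?_) ?_
      · refine (Runs.fillRow (fun p => g (n - (1 + p))) hm2 fun p _ s' h hp => ?_).mono ?_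
          fun s' h => ⟨f12.trans (h.1.mono (by decide) (by decide)), Or.inl ⟨?_, h.2⟩⟩
        · rw [hhigh s' (f12.trans (h.mono (by decide) (by decide))), hp]
        · simp [highIdx, cost_nvar, cost_size, NExp.cost]; omega
        · simpa [BExp.eval, RExp.eval, eval_rvar, e5', e6] using hb
      · refine (Runs.fillRow g hm2 fun p _ s' h hp => ?_).mono ?_
          fun s' h => ⟨f12.trans (h.1.mono (by decide) (by decide)), Or.inr ⟨?_, h.2⟩⟩
        · rw [hlow s' (f12.trans (h.mono (by decide) (by decide))), hp]
        · simp [lowIdx, cost_nvar, NExp.cost]; omega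
        · simpa [BExp.eval, RExp.eval, eval_rvar, e5', e6] using hb
      · simp [BExp.cost, RExp.cost, cost_rvar]; omega
    · simp [highIdx, cost_size, cost_nvar, RExp.cost, NExp.cost]; omega
  · simp [lowIdx, cost_size, cost_nvar, RExp.cost, NExp.cost]; omega

/-! ### Correctness of the step -/

/-- An exchange argument: the common part cancels, the two differences have equal size, and the
largest weight in `S \ T` is at most each weight in `T \ S`. -/
lemma sum_le_sum_of_card_eq {ι : Type*} [DecidableEq ι] {w : ι → ℝ} {S T : Finset ι}
    (h : S.card = T.card) (hw : ∀ a ∈ S, a ∉ T → ∀ b ∈ T, b ∉ S → w a ≤ w b) :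
    ∑ j ∈ S, w j ≤ ∑ j ∈ T, w j := by
  have hc : (S \ T).card = (T \ S).card := Finset.card_sdiff_comm h
  rw [← Finset.sum_inter_add_sum_sdiff S T, ← Finset.sum_inter_add_sum_sdiff T S,
    Finset.inter_comm T S]
  refine add_le_add le_rfl ?_
  rcases (S \ T).eq_empty_or_nonempty with he | hne
  · rw [he] at hc ⊢
    rw [Finset.card_empty, eq_comm, Finset.card_eq_zero] at hc
    rw [hc]
  · obtain ⟨a, ha, hmax⟩ := (S \ T).exists_max_image w hne
    rw [Finset.mem_sdiff] at ha
    calc ∑ j ∈ S \ T, w j ≤ (S \ T).card • w a := Finset.sum_le_card_nsmul _ _ _ hmax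
      _ = (T \ S).card • w a := by rw [hc]
      _ ≤ ∑ j ∈ T \ S, w j := Finset.card_nsmul_le_sum _ _ _ fun b hb =>
        hw a ha.1 ha.2 b (Finset.mem_sdiff.1 hb).1 (Finset.mem_sdiff.1 hb).2

lemma Lists.sum {n m : ℕ} {f : ℕ → ℕ} {S : Finset (Fin n)} {X : Type*} [AddCommMonoid X]
    (h : Lists f m S) (w : ℕ → X) : ∑ p ∈ Finset.range m, w (f p) = ∑ j ∈ S, w j := by
  refine Eq.trans ?_ (Finset.sum_map S Fin.valEmbedding w)
  refine Finset.sum_nbij f (fun p hp => ?_) ?_ ?_ fun _ _ => rfl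
  · obtain ⟨j, hj, hj'⟩ := h.mapsTo (show p ∈ Set.Iio m from Finset.mem_range.1 hp)
    exact Finset.mem_map.2 ⟨j, hj, hj'⟩
  · simpa using h.injOn
  · intro x hx
    obtain ⟨j, hj, rfl⟩ := Finset.mem_map.1 (Finset.mem_coe.1 hx)
    obtain ⟨p, hp, hp'⟩ := h.surjOn ⟨j, hj, rfl⟩
    exact ⟨p, by simpa using hp, hp'⟩

lemma Lists.card {n m : ℕ} {f : ℕ → ℕ} {S : Finset (Fin n)} (h : Lists f m S) : S.card = m := by
  have := h.sum fun _ => (1 : ℕ)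
  simpa using this.symm

lemma exists_lists {n m : ℕ} {f : ℕ → ℕ} (hf : Set.InjOn f (Set.Iio m))
    (hn : ∀ p < m, f p < n) : ∃ S : Finset (Fin n), Lists f m S := by
  refine ⟨Finset.univ.filter fun j => ∃ p < m, f p = j, fun p hp => ?_, hf, ?_⟩
  · exact ⟨⟨f p, hn p hp⟩, by simpa using ⟨p, hp, rfl⟩, rfl⟩
  · rintro _ ⟨j, hj, rfl⟩
    obtain ⟨p, hp, hp'⟩ := (Finset.mem_filter.1 (Finset.mem_coe.1 hj)).2
    exact ⟨p, hp, hp'⟩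

lemma Lists.mem_iff {n m : ℕ} {f : ℕ → ℕ} {S : Finset (Fin n)} (h : Lists f m S) (j : Fin n) :
    j ∈ S ↔ ∃ p < m, f p = j := by
  constructor
  · intro hj
    obtain ⟨p, hp, hp'⟩ := h.surjOn ⟨j, hj, rfl⟩
    exact ⟨p, hp, hp'⟩
  · rintro ⟨p, hp, hp'⟩
    obtain ⟨j', hj, hj'⟩ := h.mapsTo (show p ∈ Set.Iio m from hp)
    rwa [← Fin.ext (hj'.trans hp')]

section Sorted

variable {κ : ℕ → ℝ} {g : ℕ → ℕ} {n : ℕ}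

lemma seg_zero (g : ℕ → ℕ) (n : ℕ) : seg g 0 n = (List.range n).map g := by
  rw [seg, List.range_eq_range', Nat.sub_zero]

lemma injOn_of_perm_range (h : (seg g 0 n).Perm (List.range n)) : Set.InjOn g (Set.Iio n) := by
  have := h.nodup_iff.2 List.nodup_range
  rw [seg_zero] at this
  intro a ha b hb hab
  exact List.inj_on_of_nodup_map this (List.mem_range.2 ha) (List.mem_range.2 hb) hab

lemma lt_of_perm_range (h : (seg g 0 n).Perm (List.range n)) {p : ℕ} (hp : p < n) : g p < n := by
  rw [← List.mem_range, ← h.mem_iff, seg_zero]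
  exact List.mem_map_of_mem (List.mem_range.2 hp)

lemma exists_eq_of_perm_range (h : (seg g 0 n).Perm (List.range n)) {j : ℕ} (hj : j < n) :
    ∃ p < n, g p = j := by
  rw [← List.mem_range, ← h.mem_iff, seg_zero, List.mem_map] at hj
  simpa using hj

lemma SortedBy.le (h : SortedBy κ (seg g 0 n)) {p p' : ℕ} (hp : p ≤ p') (hp' : p' < n) :
    κ (g p) ≤ κ (g p') := by
  rcases hp.eq_or_lt with rfl | hlt
  · exact le_rfl
  · rw [SortedBy, seg_zero, List.pairwise_map] at h
    have := List.pairwise_iff_getElem.1 h p p' (by simpa using hlt.trans hp') (by simpa using hp') hlt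
    simpa using this

lemma sum_low_le (hs : SortedBy κ (seg g 0 n)) (h : (seg g 0 n).Perm (List.range n)) {m : ℕ}
    {S T : Finset (Fin n)} (hS : Lists g m S) (hT : T.card = m) :
    ∑ j ∈ S, κ j ≤ ∑ j ∈ T, κ j := by
  refine sum_le_sum_of_card_eq (hS.card.trans hT.symm) fun a ha _ b _ hb => ?_
  obtain ⟨p, hp, hpa⟩ := (hS.mem_iff a).1 ha
  obtain ⟨p', hp', hpb⟩ := exists_eq_of_perm_range h b.2
  rw [← hpa, ← hpb]
  refine hs.le (hp.le.trans ?_) hp'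
  by_contra hlt
  exact hb ((hS.mem_iff b).2 ⟨p', by omega, hpb⟩)

lemma le_sum_high (hs : SortedBy κ (seg g 0 n)) (h : (seg g 0 n).Perm (List.range n)) {m : ℕ}
    {S T : Finset (Fin n)} (hS : Lists (fun p => g (n - (1 + p))) m S) (hT : T.card = m) :
    ∑ j ∈ T, κ j ≤ ∑ j ∈ S, κ j := by
  refine sum_le_sum_of_card_eq (hT.trans hS.card.symm) fun b _ hb a ha _ => ?_
  obtain ⟨p, hp, hpa⟩ := (hS.mem_iff a).1 ha
  obtain ⟨p', hp', hpb⟩ := exists_eq_of_perm_range h b.2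
  rw [← hpa, ← hpb]
  refine hs.le ?_ (by omega)
  by_contra hlt
  refine hb ((hS.mem_iff b).2 ⟨n - (1 + p'), by omega, ?_⟩)
  rw [show n - (1 + (n - (1 + p'))) = p' by omega, hpb]

/-- Selecting the better of the extreme ends of the sorted order maximizes the absolute sum. -/
lemma exists_lists_select (hs : SortedBy κ (seg g 0 n)) (h : (seg g 0 n).Perm (List.range n))
    {m : ℕ} (hm : m ≤ n) {f : ℕ → ℕ}
    (hf : (0 ≤ ∑ p ∈ Finset.range m, κ (g p) + ∑ p ∈ Finset.range m, κ (g (n - (1 + p))) ∧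
          ∀ p < m, f p = g (n - (1 + p))) ∨
        (∑ p ∈ Finset.range m, κ (g p) + ∑ p ∈ Finset.range m, κ (g (n - (1 + p))) < 0 ∧
          ∀ p < m, f p = g p)) :
    ∃ S : Finset (Fin n), Lists f m S ∧
      ∀ T : Finset (Fin n), T.card = m → |∑ j ∈ T, κ j| ≤ |∑ j ∈ S, κ j| := by
  have hinj := injOn_of_perm_range h
  obtain ⟨S₁, hS₁⟩ := exists_lists (n := n) (hinj.mono (Set.Iio_subset_Iio hm))
    fun p hp => lt_of_perm_range h (hp.trans_le hm)
  obtain ⟨S₂, hS₂⟩ := exists_lists (n := n) (f := fun p => g (n - (1 + p))) (m := m)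
    (fun a (ha : a < m) b (hb : b < m) hab => by
      have := hinj (show n - (1 + a) < n by omega) (show n - (1 + b) < n by omega) hab
      omega)
    fun p hp => lt_of_perm_range h (by omega)
  rw [hS₁.sum κ, hS₂.sum κ] at hf
  rcases hf with ⟨h0, hf⟩ | ⟨h0, hf⟩
  · refine ⟨S₂, hS₂.congr fun p hp => (hf p hp).symm, fun T hT => ?_⟩
    have h1 := sum_low_le hs h hS₁ hT
    have h2 := le_sum_high hs h hS₂ hT
    -- The sum over any `T` lies between the lowest and the highest sum; with a nonnegative total
    -- the highest one dominates both in absolute value.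
    rw [abs_le, abs_of_nonneg (by linarith)]
    constructor <;> linarith
  · refine ⟨S₁, hS₁.congr fun p hp => (hf p hp).symm, fun T hT => ?_⟩
    have h1 := sum_low_le hs h hS₁ hT
    have h2 := le_sum_high hs h hS₂ hT
    rw [abs_le, abs_of_neg (by linarith)]
    constructor <;> linarith

end Sorted

lemma inner_avgCol {d n : ℕ} (A : Matrix (Fin d) (Fin n) ℝ) (u : Eu d) (T : Finset (Fin n)) :
    inner ℝ u (avgCol A T) = (T.card : ℝ)⁻¹ * ∑ j ∈ T, inner ℝ u (col A j) := by
  rw [avgCol, inner_smul_right, inner_sum]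

lemma isArgmax_of_sum {d n m : ℕ} {A : Matrix (Fin d) (Fin n) ℝ} {u : Eu d} {S : Finset (Fin n)}
    (hS : S.card = m) (h : ∀ T : Finset (Fin n), T.card = m →
      |∑ j ∈ T, inner ℝ u (col A j)| ≤ |∑ j ∈ S, inner ℝ u (col A j)|) : IsArgmax A m u S := by
  refine ⟨hS, fun T hT => ?_⟩
  rw [inner_avgCol, inner_avgCol, hS, hT, abs_mul, abs_mul]
  exact mul_le_mul_of_nonneg_left (h T hT) (abs_nonneg _)

/-- The Gram–Schmidt vector is orthogonal to the earlier vectors and differs from `F r` by an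
element of their span. Linear independence is not needed. -/
lemma gramSchmidt_eq_starProjection {E : Type*} [NormedAddCommGroup E] [InnerProductSpace ℝ E]
    [FiniteDimensional ℝ E] (F : ℕ → E) (r : ℕ) :
    InnerProductSpace.gramSchmidt ℝ F r =
      (Submodule.span ℝ (F '' Set.Iio r))ᗮ.starProjection (F r) := by
  rw [← InnerProductSpace.span_gramSchmidt_Iio]
  symm
  refine Submodule.eq_starProjection_of_mem_orthogonal ?_ (Submodule.le_orthogonal_orthogonal _ ?_)
  · rw [Set.image_eq_range, mem_orthogonal_span_range]
    exact fun t => InnerProductSpace.gramSchmidt_orthogonal ℝ F (ne_of_lt t.2)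
  · rw [InnerProductSpace.gramSchmidt_def, sub_sub_cancel]
    refine Submodule.sum_mem _ fun i hi => ?_
    rw [Submodule.starProjection_singleton]
    exact Submodule.smul_mem _ _ (Submodule.subset_span ⟨i, Finset.mem_Iio.1 hi, rfl⟩)

/-- The linear isometry that maps coordinates with respect to an orthonormal family to vectors. -/
noncomputable def synth {d k : ℕ} {q : Fin k → Eu d} (hq : Orthonormal ℝ q) : Eu k →ₗᵢ[ℝ] Eu d :=
  (Fintype.linearCombination ℝ q ∘ₗ (WithLp.linearEquiv 2 ℝ (Fin k → ℝ)).toLinearMap).isometryOfInner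
    fun x y => by
      simp [Fintype.linearCombination_apply, hq.inner_sum, PiLp.inner_apply, mul_comm]

section Synth

variable {d n k r m : ℕ} {A : Matrix (Fin d) (Fin n) ℝ} {R : Fin r → Finset (Fin n)}
  {q : Fin k → Eu d}

lemma synth_apply (hq : Orthonormal ℝ q) (x : Eu k) : synth hq x = ∑ l, x l • q l := by
  simp [synth, Fintype.linearCombination_apply]

lemma inner_synth (hq : Orthonormal ℝ q) (x : Eu k) (w : Eu d) :
    inner ℝ (synth hq x) w = ∑ l, x l * inner ℝ (q l) w := by
  simp [synth_apply, sum_inner, inner_smul_left]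

lemma mem_range_synth (hq : Orthonormal ℝ q) (w : Eu d) :
    w ∈ Submodule.span ℝ (Set.range q) ↔ ∃ x, synth hq x = w := by
  rw [← Fintype.range_linearCombination ℝ q, LinearMap.mem_range]
  constructor
  · rintro ⟨x, rfl⟩
    exact ⟨WithLp.toLp 2 x, by simp [synth_apply, Fintype.linearCombination_apply]⟩
  · rintro ⟨x, rfl⟩
    exact ⟨x.ofLp, by simp [synth_apply, Fintype.linearCombination_apply]⟩

/-- A vector of `V` is orthogonal to an average exactly if its coordinate vector is orthogonal to
the coordinate sums, because the two inner products differ by the factor `1/m`. -/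
lemma residual_eq_map_synth (hq : Orthonormal ℝ q) (hm : 0 < m) (hR : ∀ t, (R t).card = m)
    {F : ℕ → Eu k} (hF : ∀ (t : Fin r) (l : Fin k), F t l = ∑ j ∈ R t, inner ℝ (q l) (col A j)) :
    residual A (Submodule.span ℝ (Set.range q)) R =
      (Submodule.span ℝ (F '' Set.Iio r))ᗮ.map (synth hq : Eu k →ₗ[ℝ] Eu d) := by
  have key : ∀ (x : Eu k) (t : Fin r),
      inner ℝ (avgCol A (R t)) (synth hq x) = (m : ℝ)⁻¹ * inner ℝ (F t) x := by
    intro x t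
    rw [real_inner_comm, inner_synth, PiLp.inner_apply, Finset.mul_sum]
    refine Finset.sum_congr rfl fun l _ => ?_
    rw [inner_avgCol, hR, hF]
    simp
    ring
  have hm' : ((m : ℝ)⁻¹) ≠ 0 := by positivity
  ext w
  rw [residual, nullOf, Submodule.mem_inf, mem_orthogonal_span_range, mem_range_synth hq,
    Submodule.mem_map, Set.image_eq_range]
  simp only [mem_orthogonal_span_range]
  constructor
  · rintro ⟨⟨x, rfl⟩, h⟩
    refine ⟨x, fun t => ?_, rfl⟩
    have := h ⟨t, t.2⟩
    rw [key] at this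
    exact (mul_eq_zero.1 this).resolve_left hm'
  · rintro ⟨x, h, rfl⟩
    refine ⟨⟨x, rfl⟩, fun t => ?_⟩
    change inner ℝ _ (synth hq x) = _
    rw [key, h ⟨t, t.2⟩, mul_zero]

/-- A linear isometry carries the orthogonal projection to a subspace into the one to its image, so
projecting can be done in `k` coordinates. -/
lemma starProjection_residual (hq : Orthonormal ℝ q) (hm : 0 < m) (hR : ∀ t, (R t).card = m)
    {F : ℕ → Eu k} (hF : ∀ (t : Fin r) (l : Fin k), F t l = ∑ j ∈ R t, inner ℝ (q l) (col A j))
    (x : Eu k) : (residual A (Submodule.span ℝ (Set.range q)) R).starProjection (synth hq x) =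
      synth hq ((Submodule.span ℝ (F '' Set.Iio r))ᗮ.starProjection x) := by
  have key : ∀ U : Submodule ℝ (Eu d),
      U = (Submodule.span ℝ (F '' Set.Iio r))ᗮ.map (synth hq : Eu k →ₗ[ℝ] Eu d) →
        U.starProjection (synth hq x) =
          synth hq ((Submodule.span ℝ (F '' Set.Iio r))ᗮ.starProjection x) := by
    rintro _ rfl
    exact (LinearIsometry.map_starProjection' _ _ _).symm
  exact key _ (residual_eq_map_synth hq hm hR hF)

/-- The coordinate of a sparse column as computed from the list of its nonzero entries. -/
lemma IsInput.inner_col {s : State} (h : IsInput A m R q s) (j : Fin n) (l : Fin k) :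
    ∑ p ∈ Finset.range (s.nat 1 j 0), s.real 0 j p * s.real 1 (s.nat 2 j p) l =
      inner ℝ (q l) (col A j) := by
  set w : ℕ → ℝ := fun i => if hi : i < d then A ⟨i, hi⟩ j * q l ⟨i, hi⟩ else 0 with hw
  have h1 : ∀ p ∈ Finset.range (s.nat 1 j 0),
      s.real 0 j p * s.real 1 (s.nat 2 j p) l = w (s.nat 2 j p) := by
    intro p hp
    rw [Finset.mem_range] at hp
    obtain ⟨i, _, hi⟩ := (h.rows j).mapsTo (show p ∈ Set.Iio _ from hp)
    rw [h.vals j p i hp hi.symm, ← hi, h.basis, hw]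
    simp
  rw [Finset.sum_congr rfl h1, (h.rows j).sum w, PiLp.inner_apply, Finset.sum_filter]
  refine Finset.sum_congr rfl fun i _ => ?_
  by_cases hA : A i j = 0
  · simp [hA, col]
  · simp [hA, col, hw]

end Synth

/-- Draw a random unit vector `u` of the residual space and find a set of `m` columns that maximizes
the absolute inner product of `u` with their average. -/
def step : Prog :=
  .seq drawGauss (.seq coordCols (.seq coordSums (.seq orthogonalize (.seq normalize
    (.seq assemble (.seq columnKeys (.seq sortCols selectSet)))))))

/-- A bound for the number of steps. -/
def stepBound (d n k r m N : ℕ) : ℕ :=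
  (k * 23 + 12) + (k * 44 * N + n * (k * 70 + 28) + 12) + (r * (k * ((m + 1) * 34 + 26) + 28) + 12)
    + ((r + 1) * (r * (k * 130 + 106) + 30) + 14) + (k * 80 + 60) + (d * ((k + 1) * 36 + 24) + 12)
    + (n * ((k + 1) * 36 + 24) + 12) + (Nat.clog 2 n + 1) * (n * 300 + 60) + (m * 150 + 150)

section Step

variable {d n k r m : ℕ} {A : Matrix (Fin d) (Fin n) ℝ} {R : Fin r → Finset (Fin n)}
  {q : Fin k → Eu d}

lemma IsInput.sum_counts {s : State} (h : IsInput A m R q s) :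
    ∑ j ∈ Finset.range n, s.nat 1 j 0 = nnz A := by
  have h1 : nnz A = ∑ j : Fin n, (Finset.univ.filter fun i : Fin d => A i j ≠ 0).card := by
    rw [nnz, Nat.card_eq_fintype_card, Fintype.card_subtype, Finset.card_filter,
      Fintype.sum_prod_type, Finset.sum_comm]
    simp [Finset.card_filter]
  rw [h1, Finset.sum_range]
  exact Finset.sum_congr rfl fun j _ => (h.rows j).card.symm

/-- The normalized projection to the residual space of the Gaussian vector of `V` that the random
tape provides. -/
noncomputable def randomDir (A : Matrix (Fin d) (Fin n) ℝ) (R : Fin r → Finset (Fin n))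
    (q : Fin k → Eu d) (ω : ℕ → ℝ) : Eu d :=
  ‖(residual A (Submodule.span ℝ (Set.range q)) R).starProjection (∑ l : Fin k, ω l • q l)‖⁻¹ •
    (residual A (Submodule.span ℝ (Set.range q)) R).starProjection (∑ l : Fin k, ω l • q l)

/-- Each stage overwrites only its own working arrays, so the input and the results still needed
persist; the frames accumulated along the way record this. -/
lemma Runs.step {s : State} (hq : Orthonormal ℝ q) (h : IsInput A m R q s) (hm : 0 < m)
    (hmn : m ≤ n) (hR : ∀ t, (R t).card = m) (ω : ℕ → ℝ) :
    Runs ω step s (stepBound d n k r m (nnz A)) fun s' =>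
      ∃ S, IsArgmax A m (randomDir A R q ω) S ∧ IsOutput m (randomDir A R q ω) S s' := by
  refine Runs.seq (Runs.drawGauss h.size_k h.size_r h.fresh) (B₂ :=
    (k * 44 * nnz A + n * (k * 70 + 28) + 12) + (r * (k * ((m + 1) * 34 + 26) + 28) + 12)
    + ((r + 1) * (r * (k * 130 + 106) + 30) + 14) + (k * 80 + 60) + (d * ((k + 1) * 36 + 24) + 12)
    + (n * ((k + 1) * 36 + 24) + 12) + (Nat.clog 2 n + 1) * (n * 300 + 60) + (m * 150 + 150))
    ?_ (by rw [stepBound]; omega)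
  rintro s₁ ⟨f1, hg⟩
  replace f1 : Frame [4, 10, 11, 12, 20, 21, 22, 23, 24, 25, 26, 27, 28] [2, 3, 4, 5, 6, 7, 8] s s₁ :=
    f1.mono (by decide) (by decide)
  have hcnt : ∑ j ∈ Finset.range n, (k * ((s₁.nat 1 j 0 + 1) * 44 + 26) + 28) =
      k * 44 * nnz A + n * (k * 70 + 28) := by
    rw [f1.nat 1 (by decide), ← h.sum_counts, Finset.mul_sum]
    calc _ = ∑ j ∈ Finset.range n, (k * 44 * s.nat 1 j 0 + (k * 70 + 28)) :=
          Finset.sum_congr rfl fun j _ => by ring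
      _ = _ := by simp [Finset.sum_add_distrib]
  refine Runs.seq ((Runs.coordCols (n := n) (k := k) (by rw [f1.nat 0 (by decide), h.size_n])
    (by rw [f1.nat 0 (by decide), h.size_k])).mono (by rw [hcnt]) fun _ h => h) ?_
    (B₂ := (r * (k * ((m + 1) * 34 + 26) + 28) + 12)
    + ((r + 1) * (r * (k * 130 + 106) + 30) + 14) + (k * 80 + 60) + (d * ((k + 1) * 36 + 24) + 12)
    + (n * ((k + 1) * 36 + 24) + 12) + (Nat.clog 2 n + 1) * (n * 300 + 60) + (m * 150 + 150))
    (by omega)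
  rintro s₂ ⟨f2, h3⟩
  have hc : ∀ (j : Fin n) (l : Fin k), s₂.real 3 j l = inner ℝ (q l) (col A j) := by
    intro j l
    rw [h3 j j.2 l l.2, f1.nat 1 (by decide), f1.nat 2 (by decide), f1.real 0 (by decide),
      f1.real 1 (by decide), h.inner_col]
  have hg2 : s₂.real 4 r = s₁.real 4 r := by rw [f2.real 4 (by decide)]
  replace f2 := f1.trans (f2.mono (by decide) (by decide))
  refine Runs.seq (Runs.coordSums (r := r) (k := k) (m := m) (by rw [f2.nat 0 (by decide), h.size_r])
    (by rw [f2.nat 0 (by decide), h.size_k]) (by rw [f2.nat 0 (by decide), h.size_m])) ?_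
    (B₂ := ((r + 1) * (r * (k * 130 + 106) + 30) + 14) + (k * 80 + 60)
    + (d * ((k + 1) * 36 + 24) + 12) + (n * ((k + 1) * 36 + 24) + 12)
    + (Nat.clog 2 n + 1) * (n * 300 + 60) + (m * 150 + 150)) (by omega)
  rintro s₃ ⟨f3, h4, hg3⟩
  have hb : ∀ (t : Fin r) (l : Fin k), headVec k (s₃.real 4 t) l =
      ∑ j ∈ R t, inner ℝ (q l) (col A j) := by
    intro t l
    change s₃.real 4 t l = _
    rw [h4 t t.2 l l.2, f2.nat 3 (by decide), (h.sets t).sum fun j => s₂.real 3 j l]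
    exact Finset.sum_congr rfl fun j _ => hc j l
  have hg4 : headVec k (s₃.real 4 r) = WithLp.toLp 2 fun l : Fin k => ω l := by
    rw [hg3, hg2]
    exact headVec_congr hg
  have e3 : s₃.real 3 = s₂.real 3 := f3.real 3 (by decide)
  replace f3 := f2.trans (f3.mono (by decide) (by decide))
  refine Runs.seq (Runs.orthogonalize (r := r) (k := k) (by rw [f3.nat 0 (by decide), h.size_k])
    (by rw [f3.nat 0 (by decide), h.size_r])) ?_
    (B₂ := (k * 80 + 60) + (d * ((k + 1) * 36 + 24) + 12) + (n * ((k + 1) * 36 + 24) + 12)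
    + (Nat.clog 2 n + 1) * (n * 300 + 60) + (m * 150 + 150)) (by omega)
  rintro s₄ ⟨f4, h5⟩
  rw [gramSchmidt_eq_starProjection, hg4] at h5
  have e4 : s₄.real 3 = s₂.real 3 := by rw [f4.real 3 (by decide), e3]
  replace f4 := f3.trans (f4.mono (by decide) (by decide))
  refine Runs.seq (Runs.normalize (r := r) (k := k) (by rw [f4.nat 0 (by decide), h.size_k])
    (by rw [f4.nat 0 (by decide), h.size_r])) ?_
    (B₂ := (d * ((k + 1) * 36 + 24) + 12) + (n * ((k + 1) * 36 + 24) + 12)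
    + (Nat.clog 2 n + 1) * (n * 300 + 60) + (m * 150 + 150)) (by omega)
  rintro s₅ ⟨f5, h6⟩
  -- The last Gram–Schmidt vector is the coordinate vector of the projected Gaussian, and the
  -- isometry preserves the norm used to normalize it.
  have hu : synth hq (headVec k (s₅.real 7 0)) = randomDir A R q ω := by
    have hx : ∑ l : Fin k, ω l • q l = synth hq (WithLp.toLp 2 fun l : Fin k => ω l) := by
      simp [synth_apply]
    rw [randomDir, hx, starProjection_residual hq hm hR (F := fun t => headVec k (s₃.real 4 t)) hb,
      h6, h5, map_smul, LinearIsometry.norm_map]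
  have e5 : s₅.real 3 = s₂.real 3 := by rw [f5.real 3 (by decide), e4]
  replace f5 := f4.trans (f5.mono (by decide) (by decide))
  refine Runs.seq (Runs.assemble (d := d) (k := k) (by rw [f5.nat 0 (by decide), h.size_d])
    (by rw [f5.nat 0 (by decide), h.size_k])) ?_
    (B₂ := (n * ((k + 1) * 36 + 24) + 12)
    + (Nat.clog 2 n + 1) * (n * 300 + 60) + (m * 150 + 150)) (by omega)
  rintro s₆ ⟨f6, h7⟩
  have hout : ∀ i : Fin d, s₆.real 2 i 0 = randomDir A R q ω i := by
    intro i
    rw [h7 i i.2, ← hu, synth_apply, Finset.sum_range]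
    simp only [WithLp.ofLp_sum, Finset.sum_apply, WithLp.ofLp_smul, Pi.smul_apply, smul_eq_mul]
    refine Finset.sum_congr rfl fun l _ => ?_
    rw [f5.real 1 (by decide), h.basis]
    rfl
  have e6 : s₆.real 3 = s₂.real 3 := by rw [f6.real 3 (by decide), e5]
  have e7 : s₆.real 7 = s₅.real 7 := f6.real 7 (by decide)
  replace f6 := f5.trans (f6.mono (by decide) (by decide))
  refine Runs.seq (Runs.columnKeys (n := n) (k := k) (by rw [f6.nat 0 (by decide), h.size_n])
    (by rw [f6.nat 0 (by decide), h.size_k])) ?_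
    (B₂ := (Nat.clog 2 n + 1) * (n * 300 + 60) + (m * 150 + 150)) (by omega)
  rintro s₇ ⟨f7, h8⟩
  -- As `u` lies in `V`, its inner products with the columns are computed from `k` coordinates
  -- instead of `d`.
  have hkey : ∀ j : Fin n, s₇.real 8 0 j = inner ℝ (randomDir A R q ω) (col A j) := by
    intro j
    rw [h8 j j.2, e6, e7, ← hu, inner_synth, Finset.sum_range]
    exact Finset.sum_congr rfl fun l _ => by rw [hc]; rfl
  have o7 : s₇.real 2 = s₆.real 2 := f7.real 2 (by decide)
  replace f7 := f6.trans (f7.mono (by decide) (by decide))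
  have hn7 : s₇.nat 0 0 1 = n := by rw [f7.nat 0 (by decide), h.size_n]
  refine Runs.seq (Runs.sortCols hn7) ?_ (B₂ := m * 150 + 150) (by omega)
  rintro s₈ ⟨f8, hperm, hsort⟩
  have o8 : s₈.real 2 = s₆.real 2 := by rw [f8.real 2 (by decide), o7]
  refine (Runs.selectSet (n := n) (m := m) _ (s₇.real 8 0) (by rw [f8.nat 0 (by decide), hn7])
    (by rw [f8.nat 0 (by decide), f7.nat 0 (by decide), h.size_m]) rfl
    (by rw [f8.real 8 (by decide)])).mono le_rfl ?_
  rintro s₉ ⟨f9, hsel⟩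
  obtain ⟨S, hS, hmax⟩ := exists_lists_select hsort hperm hmn hsel
  simp only [hkey] at hmax
  refine ⟨S, isArgmax_of_sum hS.card hmax, fun i => ?_, hS⟩
  rw [f9.real 2 (by decide), o8, hout]

end Step

/-! ### The running time and the theorem. -/

lemma natCast_clog_le (n : ℕ) : (Nat.clog 2 n : ℝ) ≤ 2 * Real.log n + 1 := by
  have h2 : (1 / 2 : ℝ) ≤ Real.log 2 := by
    have := Real.log_two_gt_d9; linarith
  have hn : 0 ≤ Real.log n := Real.log_natCast_nonneg n
  rw [← Real.natCeil_logb_natCast 2 n, Nat.cast_ofNat]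
  refine (Nat.ceil_lt_add_one (div_nonneg hn (by linarith))).le.trans ?_
  have : Real.logb 2 n ≤ 2 * Real.log n := by
    rw [Real.logb, div_le_iff₀ (by linarith)]
    nlinarith
  exact add_le_add_left this 1

/-- With `X = log(n + d + k)/(αδ)`, the relations `k ≤ 1/δ ≤ X`, `n = m/δ ≤ 2X nnz(A)` and `k ≤ d`
bound each monomial of `stepBound` by a multiple of `X² (nnz(A) + dk)`. The exponent `3` leaves
slack. -/
lemma IsStep.stepBound_le {d n k r m : ℕ} {A P : Matrix (Fin d) (Fin n) ℝ}
    {M : Matrix (Fin d) (Fin k) ℝ} {α δ : ℝ} {R : Fin r → Finset (Fin n)} {L : Fin r → Fin k}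
    {v : OrthonormalBasis (Fin d) ℝ (Eu d)} {V : Submodule ℝ (Eu d)}
    (h : IsStep A P M α δ m R L v V) :
    (stepBound d n k r m (nnz A) : ℝ) ≤
      10000 * (Real.log (n + d + k) / (α * δ)) ^ 3 * (nnz A + d * k) := by
  have hα := h.α_pos
  have hα1 := h.α_lt
  have hδ := h.δ_pos
  have hk : (2 : ℝ) ≤ k := h.two_le_real
  have hm : (1 : ℝ) ≤ m := by exact_mod_cast h.m_pos
  have hd : (k : ℝ) ≤ d := by exact_mod_cast h.k_le_d
  have hr : (r : ℝ) + 1 ≤ k := by exact_mod_cast h.r_lt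
  have hkm : (k : ℝ) * m ≤ n := by exact_mod_cast h.card_mul_le
  have hmN : (m : ℝ) ≤ 2 * nnz A := by exact_mod_cast h.m_le_nnz
  have hmδ : (m : ℝ) = δ * n := h.m_eq
  have hn : (2 : ℝ) ≤ n := by nlinarith
  have hclog := natCast_clog_le n
  have hr0 : (0 : ℝ) ≤ r := r.cast_nonneg
  rw [stepBound]
  push_cast
  set c : ℝ := (Nat.clog 2 n : ℝ)
  set N : ℝ := (nnz A : ℝ)
  generalize (n : ℝ) = n at *
  generalize (d : ℝ) = d at *
  generalize (k : ℝ) = k at *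
  generalize (r : ℝ) = r at *
  generalize (m : ℝ) = m at *
  have hc : 0 ≤ c := Nat.cast_nonneg _
  clear_value c N
  set l := Real.log (n + d + k) with hl
  -- All of `n`, `d`, `k` are at least `2`, so their sum exceeds `e`.
  have hl1 : 1 ≤ l := by
    rw [hl, Real.le_log_iff_exp_le (by linarith)]
    linarith [Real.exp_one_lt_d9]
  have hcl : c ≤ 3 * l := by
    have : Real.log n ≤ l := Real.log_le_log (by linarith) (by linarith)
    linarith
  set X := l / (α * δ) with hX
  have hδinv : 0 < δ⁻¹ := inv_pos.2 hδ
  have hlX : l * δ⁻¹ ≤ X := by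
    rw [hX, div_eq_mul_inv, mul_inv]
    refine mul_le_mul_of_nonneg_left ?_ (by linarith)
    exact le_mul_of_one_le_left hδinv.le ((one_le_inv₀ hα).2 hα1.le)
  have hkδ : k ≤ δ⁻¹ := by
    rw [← one_div, le_div_iff₀ hδ]
    have : k * δ * n ≤ 1 * n := by rw [hmδ] at hkm; linarith
    exact le_of_mul_le_mul_right this (by linarith)
  have hδX : δ⁻¹ ≤ X := le_trans (le_mul_of_one_le_left hδinv.le hl1) hlX
  have hkX : k ≤ X := hkδ.trans hδX
  have hN : 0 ≤ N := by linarith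
  have hnm : n = m * δ⁻¹ := by rw [hmδ]; field_simp
  have hnN : n ≤ 2 * (δ⁻¹ * N) := by
    calc n = m * δ⁻¹ := hnm
      _ ≤ 2 * N * δ⁻¹ := by gcongr
      _ = _ := by ring
  have hX1 : 1 ≤ X := by linarith
  have hX0 : 0 ≤ X := by linarith
  have hk0 : 0 ≤ k := by linarith
  have hd0 : 0 ≤ d := by linarith
  have hn0 : 0 ≤ n := by linarith
  set Z := X ^ 3 * (N + d * k) with hZ
  have hdk : 0 ≤ d * k := mul_nonneg hd0 hk0
  have hX2 : X ≤ X ^ 2 := le_self_pow₀ hX1 (by norm_num)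
  have z1 : N * X ^ 2 + d * k * X ^ 2 ≤ Z := by
    calc _ = X ^ 2 * (N + d * k) := by ring
      _ ≤ _ := mul_le_mul_of_nonneg_right (pow_le_pow_right₀ hX1 (by norm_num)) (by positivity)
  have b2 : N * X ≤ N * X ^ 2 := mul_le_mul_of_nonneg_left hX2 hN
  have b1 : k * N ≤ N * X ^ 2 := by
    rw [mul_comm]
    exact mul_le_mul_of_nonneg_left (hkX.trans hX2) hN
  have b3 : N ≤ N * X ^ 2 := le_mul_of_one_le_right hN (one_le_pow₀ hX1)
  have b4 : d * k ≤ d * k * X ^ 2 := le_mul_of_one_le_right hdk (one_le_pow₀ hX1)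
  have b5 : n ≤ 2 * (N * X) := by
    rw [mul_comm N]
    exact hnN.trans (mul_le_mul_of_nonneg_left (mul_le_mul_of_nonneg_right hδX hN) (by norm_num))
  have b6 : n * k ≤ 2 * (N * X ^ 2) := by
    calc n * k ≤ 2 * (N * X) * X := by gcongr
      _ = _ := by ring
  have b7 : k * k * m ≤ n * k := by
    calc k * k * m = k * m * k := by ring
      _ ≤ _ := by gcongr
  have b8 : k * k * k ≤ d * k * X ^ 2 := by
    calc k * k * k ≤ d * k * X := by gcongr
      _ ≤ _ := by gcongr
  have b9 : k * k ≤ d * k := by gcongr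
  have b10 : k ≤ k * k := le_mul_of_one_le_left hk0 (by linarith)
  have b11 : d ≤ d * k := le_mul_of_one_le_right hd0 (by linarith)
  have b12 : c * n ≤ 6 * (N * X) := by
    calc c * n ≤ 3 * l * (2 * (δ⁻¹ * N)) := by gcongr
      _ = 6 * (N * (l * δ⁻¹)) := by ring
      _ ≤ _ := by gcongr
  have b13 : c ≤ c * n := le_mul_of_one_le_right hc (by linarith)
  have t1 : r * (k * ((m + 1) * 34 + 26) + 28) ≤ k * (k * ((m + 1) * 34 + 26) + 28) := by
    gcongr; linarith
  have t2 : (r + 1) * (r * (k * 130 + 106) + 30) ≤ k * (k * (k * 130 + 106) + 30) := by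
    gcongr; linarith
  have e : 10000 * X ^ 3 * (N + d * k) = 10000 * Z := by rw [hZ]; ring
  rw [e]
  linarith

end LatentSimplex

open LatentSimplex MeasureTheory in
theorem theorem6 :
    ∃ (c : ℝ) (step : Prog) (C : ℝ) (e : ℕ),
      ∀ (d n k r m : ℕ) (A P : Matrix (Fin d) (Fin n) ℝ) (M : Matrix (Fin d) (Fin k) ℝ) (α δ : ℝ),
        2 ≤ k → 0 < n → 0 < α → α < 1 → 0 < δ → (m : ℝ) = δ * n →
        LinearIndependent ℝ (col M) →
        LatentPoints P M →
        WellSeparated M α →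
        ProximateLatentPoints A P M δ →
        SpectrallyBounded A P M α δ →
      ∀ (R : Fin r → Finset (Fin n)) (L : Fin r → Fin k),
        r < k → (∀ t, (R t).card = m) → Function.Injective L →
        (∀ t, ‖avgCol A (R t) - col M (L t)‖ ≤ errBound A P k α δ) →
      ∀ (v : OrthonormalBasis (Fin d) ℝ (Eu d)) (V : Submodule ℝ (Eu d)),
        IsLeftSingularBasis A v → Module.finrank ℝ V = k →
        sinTheta V (topSpan v k) ≤ α ^ 2 / (1000 * (k : ℝ) ^ 9) →
        -- the subspace has dimension `k - r`
        Module.finrank ℝ (residual A V R) + r = k ∧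
        -- with high probability every maximizer gives a new vertex
        ENNReal.ofReal (1 - c / (k : ℝ) ^ (3 / 2 : ℝ)) ≤
          unifSphere (residual A V R)
            {u | ∀ S : Finset (Fin n), IsArgmax A m u S →
              ∃ ℓ, ℓ ∉ Set.range L ∧ ‖col M ℓ - avgCol A S‖ ≤ errBound A P k α δ} ∧
        -- the random choice and the maximization take time `O*(nnz(A) + d k)`
        ∀ (q : Fin k → Eu d) (s : State),
          Orthonormal ℝ q → Submodule.span ℝ (Set.range q) = V → IsInput A m R q s →
          ∃ (u : (ℕ → ℝ) → Eu d) (S : (ℕ → ℝ) → Finset (Fin n)),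
            Measure.map u gaussTape = unifSphere (residual A V R) ∧
            ∀ ω : ℕ → ℝ, IsArgmax A m (u ω) (S ω) ∧
              ∃ (t : ℕ) (s' : State), Exec ω step s t s' ∧ IsOutput m (u ω) (S ω) s' ∧
                (t : ℝ) ≤ C * (Real.log (n + d + k) / (α * δ)) ^ e * (nnz A + d * k) := by
  -- The `10` is the constant of the failure probability; `10000` and `3` come from
  -- `IsStep.stepBound_le`.
  refine ⟨10, step, 10000, 3, ?_⟩
  intro d n k r m A P M α δ hk hn hα hα1 hδ hm hM hP hsep hprox hspec R L hr hR hL hnear v V hv hV hsin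
  have h : IsStep A P M α δ m R L v V :=
    { two_le := hk, n_pos := hn, α_pos := hα, α_lt := hα1, δ_pos := hδ, m_eq := hm, indep := hM,
      latent := hP, sep := hsep, prox := hprox, spec := hspec, r_lt := hr, card_R := hR, inj := hL,
      near := hnear, sing := hv, rank_V := hV, sin_le := hsin }
  refine ⟨h.finrank_residual, h.prob_ge, ?_⟩
  rintro q s hq rfl hin
  have hmn : m ≤ n := (Nat.le_mul_of_pos_left m (by omega)).trans h.card_mul_le
  choose t s' hexec hcost S hmax hout using fun ω => Runs.step hq hin h.m_pos hmn hR ω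
  refine ⟨randomDir A R q, S, ?_, fun ω => ⟨hmax ω, t ω, s' ω, hexec ω, hout ω, ?_⟩⟩
  · exact map_gaussTape_eq_unifSphere hq _ h.finrank_residual_pos inf_le_left
  · exact (Nat.cast_le.2 (hcost ω)).trans h.stepBound_le
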